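/- Let $n,m\ge 1$, $N=n+m$, and write points of $\mathbb R^N=\mathbb R^n\times\mathbb R^m$ as $z=(x,y)$. Let $L$ be the operator $Lf=\sum_{i,j=1}^N\partial_{z_i}(a_{ij}\,\partial_{z_j}f)$ with real measurable coefficients and symmetric matrix $(a_{ij})$ satisfying, for almost every $z$ and all $\zeta=(\xi,\eta)\in\mathbb R^n\times\mathbb R^m$, $$v(z)\,(|\xi|^2+\lambda(x)^2|\eta|^2)\le\sum_{i,j}a_{ij}(z)\zeta_i\zeta_j\le u(z)\,(|\xi|^2+\lambda(x)^2|\eta|^2).$$ Assumptions on $\lambda,u,v$: * (H1) $\lambda:\mathbb R^n\to[0,\infty)$ is continuous and its zeros are isolated; * (H2) $\int_{2B}\lambda\,dx\le C_1\int_B\lambda\,dx$ and (H3) $\sup_B\lambda\le C_2|B|^{-1}\int_B\lambda\,dx$ for every Euclidean ball $B\subset\mathbb R^n$; * $u,v$ are non-negative, non-trivial, locally integrable functions on $\mathbb R^N$, with $u(2B)\le C_3u(B)$ and $v(2B)\le C_4v(B)$ for every $\rho$-ball $B$. Here $w(E)=\int_E w\,dz$, and $\rho(z,w)$ is the infimum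 of all $T\ge0$ such that $z$ and $w$ are joined by an absolutely continuous curve $\gamma$ with domain $[0,T]$ satisfying $\langle\gamma'(t),\zeta\rangle^2\le|\xi|^2+\lambda^2|\eta|^2$ ($\lambda$ evaluated at the $x$-component of $\gamma(t)$) for almost every $t$ and all $\zeta=(\xi,\eta)$; * (SP) with a fixed exponent $q>2$, for every Lipschitz function $g$ on $\mathbb R^N$ and every $\rho$-ball $B$ of radius $r$, $$\Big[\frac1{u(B)}\int_B|g-m_B(g)|^q u\,dz\Big]^{1/q}\le C_5\,r\Big[\frac1{v(B)}\int_B\big(|\nabla_xg|^2+\lambda^2|\nabla_yg|^2\big)v\,dz\Big]^{1/2},\qquad m_B(g)=\frac1{u(B)}\int_Bgu\,dz.$$ Put $\Lambda(z_0,r)=\sup_{|x-x_0|<r}\lambda(x)$ and $Q(z_0,r)=\{(x,y):|x-x_0|<r,\ |y-y_0|<r\Lambda(z_0,r)\}$. For $Q=Q(z_0,h)$ let $aQ=Q(z_0,ah)$ and $\mu(Q)=u(Q)^{1/2}v(Q)^{-1/2}$. For a bounded open set $\Omega$, let $H(\Omega)$ be the completion of the space $\mathrm{Lip}(\overline\Omega)$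 of Lipschitz functions on $\overline\Omega$ for the norm $\|f\|_H^2=a_0(f,f)+\int_\Omega f^2u\,dz$, where $a_0(f,g)=\sum_{i,j}\int_\Omega a_{ij}\,\partial_if\,\partial_jg\,dz$, and extend $a_0$ to $H(\Omega)$ by continuity. Let $H_0(\Omega)$ be the closure in $H(\Omega)$ of the Lipschitz functions with compact support in $\Omega$, and let $f\mapsto\tilde f$ be the natural map $H(\Omega)\to L^2(\Omega,u\,dz)$. An element $f\in H(\Omega)$ is a weak solution of $Lf=0$ if $a_0(f,\theta)=0$ for all $\theta\in H_0(\Omega)$. It is non-negative if it is the limit in $H(\Omega)$ of non-negative functions of $\mathrm{Lip}(\overline\Omega)$. **Proposition.** There are constants $C_{14}>0$ and $\delta>0$, depending only on $C_1,\dots,C_5,q,m,n$, such that for all $\lambda,u,v,(a_{ij})$ as above, all $z_0\in\mathbb R^N$ and $h>0$, every non-negative weak solution $f\in H(Q)$ of $Lf=0$ in $Q=Q(z_0,h)$, every $a\in[\frac12,1)$ and every real $p\ne0$, $$\Big(\operatorname*{ess\,sup}_{aQ}\tilde f\Big)^p\le\frac{C_{14}}{(1-a)^{\delta}}\,[1+|p|\mu(Q)]^{\frac{2q}{q-2}}\,\frac1{u(Q)}\int_Q\tilde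 f^{\,p}u\,dz ,$$ and, if $p<0$, also $$\Big(\operatorname*{ess\,inf}_{aQ}\tilde f\Big)^p\le\frac{C_{14}}{(1-a)^{\delta}}\,[1+|p|\mu(Q)]^{\frac{2q}{q-2}}\,\frac1{u(Q)}\int_Q\tilde f^{\,p}u\,dz .$$ The essential supremum and infimum are taken with respect to $u\,dz$, and for $p<0$ we use $0^p=\infty$; the right-hand sides may be infinite. -/

import Mathlib

open MeasureTheory Set Filter Topology
open scoped ENNReal NNReal

noncomputable section

namespace Grushin

/-! ### The space `ℝⁿ × ℝᵐ`, gradients and rectangles -/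

/-- `ℝᴺ = ℝⁿ × ℝᵐ`; a point is `z = (x, y)`. Both factors are Euclidean, and `volume` is the
Lebesgue measure. -/
abbrev Space (n m : ℕ) : Type := EuclideanSpace ℝ (Fin n) × EuclideanSpace ℝ (Fin m)

/-- Indices of the `N = n + m` coordinates: `Sum.inl i` is `xᵢ` and `Sum.inr j` is `yⱼ`. -/
abbrev Idx (n m : ℕ) : Type := Fin n ⊕ Fin m

variable {n m : ℕ}

/-- The coordinate vectors of `ℝⁿ × ℝᵐ`. -/
def basisVec : Idx n m → Space n m
  | Sum.inl i => (EuclideanSpace.single i 1, 0)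
  | Sum.inr j => (0, EuclideanSpace.single j 1)

/-- The coordinates of a vector of `ℝⁿ × ℝᵐ`. -/
def coords (z : Space n m) : Idx n m → ℝ
  | Sum.inl i => z.1 i
  | Sum.inr j => z.2 j

/-- The vector of the partial derivatives `∂g/∂zᵢ` at `z`. -/
def grad (g : Space n m → ℝ) (z : Space n m) : Idx n m → ℝ :=
  fun i => fderiv ℝ g z (basisVec i)

/-- `|ξ|² + λ(x)² |η|²` for `ζ = (ξ, η)`. -/
def degNormSq (lam : EuclideanSpace ℝ (Fin n) → ℝ) (x : EuclideanSpace ℝ (Fin n))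
    (ζ : Idx n m → ℝ) : ℝ :=
  ∑ i : Fin n, ζ (Sum.inl i) ^ 2 + lam x ^ 2 * ∑ j : Fin m, ζ (Sum.inr j) ^ 2

/-- `∑ᵢⱼ aᵢⱼ ζᵢ ζ'ⱼ`. -/
def bilin (A : Matrix (Idx n m) (Idx n m) ℝ) (ζ ζ' : Idx n m → ℝ) : ℝ :=
  ∑ i, ∑ j, A i j * ζ i * ζ' j

/-- `Λ(z₀, r)`, the supremum of `λ` over the ball `|x - x₀| < r`. -/
def Lam (lam : EuclideanSpace ℝ (Fin n) → ℝ) (z₀ : Space n m) (r : ℝ) : ℝ :=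
  sSup (lam '' Metric.ball z₀.1 r)

/-- The rectangle `Q(z₀, r)`. For `Q = Q(z₀, r)` and `t > 0`, the rectangle `t Q` is
`Q(z₀, t r)`. -/
def rect (lam : EuclideanSpace ℝ (Fin n) → ℝ) (z₀ : Space n m) (r : ℝ) : Set (Space n m) :=
  Metric.ball z₀.1 r ×ˢ Metric.ball z₀.2 (r * Lam lam z₀ r)

/-! ### The metric of the Grushin-type vector fields -/

/-- An absolutely continuous curve `γ : [0, T] → ℝᴺ` that is subunit for `λ`. -/
def IsSubunit (lam : EuclideanSpace ℝ (Fin n) → ℝ) (T : ℝ) (γ : ℝ → Space n m) : Prop :=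
  AbsolutelyContinuousOnInterval γ 0 T ∧
    ∀ᵐ t : ℝ, t ∈ Ioo 0 T → ∀ ζ : Idx n m → ℝ,
      (∑ i, coords (deriv γ t) i * ζ i) ^ 2 ≤ degNormSq lam (γ t).1 ζ

/-- `ρ(z, w)`, the infimum of all `T ≥ 0` for which some subunit curve with domain `[0, T]` joins
`z` to `w` (it would be `∞` if there were none). -/
def rho (lam : EuclideanSpace ℝ (Fin n) → ℝ) (z w : Space n m) : ℝ≥0∞ :=
  ⨅ T : {T : ℝ≥0 // ∃ γ : ℝ → Space n m, IsSubunit lam T γ ∧ γ 0 = z ∧ γ T = w},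
    ((T : ℝ≥0) : ℝ≥0∞)

/-- The `ρ`-ball `B(z, r)`. -/
def rhoBall (lam : EuclideanSpace ℝ (Fin n) → ℝ) (z : Space n m) (r : ℝ) : Set (Space n m) :=
  {w | rho lam z w < ENNReal.ofReal r}

/-! ### Weights and the quantitative hypotheses -/

/-- The measure `w(z) dz`; thus `w(E) = weightMeasure w E`. -/
def weightMeasure (w : Space n m → ℝ) : Measure (Space n m) :=
  volume.withDensity fun z => ENNReal.ofReal (w z)

/-- A weight: a non-negative, non-trivial, locally integrable function. -/
structure IsWeight (w : Space n m → ℝ) : Prop where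
  nonneg : ∀ z, 0 ≤ w z
  nontrivial : ¬ w =ᵐ[volume] 0
  locallyIntegrable : LocallyIntegrable w volume

/-- Hypothesis (H1): `λ` is non-negative, continuous, and all its zeros are isolated. -/
structure IsGrushinFunction (lam : EuclideanSpace ℝ (Fin n) → ℝ) : Prop where
  nonneg : ∀ x, 0 ≤ lam x
  continuous : Continuous lam
  isolated : ∀ x, lam x = 0 → ∀ᶠ x' in 𝓝[≠] x, lam x' ≠ 0

/-- Hypothesis (H2): `λ` is doubling for the Euclidean balls, with constant `C`. -/
def IsLebesgueDoubling (C : ℝ) (lam : EuclideanSpace ℝ (Fin n) → ℝ) : Prop :=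
  ∀ x : EuclideanSpace ℝ (Fin n), ∀ r : ℝ, 0 < r →
    ∫ x' in Metric.ball x (2 * r), lam x' ≤ C * ∫ x' in Metric.ball x r, lam x'

/-- Hypothesis (H3): the supremum of `λ` over a Euclidean ball is at most `C` times its average. -/
def SupLeAverage (C : ℝ) (lam : EuclideanSpace ℝ (Fin n) → ℝ) : Prop :=
  ∀ x : EuclideanSpace ℝ (Fin n), ∀ r : ℝ, 0 < r → ∀ x₁ ∈ Metric.ball x r,
    lam x₁ ≤ C * ((volume.real (Metric.ball x r))⁻¹ * ∫ x' in Metric.ball x r, lam x')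

/-- The weight `w` is doubling for the `ρ`-balls, with constant `C`. -/
def IsRhoDoubling (C : ℝ) (lam : EuclideanSpace ℝ (Fin n) → ℝ) (w : Space n m → ℝ) : Prop :=
  ∀ z : Space n m, ∀ r : ℝ, 0 < r →
    weightMeasure w (rhoBall lam z (2 * r)) ≤
      ENNReal.ofReal C * weightMeasure w (rhoBall lam z r)

/-- The `w`-average `m_E(g)` of `g` over `E`. -/
def wAverage (w : Space n m → ℝ) (E : Set (Space n m)) (g : Space n m → ℝ) : ℝ :=
  ((weightMeasure w).real E)⁻¹ * ∫ z in E, g z ∂(weightMeasure w)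

/-- Hypothesis (SP): the Sobolev–Poincaré inequality, with exponent `q` and constant `C`, for all
Lipschitz functions and all `ρ`-balls. -/
def SobolevPoincare (q C : ℝ) (lam : EuclideanSpace ℝ (Fin n) → ℝ) (u v : Space n m → ℝ) : Prop :=
  ∀ g : Space n m → ℝ, (∃ K : ℝ≥0, LipschitzWith K g) → ∀ z₀ : Space n m, ∀ r : ℝ, 0 < r →
    ((weightMeasure u (rhoBall lam z₀ r))⁻¹ *
        ∫⁻ z in rhoBall lam z₀ r,
          ENNReal.ofReal (|g z - wAverage u (rhoBall lam z₀ r) g| ^ q) ∂(weightMeasure u)) ^ (1 / q)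
      ≤ ENNReal.ofReal (C * r) *
        ((weightMeasure v (rhoBall lam z₀ r))⁻¹ *
          ∫⁻ z in rhoBall lam z₀ r,
            ENNReal.ofReal (degNormSq lam z.1 (grad g z)) ∂(weightMeasure v)) ^ (1 / 2 : ℝ)

/-! ### The operator -/

/-- The data of `L f = ∑ᵢⱼ ∂ᵢ (aᵢⱼ ∂ⱼ f)`: a function `λ` with (H1), weights `u` and `v`, and a
symmetric matrix of measurable coefficients with the degenerate ellipticity condition. -/
structure DegenerateOperator (n m : ℕ) where
  lam : EuclideanSpace ℝ (Fin n) → ℝ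
  u : Space n m → ℝ
  v : Space n m → ℝ
  A : Space n m → Matrix (Idx n m) (Idx n m) ℝ
  isGrushin : IsGrushinFunction lam
  weight_u : IsWeight u
  weight_v : IsWeight v
  measurable_A : ∀ i j, AEMeasurable (fun z => A z i j) volume
  symm_A : ∀ z, (A z).IsSymm
  elliptic : ∀ᵐ z : Space n m, ∀ ζ : Idx n m → ℝ,
    v z * degNormSq lam z.1 ζ ≤ bilin (A z) ζ ζ ∧ bilin (A z) ζ ζ ≤ u z * degNormSq lam z.1 ζ

/-- The quantitative hypotheses, with the constants that enter them. -/
structure Admissible (C₁ C₂ C₃ C₄ C₅ q : ℝ) (L : DegenerateOperator n m) : Prop where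
  doubling_lam : IsLebesgueDoubling C₁ L.lam
  sup_lam : SupLeAverage C₂ L.lam
  doubling_u : IsRhoDoubling C₃ L.lam L.u
  doubling_v : IsRhoDoubling C₄ L.lam L.v
  sobolev : SobolevPoincare q C₅ L.lam L.u L.v

/-- A bounded open subset of `ℝⁿ × ℝᵐ`. -/
structure BoundedOpen (n m : ℕ) where
  carrier : Set (Space n m)
  isOpen : IsOpen carrier
  isBounded : Bornology.IsBounded carrier

/-! ### Lipschitz functions on the closure of a bounded open set -/

/-- The functions that are Lipschitz on `closure Ω`. (Values outside `closure Ω` do not matter: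
the seminorm below does not see them.) -/
def lipSubmodule (Ω : BoundedOpen n m) : Submodule ℝ (Space n m → ℝ) where
  carrier := {f | ∃ K : ℝ≥0, LipschitzOnWith K f (closure Ω.carrier)}
  add_mem' := by
    rintro f g ⟨K, hK⟩ ⟨K', hK'⟩
    exact ⟨K + K', hK.add hK'⟩
  zero_mem' := ⟨0, (LipschitzWith.const (0 : ℝ)).lipschitzOnWith⟩
  smul_mem' := by
    rintro c f ⟨K, hK⟩
    refine ⟨‖c‖₊ * K, ?_⟩
    rw [lipschitzOnWith_iff_norm_sub_le] at hK ⊢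
    intro x hx y hy
    have := hK hx hy
    simp only [Pi.smul_apply, smul_eq_mul, ← mul_sub, norm_mul, NNReal.coe_mul, coe_nnnorm,
      mul_assoc]
    exact mul_le_mul_of_nonneg_left this (norm_nonneg c)

/-- `Lip(closure Ω)`, to be equipped with the seminorm of `H(Ω)`, which depends on `L`. -/
def LipSpace (_L : DegenerateOperator n m) (Ω : BoundedOpen n m) : Type := ↥(lipSubmodule Ω)

variable (L : DegenerateOperator n m) (Ω : BoundedOpen n m)

instance : AddCommGroup (LipSpace L Ω) := inferInstanceAs (AddCommGroup ↥(lipSubmodule Ω))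
instance : Module ℝ (LipSpace L Ω) := inferInstanceAs (Module ℝ ↥(lipSubmodule Ω))
instance : CoeFun (LipSpace L Ω) (fun _ => Space n m → ℝ) := ⟨Subtype.val⟩

variable {L Ω}

theorem LipSpace.coe_add (f g : LipSpace L Ω) : (⇑(f + g) : Space n m → ℝ) = ⇑f + ⇑g := rfl
theorem LipSpace.coe_smul (c : ℝ) (f : LipSpace L Ω) : (⇑(c • f) : Space n m → ℝ) = c • ⇑f := rfl

/-- `a₀(f, g) = ∑ᵢⱼ ∫_Ω aᵢⱼ ∂ᵢf ∂ⱼg` for Lipschitz functions. -/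
def dirichlet (f g : LipSpace L Ω) : ℝ :=
  ∫ z in Ω.carrier, bilin (L.A z) (grad f z) (grad g z)

/-- `∫_Ω f g u` for Lipschitz functions. -/
def massForm (f g : LipSpace L Ω) : ℝ :=
  ∫ z in Ω.carrier, f z * g z ∂(weightMeasure L.u)


/-! ### The seminorm of `H(Ω)` comes from a positive semidefinite form -/

theorem bilin_comm {A : Matrix (Idx n m) (Idx n m) ℝ} (hA : A.IsSymm) (ζ ζ' : Idx n m → ℝ) :
    bilin A ζ ζ' = bilin A ζ' ζ := by
  unfold bilin
  rw [Finset.sum_comm]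
  refine Finset.sum_congr rfl fun i _ => Finset.sum_congr rfl fun j _ => ?_
  rw [← hA.apply i j]; ring

theorem bilin_add_left (A : Matrix (Idx n m) (Idx n m) ℝ) (ζ ζ' ζ'' : Idx n m → ℝ) :
    bilin A (ζ + ζ') ζ'' = bilin A ζ ζ'' + bilin A ζ' ζ'' := by
  simp only [bilin, ← Finset.sum_add_distrib, Pi.add_apply]
  refine Finset.sum_congr rfl fun i _ => Finset.sum_congr rfl fun j _ => ?_
  ring

theorem bilin_smul_left (A : Matrix (Idx n m) (Idx n m) ℝ) (c : ℝ) (ζ ζ' : Idx n m → ℝ) :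
    bilin A (c • ζ) ζ' = c * bilin A ζ ζ' := by
  simp only [bilin, Finset.mul_sum, Pi.smul_apply, smul_eq_mul]
  refine Finset.sum_congr rfl fun i _ => Finset.sum_congr rfl fun j _ => ?_
  ring

theorem degNormSq_nonneg (lam : EuclideanSpace ℝ (Fin n) → ℝ) (x : EuclideanSpace ℝ (Fin n))
    (ζ : Idx n m → ℝ) : 0 ≤ degNormSq lam x ζ := by
  unfold degNormSq; positivity

theorem degNormSq_le (lam : EuclideanSpace ℝ (Fin n) → ℝ) (x : EuclideanSpace ℝ (Fin n))
    (ζ : Idx n m → ℝ) {K : ℝ} (hζ : ∀ i, |ζ i| ≤ K) :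
    degNormSq lam x ζ ≤ (n + lam x ^ 2 * m) * K ^ 2 := by
  have h : ∀ i, ζ i ^ 2 ≤ K ^ 2 := fun i => by
    rw [← sq_abs]; exact pow_le_pow_left₀ (abs_nonneg _) (hζ i) 2
  have h1 : ∑ i : Fin n, ζ (Sum.inl i) ^ 2 ≤ n * K ^ 2 := by
    simpa using Finset.sum_le_card_nsmul Finset.univ (fun i : Fin n => ζ (Sum.inl i) ^ 2) (K ^ 2)
      (fun i _ => h _)
  have h2 : ∑ i : Fin m, ζ (Sum.inr i) ^ 2 ≤ m * K ^ 2 := by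
    simpa using Finset.sum_le_card_nsmul Finset.univ (fun i : Fin m => ζ (Sum.inr i) ^ 2) (K ^ 2)
      (fun i _ => h _)
  have h3 := mul_le_mul_of_nonneg_left h2 (sq_nonneg (lam x))
  unfold degNormSq
  linarith

theorem abs_bilin_le {A : Matrix (Idx n m) (Idx n m) ℝ} (hA : A.IsSymm)
    {lam : EuclideanSpace ℝ (Fin n) → ℝ} {x : EuclideanSpace ℝ (Fin n)} {a : ℝ}
    (h0 : ∀ ζ, 0 ≤ bilin A ζ ζ) (h1 : ∀ ζ, bilin A ζ ζ ≤ a * degNormSq lam x ζ)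
    (ζ ζ' : Idx n m → ℝ) :
    |bilin A ζ ζ'| ≤ a * (degNormSq lam x ζ + degNormSq lam x ζ') := by
  have e1 : bilin A (ζ + ζ') (ζ + ζ') = bilin A ζ ζ + 2 * bilin A ζ ζ' + bilin A ζ' ζ' := by
    rw [bilin_add_left, bilin_comm hA ζ, bilin_comm hA ζ', bilin_add_left, bilin_add_left,
      bilin_comm hA ζ' ζ]
    ring
  have e2 : bilin A (ζ + (-1 : ℝ) • ζ') (ζ + (-1 : ℝ) • ζ')
      = bilin A ζ ζ - 2 * bilin A ζ ζ' + bilin A ζ' ζ' := by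
    rw [bilin_add_left, bilin_smul_left, bilin_comm hA ζ, bilin_comm hA ζ', bilin_add_left,
      bilin_add_left, bilin_smul_left, bilin_smul_left, bilin_comm hA ζ' ζ]
    ring
  have := h0 (ζ + ζ')
  have := h0 (ζ + (-1 : ℝ) • ζ')
  have := h1 ζ
  have := h1 ζ'
  have := h0 ζ
  have := h0 ζ'
  rw [abs_le]
  constructor <;> linarith

theorem norm_basisVec_le (i : Idx n m) : ‖(basisVec i : Space n m)‖ ≤ 1 := by
  rcases i with i | j <;> simp [basisVec, Prod.norm_def]

theorem abs_grad_le {f : Space n m → ℝ} {K : ℝ≥0} (hf : LipschitzOnWith K f (closure Ω.carrier))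
    {z : Space n m} (hz : z ∈ Ω.carrier) (i : Idx n m) : |grad f z i| ≤ K := by
  have h1 : ‖fderiv ℝ f z‖ ≤ K :=
    norm_fderiv_le_of_lipschitzOn ℝ (Filter.mem_of_superset (Ω.isOpen.mem_nhds hz) subset_closure)
      hf
  calc |grad f z i| ≤ ‖fderiv ℝ f z‖ * ‖(basisVec i : Space n m)‖ :=
        (fderiv ℝ f z).le_opNorm _
    _ ≤ K * 1 := mul_le_mul h1 (norm_basisVec_le i) (norm_nonneg _) K.2
    _ = K := mul_one _

theorem measurable_grad (f : Space n m → ℝ) (i : Idx n m) : Measurable fun z => grad f z i :=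
  measurable_fderiv_apply_const ℝ f (basisVec i)

theorem ae_differentiableAt (f : LipSpace L Ω) :
    ∀ᵐ z ∂(volume.restrict Ω.carrier), DifferentiableAt ℝ f z := by
  have : (volume : Measure (Space n m)).IsAddHaarMeasure :=
    Measure.prod.instIsAddHaarMeasure volume volume
  obtain ⟨K, hK⟩ := f.2
  rw [ae_restrict_iff' Ω.isOpen.measurableSet]
  filter_upwards [(hK.mono subset_closure).ae_differentiableWithinAt_of_mem (μ := volume)]
    with z hz hzΩ
  exact (hz hzΩ).differentiableAt (Ω.isOpen.mem_nhds hzΩ)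

theorem bilin_self_nonneg :
    ∀ᵐ z : Space n m, ∀ ζ : Idx n m → ℝ, 0 ≤ bilin (L.A z) ζ ζ := by
  filter_upwards [L.elliptic] with z hz ζ
  exact (mul_nonneg (L.weight_v.nonneg z) (degNormSq_nonneg _ _ _)).trans (hz ζ).1

theorem integrableOn_u : IntegrableOn L.u Ω.carrier volume :=
  (L.weight_u.locallyIntegrable.integrableOn_isCompact
    Ω.isBounded.isCompact_closure).mono_set subset_closure

theorem integrableOn_bilin (f g : LipSpace L Ω) :
    IntegrableOn (fun z => bilin (L.A z) (grad f z) (grad g z)) Ω.carrier volume := by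
  obtain ⟨K, hK⟩ := f.2
  obtain ⟨K', hK'⟩ := g.2
  obtain ⟨M, hM⟩ : ∃ M, ∀ z ∈ closure Ω.carrier, L.lam z.1 ^ 2 ≤ M := by
    obtain ⟨M, hM⟩ := Ω.isBounded.isCompact_closure.bddAbove_image
      (f := fun z : Space n m => L.lam z.1 ^ 2)
      ((L.isGrushin.continuous.comp continuous_fst).pow 2).continuousOn
    exact ⟨M, fun z hz => hM ⟨z, hz, rfl⟩⟩
  have hmeas : AEStronglyMeasurable (fun z => bilin (L.A z) (grad f z) (grad g z))
      (volume.restrict Ω.carrier) := by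
    refine AEMeasurable.aestronglyMeasurable ?_
    unfold bilin
    refine Finset.aemeasurable_fun_sum _ fun i _ => Finset.aemeasurable_fun_sum _ fun j _ => ?_
    exact (((L.measurable_A i j).restrict.mul (measurable_grad _ i).aemeasurable).mul
      (measurable_grad _ j).aemeasurable)
  refine Integrable.mono' ((integrableOn_u (L := L) (Ω := Ω)).mul_const
    ((n + M * m) * (K : ℝ) ^ 2 + (n + M * m) * (K' : ℝ) ^ 2)) hmeas ?_
  have h1 := ae_restrict_of_ae (s := Ω.carrier) L.elliptic
  have h2 := ae_restrict_of_ae (s := Ω.carrier) (bilin_self_nonneg (L := L))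
  filter_upwards [h1, h2, ae_restrict_mem Ω.isOpen.measurableSet] with z hz1 hz2 hz
  refine (abs_bilin_le (L.symm_A z) hz2 (fun ζ => (hz1 ζ).2) _ _).trans ?_
  refine mul_le_mul_of_nonneg_left ?_ (L.weight_u.nonneg z)
  have hm := mul_le_mul_of_nonneg_right (hM z (subset_closure hz)) (Nat.cast_nonneg (α := ℝ) m)
  have a1 := degNormSq_le L.lam z.1 (grad f z) (abs_grad_le hK hz)
  have a2 := degNormSq_le L.lam z.1 (grad g z) (abs_grad_le hK' hz)
  have b1 := mul_le_mul_of_nonneg_right (add_le_add_right hm (n : ℝ)) (sq_nonneg (K : ℝ))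
  have b2 := mul_le_mul_of_nonneg_right (add_le_add_right hm (n : ℝ)) (sq_nonneg (K' : ℝ))
  linarith

theorem weightMeasure_lt_top : weightMeasure L.u Ω.carrier < ∞ := by
  rw [weightMeasure, withDensity_apply _ Ω.isOpen.measurableSet]
  exact (integrableOn_u (L := L) (Ω := Ω)).lintegral_lt_top

instance : IsFiniteMeasure ((weightMeasure L.u).restrict Ω.carrier) :=
  ⟨by rw [Measure.restrict_apply_univ]; exact weightMeasure_lt_top⟩

theorem memLp_lip (f : LipSpace L Ω) :
    MemLp (⇑f) 2 ((weightMeasure L.u).restrict Ω.carrier) := by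
  obtain ⟨K, hK⟩ := f.2
  obtain ⟨M, hM⟩ := Ω.isBounded.isCompact_closure.exists_bound_of_continuousOn hK.continuousOn
  refine MemLp.of_bound ((hK.continuousOn.mono subset_closure).aestronglyMeasurable
    Ω.isOpen.measurableSet) M ?_
  filter_upwards [ae_restrict_mem Ω.isOpen.measurableSet] with z hz
  exact hM z (subset_closure hz)

theorem integrableOn_mul (f g : LipSpace L Ω) :
    IntegrableOn (fun z => f z * g z) Ω.carrier (weightMeasure L.u) :=
  (memLp_lip f).integrable_mul (memLp_lip g)

theorem dirichlet_comm (f g : LipSpace L Ω) : dirichlet f g = dirichlet g f :=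
  integral_congr_ae (ae_of_all _ fun z => bilin_comm (L.symm_A z) _ _)

theorem dirichlet_self_nonneg (f : LipSpace L Ω) : 0 ≤ dirichlet f f :=
  integral_nonneg_of_ae <| by
    filter_upwards [ae_restrict_of_ae (s := Ω.carrier) (bilin_self_nonneg (L := L))] with z hz
    exact hz _

theorem dirichlet_add_left (f g h : LipSpace L Ω) :
    dirichlet (f + g) h = dirichlet f h + dirichlet g h := by
  unfold dirichlet
  rw [← integral_add (integrableOn_bilin f h) (integrableOn_bilin g h)]
  refine integral_congr_ae ?_
  filter_upwards [ae_differentiableAt f, ae_differentiableAt g] with z hf hg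
  have : grad (⇑(f + g)) z = grad f z + grad g z := by
    ext i
    simp [grad, LipSpace.coe_add, fderiv_add hf hg]
  rw [this, bilin_add_left]

theorem dirichlet_smul_left (c : ℝ) (f g : LipSpace L Ω) :
    dirichlet (c • f) g = c * dirichlet f g := by
  unfold dirichlet
  rw [← integral_const_mul]
  refine integral_congr_ae ?_
  filter_upwards [ae_differentiableAt f] with z hf
  have : grad (⇑(c • f)) z = c • grad f z := by
    ext i
    simp [grad, LipSpace.coe_smul, fderiv_const_smul hf]
  rw [this, bilin_smul_left]

/-- The scalar product `a₀(f, g) + ∫_Ω f g u` on `Lip(closure Ω)`, whose seminorm is that of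
`H(Ω)`. -/
@[reducible]
def lipCore (L : DegenerateOperator n m) (Ω : BoundedOpen n m) :
    PreInnerProductSpace.Core ℝ (LipSpace L Ω) where
  inner f g := dirichlet f g + massForm f g
  conj_inner_symm f g := by
    simp only [conj_trivial]
    rw [dirichlet_comm]
    simp only [massForm, mul_comm]
  re_inner_nonneg f := by
    simp only [RCLike.re_to_real]
    exact add_nonneg (dirichlet_self_nonneg f)
      (integral_nonneg fun z => mul_self_nonneg (f z))
  add_left f g h := by
    have : massForm (f + g) h = massForm f h + massForm g h := by
      unfold massForm
      rw [← integral_add (integrableOn_mul f h) (integrableOn_mul g h)]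
      simp [LipSpace.coe_add, add_mul]
    rw [dirichlet_add_left, this]; ring
  smul_left f g c := by
    have : massForm (c • f) g = c * massForm f g := by
      unfold massForm
      rw [← integral_const_mul]
      simp [LipSpace.coe_smul, mul_assoc]
    simp only [conj_trivial]
    rw [dirichlet_smul_left, this]; ring

instance : SeminormedAddCommGroup (LipSpace L Ω) :=
  InnerProductSpace.Core.toSeminormedAddCommGroup (c := lipCore L Ω)

instance : InnerProductSpace ℝ (LipSpace L Ω) := InnerProductSpace.ofCore (lipCore L Ω)

theorem inner_lip (f g : LipSpace L Ω) : inner ℝ f g = dirichlet f g + massForm f g := rfl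

theorem norm_sq_lip (f : LipSpace L Ω) : ‖f‖ ^ 2 = dirichlet f f + massForm f f := by
  rw [← real_inner_self_eq_norm_sq]; rfl

/-! ### The space `H(Ω)` and weak solutions -/

/-- `H(Ω)`: the completion of `Lip(closure Ω)` for the norm
`‖f‖² = ∑ᵢⱼ ∫_Ω aᵢⱼ ∂ᵢf ∂ⱼf + ∫_Ω f² u`. -/
abbrev HSpace (L : DegenerateOperator n m) (Ω : BoundedOpen n m) : Type :=
  UniformSpace.Completion (LipSpace L Ω)

/-- `L²(Ω, u dz)`. -/
abbrev L2Space (L : DegenerateOperator n m) (Ω : BoundedOpen n m) : Type :=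
  Lp ℝ 2 ((weightMeasure L.u).restrict Ω.carrier)

/-- A Lipschitz function as an element of `L²(Ω, u dz)`. -/
def lipToL2 (L : DegenerateOperator n m) (Ω : BoundedOpen n m) :
    LipSpace L Ω →ₗ[ℝ] L2Space L Ω where
  toFun f := (memLp_lip f).toLp f
  map_add' f g := MemLp.toLp_add (memLp_lip f) (memLp_lip g)
  map_smul' c f := MemLp.toLp_const_smul c (memLp_lip f)

theorem inner_lipToL2 (f g : LipSpace L Ω) :
    inner ℝ (lipToL2 L Ω f) (lipToL2 L Ω g) = massForm f g := by
  rw [L2.inner_def]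
  refine integral_congr_ae ?_
  filter_upwards [(memLp_lip f).coeFn_toLp, (memLp_lip g).coeFn_toLp] with z hf hg
  change inner ℝ ((memLp_lip f).toLp f z) ((memLp_lip g).toLp g z) = _
  rw [hf, hg]
  simp [mul_comm]

theorem norm_lipToL2_le (f : LipSpace L Ω) : ‖lipToL2 L Ω f‖ ≤ 1 * ‖f‖ := by
  rw [one_mul]
  refine le_of_sq_le_sq ?_ (norm_nonneg _)
  rw [norm_sq_lip, ← real_inner_self_eq_norm_sq, inner_lipToL2]
  linarith [dirichlet_self_nonneg f]

/-- `lipToL2` as a continuous linear map. -/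
def lipToL2L (L : DegenerateOperator n m) (Ω : BoundedOpen n m) : LipSpace L Ω →L[ℝ] L2Space L Ω :=
  (lipToL2 L Ω).mkContinuous 1 norm_lipToL2_le

/-- The natural map `f ↦ f̃` from `H(Ω)` to `L²(Ω, u dz)`: the continuous extension of the map
that sends a Lipschitz function to itself. -/
def tilde (L : DegenerateOperator n m) (Ω : BoundedOpen n m) : HSpace L Ω →L[ℝ] L2Space L Ω :=
  (lipToL2L L Ω).extend (UniformSpace.Completion.toComplL : LipSpace L Ω →L[ℝ] HSpace L Ω)

theorem tilde_coe (f : LipSpace L Ω) : tilde L Ω (f : HSpace L Ω) = lipToL2 L Ω f :=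
  ContinuousLinearMap.extend_eq (lipToL2L L Ω)
    (e := (UniformSpace.Completion.toComplL : LipSpace L Ω →L[ℝ] HSpace L Ω))
    UniformSpace.Completion.denseRange_coe
    (UniformSpace.Completion.isUniformInducing_coe (LipSpace L Ω)) f

/-- The continuous extension of the bilinear form `a₀` to `H(Ω)`. As `⟪f, g⟫ = a₀(f, g) + ∫ f g u`
for Lipschitz functions, it is `⟪f, g⟫` minus the scalar product of `f̃` and `g̃`. -/
def a₀ (f g : HSpace L Ω) : ℝ := inner ℝ f g - inner ℝ (tilde L Ω f) (tilde L Ω g)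

theorem a₀_coe (f g : LipSpace L Ω) : a₀ (f : HSpace L Ω) (g : HSpace L Ω) = dirichlet f g := by
  rw [a₀, UniformSpace.Completion.inner_coe, tilde_coe, tilde_coe, inner_lipToL2, inner_lip]
  ring

theorem continuous_a₀ : Continuous fun p : HSpace L Ω × HSpace L Ω => a₀ p.1 p.2 := by
  unfold a₀
  fun_prop

/-- `H₀(Ω)`: the closure in `H(Ω)` of the Lipschitz functions with compact support in `Ω`. -/
def HZero (L : DegenerateOperator n m) (Ω : BoundedOpen n m) : Set (HSpace L Ω) :=
  closure {f | ∃ g : LipSpace L Ω, f = g ∧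
    ∃ K : Set (Space n m), IsCompact K ∧ K ⊆ Ω.carrier ∧ ∀ z ∈ closure Ω.carrier \ K, g z = 0}

/-- `f ∈ H(Ω)` is a weak solution of `L f = 0`. -/
def IsWeakSolution (f : HSpace L Ω) : Prop := ∀ θ ∈ HZero L Ω, a₀ f θ = 0

/-- `f ∈ H(Ω)` is non-negative: some sequence of non-negative functions of `Lip(closure Ω)`
converges to `f` in `H(Ω)`. -/
def IsNonneg (f : HSpace L Ω) : Prop :=
  ∃ φ : ℕ → LipSpace L Ω, (∀ k, ∀ z ∈ closure Ω.carrier, 0 ≤ φ k z) ∧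
    Tendsto (fun k => (φ k : HSpace L Ω)) atTop (𝓝 f)

/-- The rectangle `Q(z₀, r)` as a bounded open set. -/
def rectOpen (lam : EuclideanSpace ℝ (Fin n) → ℝ) (z₀ : Space n m) (r : ℝ) : BoundedOpen n m where
  carrier := rect lam z₀ r
  isOpen := Metric.isOpen_ball.prod Metric.isOpen_ball
  isBounded := Metric.isBounded_ball.prod Metric.isBounded_ball

/-- `μ(E) = u(E)^{1/2} v(E)^{-1/2}`. -/
def muRatio (L : DegenerateOperator n m) (E : Set (Space n m)) : ℝ :=
  (weightMeasure L.u).real E ^ (1 / 2 : ℝ) * (weightMeasure L.v).real E ^ (-(1 / 2) : ℝ)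

/-- The function `f̃` with values in `[0, ∞]`; it is only used for `f ≥ 0`, when `f̃ ≥ 0` almost
everywhere for `u dz`. With these values, `f̃ ^ p = ∞` where `f̃ = 0` and `p < 0`. -/
def tildeFun (f : HSpace L Ω) (z : Space n m) : ℝ≥0∞ := ENNReal.ofReal (tilde L Ω f z)

end Grushin

end

open Grushin

namespace Grushin

/-! ### Rectangles and balls of the subunit metric -/

section Geometry

variable {n m : ℕ} {lam : EuclideanSpace ℝ (Fin n) → ℝ}

/-! The proof is Moser's iteration with two weights, in the geometry of the metric `rho`. A subunit
curve of duration less than r stays in the rectangle of size r, and explicit three-piece curves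
reach every point of a rectangle, so B(z, r) ⊆ Q(z, r) ⊆ B(z, 5r) (`rhoBall_subset_rect`,
`rect_subset_rhoBall`). Hence doubling passes from balls to rectangles with a power-law loss
(`weightMeasure_rect_le`), and for a < b the rectangle aQ is covered by a controlled number of balls
of radius comparable to (b - a)h.

Testing the equation with η²Φ(f), where Φ' = G'², gives a Caccioppoli inequality for G(f)
(`caccioppoli`). Together with Sobolev–Poincaré on each small ball it yields a reverse Hölder
inequality from L² on bQ to L^q on aQ (`reverse_holder`). Ellipticity controls the gradient with v
and the cutoff term with u; the passage from one weight to the other costs μ(Q). No calculus is done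
on elements of H(Q) themselves: the estimates are proved for non-negative Lipschitz approximations
φ_k, for which a₀(φ_k, η²Φ(φ_k)) → 0 because the test functions stay bounded in H(Q)
(`IsWeakSolution.tendsto_dirichlet`), and Fatou's lemma passes to the limit (`local_estimate`).

For the powers (f̃ + ε)^p the reverse Hölder constant contains 1 + κ|p|μ(Q), where κ bounds 1/(2|p -
1|) (`reverse_holder_rpow`). Iterating over the exponents p kʲ with k = q/2 gives the mean value
inequality for f̃ + ε whenever these exponents stay away from 1 (`mean_value_of_avoidsOne`); the sum
k/(k - 1) of the powers of 1/k, applied to a squared constant, produces the exponent 2q/(q - 2).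

For p < 0 the exponents are never near 1, and the bound for (f̃ + ε)^p is one for the essential
infimum, hence also for the essential supremum. For p > 0 the iteration is run with some p' ∈ [p,
kp] that is a half-integer power of k (`exists_avoidsOne`); the return to p pulls out the power p' -
p of the supremum and absorbs it by Young's inequality (`essSup_rpow_le_of_mean_value`). Absorption
needs a finite supremum, supplied by a starting exponent at most 2, for which f̃ ∈ L²(u) suffices.
Finally ε → 0. -/

theorem bddAbove_image_ball (hlam : IsGrushinFunction lam) (x : EuclideanSpace ℝ (Fin n)) (r : ℝ) :
    BddAbove (lam '' Metric.ball x r) :=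
  ((isCompact_closedBall x r).bddAbove_image hlam.continuous.continuousOn).mono
    (image_mono Metric.ball_subset_closedBall)

theorem le_Lam (hlam : IsGrushinFunction lam) {z : Space n m} {r : ℝ}
    {x : EuclideanSpace ℝ (Fin n)} (hx : x ∈ Metric.ball z.1 r) : lam x ≤ Lam lam z r :=
  le_csSup (bddAbove_image_ball hlam _ _) ⟨x, hx, rfl⟩

theorem Lam_nonneg (hlam : IsGrushinFunction lam) (z : Space n m) (r : ℝ) : 0 ≤ Lam lam z r :=
  Real.sSup_nonneg <| by rintro _ ⟨x, -, rfl⟩; exact hlam.nonneg x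

/-- If λ vanishes at the centre, that zero is isolated, and as n > 0 the ball contains other points
arbitrarily near the centre, where λ > 0. -/
theorem Lam_pos (hn : 0 < n) (hlam : IsGrushinFunction lam) (z : Space n m) {r : ℝ} (hr : 0 < r) :
    0 < Lam lam z r := by
  by_cases h0 : lam z.1 = 0
  · have : Nonempty (Fin n) := ⟨⟨0, hn⟩⟩
    have h1 : ∀ᶠ x' in 𝓝[≠] z.1, x' ∈ Metric.ball z.1 r :=
      nhdsWithin_le_nhds (Metric.ball_mem_nhds _ hr)
    obtain ⟨x, hx0, hx⟩ := ((hlam.isolated _ h0).and h1).exists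
    exact ((hlam.nonneg x).lt_of_ne' hx0).trans_le (le_Lam hlam hx)
  · exact ((hlam.nonneg _).lt_of_ne' h0).trans_le (le_Lam hlam (Metric.mem_ball_self hr))

theorem Lam_mono (hlam : IsGrushinFunction lam) {z z' : Space n m} {r r' : ℝ} (hr : 0 < r)
    (h : dist z'.1 z.1 + r ≤ r') : Lam lam z' r ≤ Lam lam z r' :=
  csSup_le_csSup (bddAbove_image_ball hlam _ _) ((Metric.nonempty_ball.2 hr).image _)
    (image_mono (Metric.ball_subset_ball' (by linarith)))

theorem rect_mono (hlam : IsGrushinFunction lam) (z : Space n m) {r r' : ℝ} (hr : 0 < r)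
    (h : r ≤ r') : rect lam z r ⊆ rect lam z r' :=
  prod_mono (Metric.ball_subset_ball h) (Metric.ball_subset_ball
    (mul_le_mul h (Lam_mono hlam hr (by simpa using h)) (Lam_nonneg hlam _ _) (hr.le.trans h)))

theorem mem_rect {z w : Space n m} {r : ℝ} :
    w ∈ rect lam z r ↔ dist w.1 z.1 < r ∧ dist w.2 z.2 < r * Lam lam z r := by
  simp [rect]

theorem isOpen_rect (z : Space n m) (r : ℝ) : IsOpen (rect lam z r) :=
  (rectOpen lam z r).isOpen

theorem measurableSet_rect (z : Space n m) (r : ℝ) : MeasurableSet (rect lam z r) :=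
  (isOpen_rect z r).measurableSet

/-- A rectangle of size `s` centred in the rectangle of size `r` is contained in the
rectangle of size `r + s`. -/
theorem rect_subset_rect_add (hlam : IsGrushinFunction lam) {z w : Space n m} {r s : ℝ}
    (hr : 0 < r) (hs : 0 < s) (hw : w ∈ rect lam z r) : rect lam w s ⊆ rect lam z (r + s) := by
  intro p hp
  rw [mem_rect] at hw hp ⊢
  have h1 := dist_triangle p.1 w.1 z.1
  have h2 := dist_triangle p.2 w.2 z.2
  have h3 : Lam lam w s ≤ Lam lam z (r + s) := Lam_mono hlam hs (by linarith)
  have h4 : Lam lam z r ≤ Lam lam z (r + s) := Lam_mono hlam hr (by simp; linarith)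
  refine ⟨by linarith, ?_⟩
  nlinarith [mul_le_mul_of_nonneg_left h3 hs.le, mul_le_mul_of_nonneg_left h4 hr.le]

/-- A rectangle is contained in any twice larger rectangle centred at one of its points. -/
theorem rect_subset_rect_two_mul (hlam : IsGrushinFunction lam) {z w : Space n m} {r : ℝ}
    (hr : 0 < r) (hw : w ∈ rect lam z r) : rect lam z r ⊆ rect lam w (2 * r) := by
  intro p hp
  rw [mem_rect] at hw hp ⊢
  have h1 := dist_triangle_right p.1 w.1 z.1
  have h2 := dist_triangle_right p.2 w.2 z.2
  have h3 : Lam lam z r ≤ Lam lam w (2 * r) :=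
    Lam_mono hlam hr (by rw [dist_comm]; linarith)
  refine ⟨by linarith, ?_⟩
  nlinarith [mul_le_mul_of_nonneg_left h3 hr.le]

/-- If two rectangles of the same size meet, the centre of the first lies in the triple of the
second. -/
theorem mem_rect_three_mul (hlam : IsGrushinFunction lam) {z w : Space n m} {r : ℝ} (hr : 0 < r)
    (h : (rect lam z r ∩ rect lam w r).Nonempty) : z ∈ rect lam w (3 * r) := by
  obtain ⟨p, hp, hp'⟩ := h
  rw [mem_rect] at hp hp' ⊢
  have h1 := dist_triangle_left z.1 w.1 p.1
  have h2 := dist_triangle_left z.2 w.2 p.2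
  have h3 : Lam lam z r ≤ Lam lam w (3 * r) := Lam_mono hlam hr (by linarith)
  have h4 : Lam lam w r ≤ Lam lam w (3 * r) := Lam_mono hlam hr (by simp; linarith)
  have h5 := Lam_nonneg hlam w (3 * r)
  refine ⟨by linarith, ?_⟩
  nlinarith [mul_le_mul_of_nonneg_left h3 hr.le, mul_le_mul_of_nonneg_left h4 hr.le,
    mul_nonneg hr.le h5]

/-! ### Subunit curves -/

/-- The linear form `z ↦ ∑ᵢ zᵢ ζᵢ`. -/
noncomputable def pairing (ζ : Idx n m → ℝ) : Space n m →L[ℝ] ℝ :=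
  LinearMap.toContinuousLinearMap
    { toFun := fun z => ∑ i, coords z i * ζ i
      map_add' := fun z w => by
        rw [← Finset.sum_add_distrib]
        refine Finset.sum_congr rfl fun i _ => ?_
        rcases i with i | i <;> simp [coords, add_mul]
      map_smul' := fun c z => by
        rw [Finset.smul_sum]
        refine Finset.sum_congr rfl fun i _ => ?_
        rcases i with i | i <;> simp [coords, mul_assoc] }

theorem pairing_apply (ζ : Idx n m → ℝ) (z : Space n m) :
    pairing ζ z = ∑ i, coords z i * ζ i := rfl

/-- The scalar function ⟨γ, ζ⟩ is absolutely continuous, hence the integral of its derivative, which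
the subunit condition bounds by C. -/
theorem IsSubunit.abs_pairing_sub_le {T : ℝ} {γ : ℝ → Space n m} (hγ : IsSubunit lam T γ)
    {S : ℝ} (hS : 0 ≤ S) (hST : S ≤ T) (ζ : Idx n m → ℝ) {C : ℝ} (hC : 0 ≤ C)
    (h : ∀ t ∈ Ioo 0 S, degNormSq lam (γ t).1 ζ ≤ C ^ 2) :
    |pairing ζ (γ S) - pairing ζ (γ 0)| ≤ C * S := by
  have hac : AbsolutelyContinuousOnInterval γ 0 S :=
    hγ.1.mono (by rw [uIcc_of_le hS, uIcc_of_le (hS.trans hST)]; exact Icc_subset_Icc_right hST)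
  have hac' : AbsolutelyContinuousOnInterval (fun t => pairing ζ (γ t)) 0 S := by
    -- Absolute continuity is a limit of oscillation sums over families of intervals; a continuous
    -- linear form multiplies each sum by at most its norm.
    refine squeeze_zero (fun _ => Finset.sum_nonneg fun _ _ => dist_nonneg) (fun E => ?_)
      (by simpa using Tendsto.const_mul (‖pairing ζ‖) hac)
    rw [Finset.mul_sum]
    refine Finset.sum_le_sum fun i _ => ?_
    exact (pairing ζ).lipschitz.dist_le_mul _ _
  have hd : ∀ᵐ t : ℝ, t ∈ uIcc 0 S → DifferentiableAt ℝ γ t :=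
    hac.boundedVariationOn.ae_differentiableAt_of_mem_uIcc
  rw [← hac'.integral_deriv_eq_sub, ← Real.norm_eq_abs]
  refine (intervalIntegral.norm_integral_le_of_norm_le_const_ae (C := C) ?_).trans ?_
  · have hne : ∀ᵐ t : ℝ, t ≠ S := by simp [ae_iff, measure_singleton]
    filter_upwards [hd, hγ.2, hne] with t h1 h2 h3 ht
    rw [uIoc_of_le hS] at ht
    have ht' : t ∈ Ioo 0 S := ⟨ht.1, ht.2.lt_of_ne h3⟩
    have e : deriv (fun t => pairing ζ (γ t)) t = pairing ζ (deriv γ t) :=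
      ((pairing ζ).hasFDerivAt.comp_hasDerivAt t
        (h1 (by rw [uIcc_of_le hS]; exact Ioc_subset_Icc_self ht)).hasDerivAt).deriv
    rw [e, Real.norm_eq_abs]
    exact abs_le_of_sq_le_sq ((h2 ⟨ht.1, ht'.2.trans_le hST⟩ ζ).trans (h t ht')) hC
  · rw [sub_zero, abs_of_nonneg hS]

theorem sum_sq_eq_norm_sq {k : ℕ} (x : EuclideanSpace ℝ (Fin k)) : ∑ i, x i ^ 2 = ‖x‖ ^ 2 := by
  rw [EuclideanSpace.norm_eq, Real.sq_sqrt (Finset.sum_nonneg fun _ _ => sq_nonneg _)]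
  simp

/-- Pairing with the covector (w, 0), where w is the displacement itself, gives |w|² ≤ |w| S.
Intermediate times S are allowed, so that the whole curve can be confined to a ball. -/
theorem IsSubunit.dist_fst_le {T : ℝ} {γ : ℝ → Space n m} (hγ : IsSubunit lam T γ)
    {S : ℝ} (hS : 0 ≤ S) (hST : S ≤ T) : dist (γ S).1 (γ 0).1 ≤ S := by
  set w := (γ S).1 - (γ 0).1 with hw
  have h := hγ.abs_pairing_sub_le hS hST (Sum.elim (⇑w) 0) (norm_nonneg w) (fun t _ => by
    simp [degNormSq, sum_sq_eq_norm_sq])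
  rw [← map_sub, pairing_apply] at h
  have e : ∑ i, coords (γ S - γ 0) i * (Sum.elim (⇑w) 0 : Idx n m → ℝ) i = ‖w‖ ^ 2 := by
    rw [← sum_sq_eq_norm_sq]
    simp [coords, hw, pow_two]
  rw [e, abs_of_nonneg (sq_nonneg _)] at h
  rw [dist_eq_norm, ← hw]
  by_contra hc
  push Not at hc
  nlinarith

/-- The same argument with the covector (0, w), whose degenerate norm along the curve is at most
c|w|. -/
theorem IsSubunit.dist_snd_le {T : ℝ} {γ : ℝ → Space n m} (hγ : IsSubunit lam T γ)
    (hT : 0 ≤ T) {c : ℝ} (hc : 0 ≤ c) (hlam : ∀ x, 0 ≤ lam x)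
    (h : ∀ t ∈ Ioo 0 T, lam (γ t).1 ≤ c) : dist (γ T).2 (γ 0).2 ≤ c * T := by
  set w := (γ T).2 - (γ 0).2 with hw
  have h := hγ.abs_pairing_sub_le hT le_rfl (Sum.elim 0 (⇑w)) (mul_nonneg hc (norm_nonneg w))
    (fun t ht => by
      have := mul_le_mul_of_nonneg_right (pow_le_pow_left₀ (hlam _) (h t ht) 2)
        (sq_nonneg ‖w‖)
      simpa [degNormSq, sum_sq_eq_norm_sq, mul_pow] using this)
  rw [← map_sub, pairing_apply] at h
  have e : ∑ i, coords (γ T - γ 0) i * (Sum.elim 0 (⇑w) : Idx n m → ℝ) i = ‖w‖ ^ 2 := by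
    rw [← sum_sq_eq_norm_sq]
    simp [coords, hw, pow_two]
  rw [e, abs_of_nonneg (sq_nonneg _)] at h
  rw [dist_eq_norm, ← hw]
  by_contra hlt
  push Not at hlt
  nlinarith [norm_nonneg w, mul_nonneg hc hT]

/-- A curve of duration T < r never leaves the ball |x - x₀| < r, so λ ≤ Λ(z, r) along it and its
vertical displacement is at most TΛ. Positivity of Λ makes the final inequality strict. -/
theorem rhoBall_subset_rect (hn : 0 < n) (hlam : IsGrushinFunction lam) (z : Space n m) {r : ℝ}
    (hr : 0 < r) : rhoBall lam z r ⊆ rect lam z r := by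
  intro w hw
  rw [rhoBall, mem_ofPred_eq, rho, iInf_lt_iff] at hw
  obtain ⟨⟨T, γ, hγ, h0, hT⟩, hTr⟩ := hw
  simp only at hTr
  have hTr' : (T : ℝ) < r := by
    rw [← ENNReal.ofReal_coe_nnreal] at hTr
    exact (ENNReal.ofReal_lt_ofReal_iff hr).1 hTr
  rw [mem_rect, ← h0, ← hT]
  refine ⟨(hγ.dist_fst_le T.2 le_rfl).trans_lt hTr', ?_⟩
  have h2 := hγ.dist_snd_le T.2 (Lam_nonneg hlam (γ 0) r) hlam.nonneg (fun t ht =>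
    le_Lam hlam ((hγ.dist_fst_le ht.1.le ht.2.le).trans_lt (ht.2.trans hTr')))
  have h3 : 0 < Lam lam (γ 0) r := Lam_pos hn hlam _ hr
  refine h2.trans_lt ?_
  rw [mul_comm]
  exact mul_lt_mul_of_pos_right hTr' h3

/-- Three consecutive motions with speeds `e₁`, `e₂`, `e₃` during the times `t₁`, `t₂`, `t₃`. -/
noncomputable def threeStep {E : Type*} [NormedAddCommGroup E] [NormedSpace ℝ E]
    (z e₁ e₂ e₃ : E) (t₁ t₂ t₃ : ℝ) (t : ℝ) : E :=
  z + max 0 (min t t₁) • e₁ + max 0 (min (t - t₁) t₂) • e₂ + max 0 (min (t - t₁ - t₂) t₃) • e₃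

section threeStep

variable {E : Type*} [NormedAddCommGroup E] [NormedSpace ℝ E] (z e₁ e₂ e₃ : E) {t₁ t₂ t₃ : ℝ}

theorem exists_lipschitzWith_threeStep :
    ∃ K, LipschitzWith K (threeStep z e₁ e₂ e₃ t₁ t₂ t₃) := by
  have hs : ∀ (a b : ℝ) (e : E),
      ∃ K, LipschitzWith K (fun t : ℝ => max 0 (min (t - a) b) • e) := by
    intro a b e
    have h1 : LipschitzWith 1 (fun t : ℝ => max 0 (min (t - a) b)) := by
      have h0 : LipschitzWith 1 (fun t : ℝ => t - a) :=
        LipschitzWith.of_dist_le_mul fun x y => by simp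
      exact (h0.min_const b).const_max 0
    refine ⟨‖e‖₊, LipschitzWith.of_dist_le_mul fun x y => ?_⟩
    have := h1.dist_le_mul x y
    rw [dist_eq_norm, ← sub_smul, norm_smul, coe_nnnorm, mul_comm, ← dist_eq_norm]
    exact mul_le_mul_of_nonneg_left (by simpa using this) (norm_nonneg e)
  obtain ⟨K₁, h₁⟩ := hs 0 t₁ e₁
  obtain ⟨K₂, h₂⟩ := hs t₁ t₂ e₂
  obtain ⟨K₃, h₃⟩ := hs (t₁ + t₂) t₃ e₃
  refine ⟨0 + K₁ + K₂ + K₃, ?_⟩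
  have := (((LipschitzWith.const z).add h₁).add h₂).add h₃
  have e : threeStep z e₁ e₂ e₃ t₁ t₂ t₃ = fun t => z + max 0 (min (t - 0) t₁) • e₁
      + max 0 (min (t - t₁) t₂) • e₂ + max 0 (min (t - (t₁ + t₂)) t₃) • e₃ := by
    funext t
    simp [threeStep, sub_sub]
  rw [e]
  exact this

theorem threeStep_zero (h₁ : 0 ≤ t₁) (h₂ : 0 ≤ t₂) : threeStep z e₁ e₂ e₃ t₁ t₂ t₃ 0 = z := by
  simp only [threeStep]
  rw [min_eq_left h₁, max_self, max_eq_left, max_eq_left]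
  · simp
  · exact (min_le_left _ _).trans (by linarith)
  · exact (min_le_left _ _).trans (by linarith)

theorem threeStep_end (h₁ : 0 ≤ t₁) (h₂ : 0 ≤ t₂) (h₃ : 0 ≤ t₃) : threeStep z e₁ e₂ e₃ t₁ t₂ t₃ (t₁ + t₂ + t₃)
    = z + t₁ • e₁ + t₂ • e₂ + t₃ • e₃ := by
  simp only [threeStep]
  rw [min_eq_right (by linarith), min_eq_right (by linarith), min_eq_right (by linarith),
    max_eq_right h₁, max_eq_right h₂, max_eq_right h₃]

theorem threeStep_first (h₂ : 0 ≤ t₂) {t : ℝ} (ht : t ∈ Ioo 0 t₁) :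
    threeStep z e₁ e₂ e₃ t₁ t₂ t₃ t = z + t • e₁ := by
  simp only [threeStep]
  rw [min_eq_left ht.2.le, max_eq_right ht.1.le, max_eq_left, max_eq_left]
  · simp
  · exact (min_le_left _ _).trans (by linarith [ht.2])
  · exact (min_le_left _ _).trans (by linarith [ht.2])

theorem threeStep_second (h₁ : 0 ≤ t₁) {t : ℝ} (ht : t ∈ Ioo t₁ (t₁ + t₂)) :
    threeStep z e₁ e₂ e₃ t₁ t₂ t₃ t = z + t₁ • e₁ + (t - t₁) • e₂ := by
  simp only [threeStep]
  rw [min_eq_right ht.1.le, max_eq_right h₁, min_eq_left (by linarith [ht.2]),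
    max_eq_right (by linarith [ht.1]), max_eq_left]
  · simp
  · exact (min_le_left _ _).trans (by linarith [ht.2])

theorem threeStep_third (h₁ : 0 ≤ t₁) (h₂ : 0 ≤ t₂) {t : ℝ} (ht : t ∈ Ioo (t₁ + t₂) (t₁ + t₂ + t₃)) :
    threeStep z e₁ e₂ e₃ t₁ t₂ t₃ t = z + t₁ • e₁ + t₂ • e₂ + (t - t₁ - t₂) • e₃ := by
  simp only [threeStep]
  rw [min_eq_right (by linarith [ht.1]), max_eq_right h₁, min_eq_right (by linarith [ht.1]),
    max_eq_right h₂, min_eq_left (by linarith [ht.2]), max_eq_right (by linarith [ht.1])]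

end threeStep

/-- Cauchy–Schwarz: horizontal velocities of norm at most 1 are subunit. The next lemma does the
same for vertical velocities of norm at most λ(x). -/
theorem sq_sum_coords_le_of_fst {e : EuclideanSpace ℝ (Fin n)} (he : ‖e‖ ≤ 1)
    (x : EuclideanSpace ℝ (Fin n)) (ζ : Idx n m → ℝ) :
    (∑ i, coords ((e, 0) : Space n m) i * ζ i) ^ 2 ≤ degNormSq lam x ζ := by
  have h := Finset.sum_mul_sq_le_sq_mul_sq Finset.univ (⇑e) (fun i => ζ (Sum.inl i))
  rw [sum_sq_eq_norm_sq] at h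
  have h1 : ‖e‖ ^ 2 ≤ 1 := pow_le_one₀ (norm_nonneg _) he
  have h2 : 0 ≤ ∑ i : Fin n, ζ (Sum.inl i) ^ 2 := by positivity
  have h3 : 0 ≤ lam x ^ 2 * ∑ j : Fin m, ζ (Sum.inr j) ^ 2 := by positivity
  simp only [Fintype.sum_sum_type, coords, PiLp.zero_apply, zero_mul, Finset.sum_const_zero,
    add_zero, degNormSq]
  nlinarith

theorem sq_sum_coords_le_of_snd {e : EuclideanSpace ℝ (Fin m)} {x : EuclideanSpace ℝ (Fin n)}
    (he : ‖e‖ ≤ lam x) (ζ : Idx n m → ℝ) :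
    (∑ i, coords ((0, e) : Space n m) i * ζ i) ^ 2 ≤ degNormSq lam x ζ := by
  have h := Finset.sum_mul_sq_le_sq_mul_sq Finset.univ (⇑e) (fun i => ζ (Sum.inr i))
  rw [sum_sq_eq_norm_sq] at h
  have h1 : ‖e‖ ^ 2 ≤ lam x ^ 2 := pow_le_pow_left₀ (norm_nonneg _) he 2
  have h2 : 0 ≤ ∑ i : Fin n, ζ (Sum.inl i) ^ 2 := by positivity
  have h3 : 0 ≤ ∑ j : Fin m, ζ (Sum.inr j) ^ 2 := by positivity
  simp only [Fintype.sum_sum_type, coords, PiLp.zero_apply, zero_mul, Finset.sum_const_zero,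
    zero_add, degNormSq]
  nlinarith

theorem exists_norm_le_one_smul_eq {E : Type*} [NormedAddCommGroup E] [NormedSpace ℝ E] (x : E) :
    ∃ e : E, ‖e‖ ≤ 1 ∧ ‖x‖ • e = x := by
  by_cases hx : x = 0
  · exact ⟨0, by simp [hx]⟩
  · refine ⟨‖x‖⁻¹ • x, by rw [norm_smul, norm_inv, norm_norm, inv_mul_cancel₀ (by simpa)], ?_⟩
    rw [smul_smul, mul_inv_cancel₀ (by simpa), one_smul]

/-- Two points are joined by a curve that moves to `x₁` in the first variable, then in the second
variable, then in the first variable again. -/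
theorem rho_le (z w : Space n m) {x₁ : EuclideanSpace ℝ (Fin n)} (hx₁ : 0 < lam x₁) :
    rho lam z w ≤ ENNReal.ofReal (dist x₁ z.1 + dist w.2 z.2 / lam x₁ + dist w.1 x₁) := by
  obtain ⟨e₁, he₁, he₁'⟩ := exists_norm_le_one_smul_eq (x₁ - z.1)
  obtain ⟨e₂, he₂, he₂'⟩ := exists_norm_le_one_smul_eq (w.2 - z.2)
  obtain ⟨e₃, he₃, he₃'⟩ := exists_norm_le_one_smul_eq (w.1 - x₁)
  rw [dist_eq_norm, dist_eq_norm, dist_eq_norm]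
  set t₁ := ‖x₁ - z.1‖ with ht₁
  set t₂ := ‖w.2 - z.2‖ / lam x₁ with ht₂
  set t₃ := ‖w.1 - x₁‖ with ht₃
  have h₁ : 0 ≤ t₁ := norm_nonneg _
  have h₂ : 0 ≤ t₂ := div_nonneg (norm_nonneg _) hx₁.le
  have h₃ : 0 ≤ t₃ := norm_nonneg _
  set E₁ : Space n m := (e₁, 0) with hE₁
  -- The vertical motion takes place above x₁ at the maximal speed λ(x₁), which explains its
  -- duration t₂.
  set E₂ : Space n m := (0, lam x₁ • e₂) with hE₂
  set E₃ : Space n m := (e₃, 0) with hE₃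
  set γ := threeStep z E₁ E₂ E₃ t₁ t₂ t₃ with hγ
  have hfst : z.1 + t₁ • e₁ = x₁ := by rw [he₁']; abel
  have hT : 0 ≤ t₁ + t₂ + t₃ := by positivity
  have hsub : IsSubunit lam (t₁ + t₂ + t₃) γ := by
    constructor
    · obtain ⟨K, hK⟩ := exists_lipschitzWith_threeStep z E₁ E₂ E₃ (t₁ := t₁) (t₂ := t₂) (t₃ := t₃)
      exact hK.lipschitzOnWith.absolutelyContinuousOnInterval
    -- The subunit condition is only required almost everywhere, so the two break points are
    -- discarded.
    · have hne : ∀ s : ℝ, ∀ᵐ t : ℝ, t ≠ s := fun s => by simp [ae_iff, measure_singleton]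
      filter_upwards [hne t₁, hne (t₁ + t₂)] with t a1 a2 ht ζ
      rcases lt_or_gt_of_ne a1 with b1 | b1
      · have hd : deriv γ t = E₁ := by
          have e : γ =ᶠ[𝓝 t] fun t => z + t • E₁ := by
            filter_upwards [Ioo_mem_nhds ht.1 b1] with s hs
            exact threeStep_first z E₁ E₂ E₃ h₂ hs
          rw [e.deriv_eq]
          simpa using (((hasDerivAt_id t).smul_const E₁).const_add z).deriv
        rw [hd]
        exact sq_sum_coords_le_of_fst he₁ _ _
      · rcases lt_or_gt_of_ne a2 with b2 | b2
        · have hd : deriv γ t = E₂ := by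
            have e : γ =ᶠ[𝓝 t] fun t => z + t₁ • E₁ + (t - t₁) • E₂ := by
              filter_upwards [Ioo_mem_nhds b1 b2] with s hs
              exact threeStep_second z E₁ E₂ E₃ h₁ hs
            rw [e.deriv_eq]
            simpa using
              ((((hasDerivAt_id t).sub_const t₁).smul_const E₂).const_add (z + t₁ • E₁)).deriv
          have hx : (γ t).1 = x₁ := by
            rw [hγ, threeStep_second z E₁ E₂ E₃ h₁ ⟨b1, b2⟩]
            simp [hE₁, hE₂, hfst]
          rw [hd, hx]
          refine sq_sum_coords_le_of_snd ?_ _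
          rw [norm_smul, Real.norm_of_nonneg hx₁.le]
          exact mul_le_of_le_one_right hx₁.le he₂
        · have hd : deriv γ t = E₃ := by
            have e : γ =ᶠ[𝓝 t] fun t => z + t₁ • E₁ + t₂ • E₂ + (t - t₁ - t₂) • E₃ := by
              filter_upwards [Ioo_mem_nhds b2 ht.2] with s hs
              exact threeStep_third z E₁ E₂ E₃ h₁ h₂ hs
            rw [e.deriv_eq]
            simpa using ((((hasDerivAt_id t).sub_const t₁).sub_const t₂).smul_const E₃).const_add
              (z + t₁ • E₁ + t₂ • E₂) |>.deriv
          rw [hd]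
          exact sq_sum_coords_le_of_fst he₃ _ _
  have h0 : γ 0 = z := threeStep_zero z E₁ E₂ E₃ h₁ h₂
  have hend : γ (t₁ + t₂ + t₃) = w := by
    rw [hγ, threeStep_end z E₁ E₂ E₃ h₁ h₂ h₃]
    refine Prod.ext ?_ ?_
    · simp [hE₁, hE₂, hE₃, hfst, he₃']
    · simp only [hE₁, hE₂, hE₃, Prod.snd_add, Prod.smul_snd, smul_zero, add_zero, smul_smul]
      rw [ht₂, div_mul_cancel₀ _ hx₁.ne', he₂']
      abel
  have := iInf_le (fun T : {T : ℝ≥0 // ∃ γ : ℝ → Space n m, IsSubunit lam T γ ∧ γ 0 = z ∧ γ T = w}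
    => ((T : ℝ≥0) : ℝ≥0∞)) ⟨⟨_, hT⟩, γ, hsub, h0, hend⟩
  rw [ENNReal.ofReal_eq_coe_nnreal hT]
  exact this

/-- Choose x₁ in the ball with λ(x₁) > Λ/2. Going to x₁ costs less than r, the vertical motion there
less than 2r, and the last horizontal motion less than 2r. -/
theorem rect_subset_rhoBall (hn : 0 < n) (hlam : IsGrushinFunction lam) (z : Space n m) {r : ℝ}
    (hr : 0 < r) : rect lam z r ⊆ rhoBall lam z (5 * r) := by
  intro w hw
  rw [mem_rect] at hw
  have hL := Lam_pos hn hlam z hr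
  obtain ⟨_, ⟨x₁, hx₁, rfl⟩, hlt⟩ := exists_lt_of_lt_csSup ((Metric.nonempty_ball.2 hr).image lam)
    (half_lt_self hL)
  have hx₁' : dist x₁ z.1 < r := hx₁
  have hpos : 0 < lam x₁ := (half_pos hL).trans hlt
  refine (rho_le z w hpos).trans_lt ?_
  rw [ENNReal.ofReal_lt_ofReal_iff (by positivity)]
  have h1 : dist w.2 z.2 / lam x₁ < 2 * r := by
    rw [div_lt_iff₀ hpos]
    have : Lam lam z r < 2 * lam x₁ := by unfold Lam; linarith
    nlinarith [hw.2]
  have h2 := dist_triangle_right w.1 x₁ z.1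
  linarith [hw.1]

end Geometry

end Grushin

namespace Grushin

/-! ### Doubling for rectangles and coverings by small rectangles -/

section Doubling

variable {n m : ℕ} {lam : EuclideanSpace ℝ (Fin n) → ℝ} {w : Space n m → ℝ} {C : ℝ}

theorem IsWeight.aemeasurable (hw : IsWeight w) : AEMeasurable w volume :=
  hw.locallyIntegrable.aestronglyMeasurable.aemeasurable

theorem IsWeight.weightMeasure_lt_top (hw : IsWeight w) {s : Set (Space n m)}
    (hs : Bornology.IsBounded s) (hs' : MeasurableSet s) : weightMeasure w s < ∞ := by
  rw [weightMeasure, withDensity_apply _ hs']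
  exact ((hw.locallyIntegrable.integrableOn_isCompact hs.isCompact_closure).mono_set
    subset_closure).lintegral_lt_top

theorem IsWeight.weightMeasure_rect_lt_top (hw : IsWeight w) (z : Space n m) (r : ℝ) :
    weightMeasure w (rect lam z r) < ∞ :=
  hw.weightMeasure_lt_top (rectOpen lam z r).isBounded (measurableSet_rect z r)

theorem IsWeight.weightMeasure_univ_ne_zero (hw : IsWeight w) : weightMeasure w univ ≠ 0 := by
  intro h
  rw [weightMeasure, Measure.measure_univ_eq_zero,
    withDensity_eq_zero_iff hw.aemeasurable.ennreal_ofReal] at h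
  refine hw.nontrivial ?_
  filter_upwards [h] with z hz
  exact le_antisymm (ENNReal.ofReal_eq_zero.1 hz) (hw.nonneg z)

theorem IsRhoDoubling.weightMeasure_rhoBall_le (h : IsRhoDoubling C lam w) (z : Space n m)
    {r : ℝ} (hr : 0 < r) (j : ℕ) : weightMeasure w (rhoBall lam z (2 ^ j * r)) ≤
      ENNReal.ofReal C ^ j * weightMeasure w (rhoBall lam z r) := by
  induction j with
  | zero => simp
  | succ j ih =>
    have := h z (2 ^ j * r) (by positivity)
    rw [← mul_assoc, ← pow_succ'] at this
    refine this.trans ((mul_le_mul_right ih _).trans_eq ?_)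
    rw [pow_succ', mul_assoc]

theorem rhoBall_mono (z : Space n m) {r r' : ℝ} (h : r ≤ r') :
    rhoBall lam z r ⊆ rhoBall lam z r' :=
  fun _ hw => lt_of_lt_of_le hw (ENNReal.ofReal_le_ofReal h)

/-- The dimension attached to the doubling constant `C`. -/
noncomputable def doublingDim (C : ℝ) : ℝ := Real.logb 2 (max C 2)

theorem doublingDim_pos (C : ℝ) : 0 < doublingDim C :=
  Real.logb_pos one_lt_two (lt_max_of_lt_right one_lt_two)

/-- The rectangle lies in Q(p, 2r) ⊆ B(p, 10r) ⊆ B(p, 2^(j+1) s), where 2^j ≤ 10r/s < 2^(j+1).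
Doubling is applied j + 1 times, and 2^(j+1) ≤ 20r/s. Positivity of the mass of small balls is a
by-product, once rectangles are known to have positive mass. -/
theorem weightMeasure_rect_le (hn : 0 < n) (hlam : IsGrushinFunction lam)
    (hd : IsRhoDoubling C lam w) {z p : Space n m} {r s : ℝ} (hr : 0 < r) (hs : 0 < s)
    (hsr : s ≤ r) (hp : p ∈ rect lam z r) : weightMeasure w (rect lam z r) ≤
      ENNReal.ofReal ((20 * (r / s)) ^ doublingDim C) * weightMeasure w (rhoBall lam p s) := by
  have h1 : 1 ≤ r / s := (one_le_div hs).2 hsr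
  obtain ⟨j, hj, hj'⟩ := exists_nat_pow_near (by linarith : 1 ≤ 10 * (r / s)) one_lt_two
  have hsub : rect lam z r ⊆ rhoBall lam p (2 ^ (j + 1) * s) := by
    refine (rect_subset_rect_two_mul hlam hr hp).trans
      ((rect_subset_rhoBall hn hlam p (by positivity)).trans (rhoBall_mono p ?_))
    have : 10 * (r / s) * s = 5 * (2 * r) := by field_simp; norm_num
    rw [← this]
    exact mul_le_mul_of_nonneg_right hj'.le hs.le
  refine (measure_mono hsub).trans ((hd.weightMeasure_rhoBall_le p hs (j + 1)).trans ?_)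
  refine mul_le_mul_left ?_ _
  have hC : (2 : ℝ) ^ doublingDim C = max C 2 :=
    Real.rpow_logb two_pos (by norm_num) (lt_max_of_lt_right two_pos)
  calc ENNReal.ofReal C ^ (j + 1) ≤ ENNReal.ofReal (max C 2) ^ (j + 1) :=
        pow_le_pow_left' (ENNReal.ofReal_le_ofReal (le_max_left _ _)) _
    _ = ENNReal.ofReal ((2 ^ (j + 1) : ℝ) ^ doublingDim C) := by
        rw [← ENNReal.ofReal_pow (by positivity), ← hC, ← Real.rpow_natCast, ← Real.rpow_natCast,
          ← Real.rpow_mul two_pos.le, ← Real.rpow_mul two_pos.le, mul_comm]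
    _ ≤ _ := by
        refine ENNReal.ofReal_le_ofReal (Real.rpow_le_rpow (by positivity) ?_
          (doublingDim_pos C).le)
        rw [pow_succ]
        linarith

/-- If a rectangle were null, so would be the ball inside it, and by doubling all larger concentric
rectangles. These exhaust the space, so the weight would be trivial. -/
theorem weightMeasure_rect_pos (hn : 0 < n) (hlam : IsGrushinFunction lam) (hw : IsWeight w)
    (hd : IsRhoDoubling C lam w) (z : Space n m) {r : ℝ} (hr : 0 < r) :
    0 < weightMeasure w (rect lam z r) := by
  rw [pos_iff_ne_zero]
  intro h0
  have hz : ∀ s, z ∈ rect lam z s ∨ s ≤ 0 := fun s => by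
    rcases le_or_gt s 0 with hs | hs
    · exact Or.inr hs
    · exact Or.inl (by rw [mem_rect]; simp [hs, Lam_pos hn hlam])
  have hb : weightMeasure w (rhoBall lam z r) = 0 :=
    measure_mono_null (rhoBall_subset_rect hn hlam z hr) h0
  have hR : ∀ k : ℕ, weightMeasure w (rect lam z (r + k)) = 0 := fun k => by
    have hk : 0 < r + k := by positivity
    have := weightMeasure_rect_le hn hlam hd hk hr (by simp) ((hz (r + k)).resolve_right hk.not_ge)
    rw [hb, mul_zero] at this
    exact le_antisymm this zero_le
  refine hw.weightMeasure_univ_ne_zero (measure_mono_null ?_ (measure_iUnion_null hR))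
  intro p _
  have hL := Lam_pos hn hlam z hr
  obtain ⟨k, hk⟩ := exists_nat_gt (max (dist p.1 z.1) (dist p.2 z.2 / Lam lam z r))
  rw [max_lt_iff, div_lt_iff₀ hL] at hk
  refine mem_iUnion.2 ⟨k, mem_rect.2 ⟨by linarith, hk.2.trans_le ?_⟩⟩
  exact mul_le_mul (by linarith) (Lam_mono hlam hr (by simp)) hL.le (by positivity)

/-- A rectangle is covered by a controlled number of small rectangles. -/
theorem exists_finset_rect_cover (hn : 0 < n) (hlam : IsGrushinFunction lam) (hw : IsWeight w)
    (hd : IsRhoDoubling C lam w) (z : Space n m) {r s h : ℝ} (hr : 0 < r) (hs : 0 < s)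
    (hrs : r + s ≤ h) : ∃ t : Finset (Space n m), (∀ p ∈ t, p ∈ rect lam z r) ∧
      (t.card : ℝ≥0∞) ≤ ENNReal.ofReal ((20 * (h / s)) ^ doublingDim C) ∧
      rect lam z r ⊆ ⋃ p ∈ t, rect lam p (3 * s) := by
  have hh : 0 < h := by linarith
  -- With the constant size function 1, Vitali's selection is just a disjoint subfamily that every
  -- rectangle of size s centred in Q(z, r) meets.
  obtain ⟨T, hT, hdis, hcov⟩ := Vitali.exists_disjoint_subfamily_covering_enlargement
    (fun p => rect lam p s) (rect lam z r) (fun _ => (1 : ℝ)) 2 one_lt_two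
    (fun _ _ => zero_le_one) 1 (fun _ _ => le_rfl)
    (fun p _ => ⟨p, mem_rect.2 (by simp [hs, Lam_pos hn hlam])⟩)
  set X := ENNReal.ofReal ((20 * (h / s)) ^ doublingDim C) with hX
  have hpos := weightMeasure_rect_pos hn hlam hw hd z hh
  have hfin := hw.weightMeasure_rect_lt_top (lam := lam) z h
  -- Each selected rectangle carries at least the fraction 1/X of the mass of Q(z, h), and they are
  -- disjoint subsets of it, so there are at most X of them.
  have hcard : ∀ t : Finset (Space n m), (t : Set (Space n m)) ⊆ T → (t.card : ℝ≥0∞) ≤ X := by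
    intro t ht
    have h1 : ∀ p ∈ t, weightMeasure w (rect lam z h) ≤ X * weightMeasure w (rect lam p s) := by
      intro p hp
      have hp' : p ∈ rect lam z h := rect_mono hlam z hr (by linarith) (hT (ht hp))
      exact (weightMeasure_rect_le hn hlam hd hh hs (by linarith) hp').trans
        (mul_le_mul_right (measure_mono (rhoBall_subset_rect hn hlam p hs)) _)
    have h2 : ∑ p ∈ t, weightMeasure w (rect lam p s) ≤ weightMeasure w (rect lam z h) := by
      rw [← measure_biUnion_finset (hdis.subset ht) fun p _ => measurableSet_rect p s]
      refine measure_mono (iUnion₂_subset fun p hp => ?_)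
      exact (rect_subset_rect_add hlam hr hs (hT (ht hp))).trans
        (rect_mono hlam z (by linarith) hrs)
    have h3 := Finset.sum_le_sum h1
    rw [← Finset.mul_sum, Finset.sum_const, nsmul_eq_mul] at h3
    exact (ENNReal.mul_le_mul_iff_left hpos.ne' hfin.ne).1 (h3.trans (mul_le_mul_right h2 _))
  have hTfin : T.Finite := by
    by_contra hinf
    obtain ⟨N, hN⟩ := ENNReal.exists_nat_gt (ENNReal.ofReal_ne_top : X ≠ ∞)
    obtain ⟨t, ht, htN⟩ := (show T.Infinite from hinf).exists_subset_card_eq N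
    exact absurd (hcard t ht) (by rw [htN]; exact not_le.2 hN)
  refine ⟨hTfin.toFinset, fun p hp => hT (hTfin.mem_toFinset.1 hp), hcard _ (by simp), ?_⟩
  intro p hp
  obtain ⟨b, hb, hne, -⟩ := hcov p hp
  exact mem_iUnion₂.2 ⟨b, hTfin.mem_toFinset.2 hb, mem_rect_three_mul hlam hs hne⟩

end Doubling

end Grushin

namespace Grushin

/-! ### Cutoff functions adapted to rectangles -/

section Cutoff

variable {n m : ℕ} {lam : EuclideanSpace ℝ (Fin n) → ℝ}

/-- Differentiability is not assumed: where it fails, `fderiv` is zero and the bound is trivial.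
This gives gradient bounds at every point. -/
theorem abs_fderiv_apply_le {E : Type*} [NormedAddCommGroup E] [NormedSpace ℝ E] {g : E → ℝ}
    {z e : E} {c : ℝ} (h : ∀ t : ℝ, |g (z + t • e) - g z| ≤ c * |t|) : |fderiv ℝ g z e| ≤ c := by
  have hc : 0 ≤ c := by simpa using (abs_nonneg _).trans (h 1)
  by_cases hd : DifferentiableAt ℝ g z
  · rw [← hd.lineDeriv_eq_fderiv, ← Real.norm_eq_abs]
    refine norm_deriv_le_of_lip' hc (Eventually.of_forall fun t => ?_)
    simpa using h t
  · simpa [fderiv_zero_of_not_differentiableAt hd] using hc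

/-- The piecewise linear function of `d` that is `1` for `d ≤ α` and `0` for `β ≤ d`. -/
noncomputable def ramp (α β d : ℝ) : ℝ := max 0 (min 1 ((β - d) / (β - α)))

theorem ramp_nonneg (α β d : ℝ) : 0 ≤ ramp α β d := le_max_left _ _

theorem ramp_le_one (α β d : ℝ) : ramp α β d ≤ 1 := max_le zero_le_one (min_le_left _ _)

theorem ramp_eq_one {α β d : ℝ} (h : α < β) (hd : d ≤ α) : ramp α β d = 1 := by
  rw [ramp, min_eq_left, max_eq_right zero_le_one]
  rw [one_le_div (by linarith)]
  linarith

theorem ramp_eq_zero {α β d : ℝ} (h : α < β) (hd : β ≤ d) : ramp α β d = 0 :=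
  max_eq_left ((min_le_right _ _).trans (div_nonpos_of_nonpos_of_nonneg (by linarith)
    (by linarith)))

theorem abs_ramp_sub_le {α β : ℝ} (h : α < β) (d d' : ℝ) :
    |ramp α β d - ramp α β d'| ≤ (β - α)⁻¹ * |d - d'| := by
  have h0 : LipschitzWith (Real.toNNReal (β - α)⁻¹) (fun d : ℝ => (β - d) / (β - α)) :=
    LipschitzWith.of_dist_le_mul fun x y => by
      have : 0 < β - α := by linarith
      rw [Real.coe_toNNReal _ (by positivity), Real.dist_eq, Real.dist_eq, ← sub_div,
        abs_div, abs_of_pos this, div_eq_inv_mul]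
      rw [show β - x - (β - y) = -(x - y) by ring, abs_neg]
  have := ((h0.const_min 1).const_max 0).dist_le_mul d d'
  rwa [Real.coe_toNNReal _ (inv_nonneg.2 (by linarith)), Real.dist_eq, Real.dist_eq] at this

theorem LipschitzWith.mul_of_bounded {X : Type*} [PseudoMetricSpace X] {f g : X → ℝ} {a b : ℝ}
    (hf : ∃ K, LipschitzWith K f) (hg : ∃ K, LipschitzWith K g) (ha : ∀ x, |f x| ≤ a)
    (hb : ∀ x, |g x| ≤ b) : ∃ K, LipschitzWith K fun x => f x * g x := by
  obtain ⟨K, hK⟩ := hf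
  obtain ⟨K', hK'⟩ := hg
  refine ⟨Real.toNNReal (a * K' + K * b), LipschitzWith.of_dist_le' fun x y => ?_⟩
  have h1 := hK.dist_le_mul x y
  have h2 := hK'.dist_le_mul x y
  rw [Real.dist_eq] at *
  have e : f x * g x - f y * g y = f x * (g x - g y) + (f x - f y) * g y := by ring
  rw [e]
  refine (abs_add_le _ _).trans ?_
  rw [abs_mul, abs_mul]
  have h3 := mul_le_mul (ha x) h2 (abs_nonneg _) ((abs_nonneg _).trans (ha x))
  have h4 := mul_le_mul h1 (hb y) (abs_nonneg _) (by positivity)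
  linarith

theorem exists_lipschitzWith_ramp {X : Type*} [PseudoMetricSpace X] {f : X → ℝ}
    (hf : LipschitzWith 1 f) {α β : ℝ} (h : α < β) :
    ∃ K, LipschitzWith K fun x => ramp α β (f x) := by
  refine ⟨_, LipschitzWith.of_dist_le' (K := (β - α)⁻¹) fun x y => ?_⟩
  refine (abs_ramp_sub_le h _ _).trans (mul_le_mul_of_nonneg_left ?_ (inv_nonneg.2 (by linarith)))
  simpa [Real.dist_eq] using hf.dist_le_mul x y

/-- A Lipschitz cutoff function between two concentric rectangles, with the natural bound for its
degenerate gradient. -/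
structure IsCutoff (lam : EuclideanSpace ℝ (Fin n) → ℝ) (S T : Set (Space n m)) (c : ℝ)
    (η : Space n m → ℝ) : Prop where
  lipschitz : ∃ K, LipschitzWith K η
  nonneg : ∀ z, 0 ≤ η z
  le_one : ∀ z, η z ≤ 1
  eq_one : ∀ z ∈ S, η z = 1
  eq_zero : ∀ z ∉ T, η z = 0
  degNormSq_le : ∀ z, degNormSq lam z.1 (grad η z) ≤ c

/-- A non-negative function has a local minimum wherever it vanishes, so the gradient is zero even
on the boundary of T. -/
theorem IsCutoff.grad_eq_zero {S T : Set (Space n m)} {c : ℝ} {η : Space n m → ℝ}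
    (hη : IsCutoff lam S T c η) {z : Space n m} (hz : z ∉ T) : grad η z = 0 := by
  have : IsLocalMin η z := Eventually.of_forall fun w => by rw [hη.eq_zero z hz]; exact hη.nonneg w
  ext i
  simp [grad, this.fderiv_eq_zero]

/-- The cutoff is a product of ramps in |x - x₀| and |y - y₀|. Since Λ is nondecreasing, the second
ramp has width at least (s - r)Λ(z₀, s); the factor λ ≤ Λ in the degenerate norm therefore
compensates the vertical slope, and both slopes count as 1/(s - r). -/
theorem exists_isCutoff (hn : 0 < n) (hlam : IsGrushinFunction lam) (z₀ : Space n m) {r s : ℝ}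
    (hr : 0 < r) (hrs : r < s) :
    ∃ η, IsCutoff lam (rect lam z₀ r) (rect lam z₀ s) ((n + m) / (s - r) ^ 2) η := by
  have hs : 0 < s := hr.trans hrs
  have hL : 0 < Lam lam z₀ s := Lam_pos hn hlam _ hs
  have hmono : Lam lam z₀ r ≤ Lam lam z₀ s := Lam_mono hlam hr (by simpa using hrs.le)
  have hsr : 0 < s - r := by linarith
  have hgap : (s - r) * Lam lam z₀ s ≤ s * Lam lam z₀ s - r * Lam lam z₀ r := by nlinarith
  have hlt : r * Lam lam z₀ r < s * Lam lam z₀ s := by nlinarith [mul_pos hsr hL]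
  have hd1 : LipschitzWith 1 fun z : Space n m => dist z.1 z₀.1 :=
    LipschitzWith.of_dist_le_mul fun x y => by
      rw [NNReal.coe_one, one_mul]
      exact (dist_dist_dist_le_left _ _ _).trans (le_max_left _ _)
  have hd2 : LipschitzWith 1 fun z : Space n m => dist z.2 z₀.2 :=
    LipschitzWith.of_dist_le_mul fun x y => by
      rw [NNReal.coe_one, one_mul]
      exact (dist_dist_dist_le_left _ _ _).trans (le_max_right _ _)
  set η₁ : Space n m → ℝ := fun z => ramp r s (dist z.1 z₀.1) with hη₁
  set η₂ : Space n m → ℝ :=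
    fun z => ramp (r * Lam lam z₀ r) (s * Lam lam z₀ s) (dist z.2 z₀.2) with hη₂
  have b1 : ∀ z, |η₁ z| ≤ 1 := fun z => by
    rw [abs_of_nonneg (ramp_nonneg _ _ _)]; exact ramp_le_one _ _ _
  have b2 : ∀ z, |η₂ z| ≤ 1 := fun z => by
    rw [abs_of_nonneg (ramp_nonneg _ _ _)]; exact ramp_le_one _ _ _
  have hzero : ∀ z ∉ rect lam z₀ s, η₁ z * η₂ z = 0 := by
    intro z hz
    rw [mem_rect, not_and_or, not_lt, not_lt] at hz
    rcases hz with hz | hz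
    · rw [hη₁]; simp only; rw [ramp_eq_zero hrs hz, zero_mul]
    · rw [hη₂]; simp only; rw [ramp_eq_zero hlt hz, mul_zero]
  refine ⟨fun z => η₁ z * η₂ z, LipschitzWith.mul_of_bounded (exists_lipschitzWith_ramp hd1 hrs)
    (exists_lipschitzWith_ramp hd2 hlt) b1 b2, fun z => mul_nonneg (ramp_nonneg _ _ _)
    (ramp_nonneg _ _ _), fun z => mul_le_one₀ (ramp_le_one _ _ _) (ramp_nonneg _ _ _)
    (ramp_le_one _ _ _), fun z hz => ?_, hzero, fun z => ?_⟩
  · rw [mem_rect] at hz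
    simp only [hη₁, hη₂]
    rw [ramp_eq_one hrs hz.1.le, ramp_eq_one hlt hz.2.le, one_mul]
  · by_cases hz : z ∈ rect lam z₀ s
    · have hx : ∀ i : Fin n, |grad (fun z => η₁ z * η₂ z) z (Sum.inl i)| ≤ (s - r)⁻¹ := by
        intro i
        refine abs_fderiv_apply_le fun t => ?_
        have e : η₂ (z + t • basisVec (Sum.inl i)) = η₂ z := by simp [hη₂, basisVec]
        rw [e, ← sub_mul, abs_mul]
        refine (mul_le_of_le_one_right (abs_nonneg _) (b2 z)).trans ?_
        refine (abs_ramp_sub_le hrs _ _).trans (mul_le_mul_of_nonneg_left ?_ (inv_nonneg.2 hsr.le))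
        refine (abs_dist_sub_le _ _ _).trans ?_
        simp [basisVec, dist_eq_norm, norm_smul]
      have hy : ∀ j : Fin m,
          |grad (fun z => η₁ z * η₂ z) z (Sum.inr j)| ≤ ((s - r) * Lam lam z₀ s)⁻¹ := by
        intro j
        refine abs_fderiv_apply_le fun t => ?_
        have e : η₁ (z + t • basisVec (Sum.inr j)) = η₁ z := by simp [hη₁, basisVec]
        rw [e, ← mul_sub, abs_mul]
        refine (mul_le_of_le_one_left (abs_nonneg _) (b1 z)).trans ?_
        refine (abs_ramp_sub_le hlt _ _).trans (mul_le_mul ?_ ?_ (abs_nonneg _) (by positivity))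
        · exact inv_anti₀ (by positivity) hgap
        · refine (abs_dist_sub_le _ _ _).trans ?_
          simp [basisVec, dist_eq_norm, norm_smul]
      have hlz : lam z.1 ≤ Lam lam z₀ s := le_Lam hlam (mem_rect.1 hz).1
      have h1 : ∑ i : Fin n, grad (fun z => η₁ z * η₂ z) z (Sum.inl i) ^ 2
          ≤ n * (s - r)⁻¹ ^ 2 := by
        simpa using Finset.sum_le_card_nsmul Finset.univ _ ((s - r)⁻¹ ^ 2)
          (fun i _ => sq_le_sq' (abs_le.1 (hx i)).1 (abs_le.1 (hx i)).2)
      have h2 : ∑ j : Fin m, grad (fun z => η₁ z * η₂ z) z (Sum.inr j) ^ 2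
          ≤ m * ((s - r) * Lam lam z₀ s)⁻¹ ^ 2 := by
        simpa using Finset.sum_le_card_nsmul Finset.univ _ (((s - r) * Lam lam z₀ s)⁻¹ ^ 2)
          (fun j _ => sq_le_sq' (abs_le.1 (hy j)).1 (abs_le.1 (hy j)).2)
      have h3 : lam z.1 ^ 2 ≤ Lam lam z₀ s ^ 2 := pow_le_pow_left₀ (hlam.nonneg _) hlz 2
      calc degNormSq lam z.1 (grad (fun z => η₁ z * η₂ z) z)
          ≤ n * (s - r)⁻¹ ^ 2
              + Lam lam z₀ s ^ 2 * (m * ((s - r) * Lam lam z₀ s)⁻¹ ^ 2) :=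
            add_le_add h1 (mul_le_mul h3 h2 (by positivity) (by positivity))
        _ = (n + m) / (s - r) ^ 2 := by field_simp
    · have hmin : IsLocalMin (fun z => η₁ z * η₂ z) z := Eventually.of_forall fun w => by
        simp only [hzero z hz]
        exact mul_nonneg (ramp_nonneg _ _ _) (ramp_nonneg _ _ _)
      have : grad (fun z => η₁ z * η₂ z) z = 0 := by
        ext i
        simp [grad, hmin.fderiv_eq_zero]
      rw [this]
      simp only [degNormSq, Pi.zero_apply, ne_eq, OfNat.ofNat_ne_zero, not_false_eq_true, zero_pow,
        Finset.sum_const_zero, mul_zero, add_zero]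
      positivity

end Cutoff

end Grushin

namespace Grushin

/-! ### The Caccioppoli inequality -/

section Energy

variable {n m : ℕ}

/-- A function `G` with derivative `G'` on `[0, ∞)`, together with a primitive `Φ` of `G'²` that is
controlled by `G` and `G'`: the data of a Caccioppoli inequality for `G ∘ f`, obtained from the
test function `η² Φ(f)`. -/
structure IsTestPair (K ℓ : ℝ) (G G' Φ : ℝ → ℝ) : Prop where
  K_nonneg : 0 ≤ K
  hasDerivAt : ∀ t, 0 ≤ t → HasDerivAt G (G' t) t
  hasDerivAt_primitive : ∀ t, 0 ≤ t → HasDerivAt Φ (G' t ^ 2) t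
  abs_le : ∀ t, 0 ≤ t → |Φ t| ≤ K * (|G' t| * G t)
  nonneg : ∀ t, 0 ≤ t → 0 ≤ G t
  bound : ∀ t, 0 ≤ t → |G' t| ≤ ℓ

namespace IsTestPair

variable {K ℓ : ℝ} {G G' Φ : ℝ → ℝ} (h : IsTestPair K ℓ G G' Φ)

theorem bound_nonneg (h : IsTestPair K ℓ G G' Φ) : 0 ≤ ℓ := (abs_nonneg _).trans (h.bound 0 le_rfl)

theorem abs_sub_le (h : IsTestPair K ℓ G G' Φ) {s t : ℝ} (hs : 0 ≤ s) (ht : 0 ≤ t) :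
    |G s - G t| ≤ ℓ * |s - t| := by
  simpa using (convex_Ici (0 : ℝ)).norm_image_sub_le_of_norm_hasDerivWithin_le
    (fun x hx => (h.hasDerivAt x hx).hasDerivWithinAt) (fun x hx => h.bound x hx) ht hs

theorem abs_primitive_sub_le (h : IsTestPair K ℓ G G' Φ) {s t : ℝ} (hs : 0 ≤ s) (ht : 0 ≤ t) :
    |Φ s - Φ t| ≤ ℓ ^ 2 * |s - t| := by
  refine (convex_Ici (0 : ℝ)).norm_image_sub_le_of_norm_hasDerivWithin_le
    (fun x hx => (h.hasDerivAt_primitive x hx).hasDerivWithinAt) (fun x hx => ?_) ht hs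
  rw [Real.norm_eq_abs, abs_pow]
  exact pow_le_pow_left₀ (abs_nonneg _) (h.bound x hx) 2

end IsTestPair

theorem exists_lipschitzWith_comp {X : Type*} [PseudoMetricSpace X] {G : ℝ → ℝ} {ℓ : ℝ}
    (hG : ∀ s t, 0 ≤ s → 0 ≤ t → |G s - G t| ≤ ℓ * |s - t|) (hℓ : 0 ≤ ℓ) {F : X → ℝ}
    (hF : ∃ K, LipschitzWith K F) (h0 : ∀ x, 0 ≤ F x) : ∃ K, LipschitzWith K fun x => G (F x) := by
  obtain ⟨K, hK⟩ := hF
  refine ⟨Real.toNNReal (ℓ * K), LipschitzWith.of_dist_le' fun x y => ?_⟩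
  refine (hG _ _ (h0 x) (h0 y)).trans ?_
  rw [mul_assoc]
  exact mul_le_mul_of_nonneg_left (hK.dist_le_mul x y) hℓ

theorem bilin_smul_smul {A : Matrix (Idx n m) (Idx n m) ℝ} (hA : A.IsSymm) (a b : ℝ)
    (ζ ω : Idx n m → ℝ) : bilin A (a • ζ + b • ω) (a • ζ + b • ω)
      = a ^ 2 * bilin A ζ ζ + 2 * a * b * bilin A ζ ω + b ^ 2 * bilin A ω ω := by
  rw [bilin_add_left, bilin_comm hA (a • ζ), bilin_comm hA (b • ω), bilin_add_left, bilin_add_left,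
    bilin_smul_left, bilin_smul_left, bilin_smul_left, bilin_smul_left,
    bilin_comm hA ζ (a • ζ), bilin_comm hA ω (a • ζ), bilin_comm hA ζ (b • ω),
    bilin_comm hA ω (b • ω)]
  simp only [bilin_smul_left]
  rw [bilin_comm hA ω ζ]
  ring

/-- The bound on φ allows one to write φ = τg with |τ| ≤ KΓ, also where g = 0. The inequality is
then the non-negativity of the form at ηgζ + 2τω, a completed square; it replaces Cauchy–Schwarz and
Young. -/
theorem bilin_caccioppoli {A : Matrix (Idx n m) (Idx n m) ℝ} (hA : A.IsSymm)
    (h0 : ∀ ζ, 0 ≤ bilin A ζ ζ) (ζ ω : Idx n m → ℝ) {η g φ Γ K : ℝ} (hK : 0 ≤ K)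
    (hΓ : 0 ≤ Γ) (h : |φ| ≤ K * (|g| * Γ)) :
    η ^ 2 * g ^ 2 * bilin A ζ ζ ≤ 2 * bilin A ζ ((η ^ 2 * g ^ 2) • ζ + (2 * η * φ) • ω)
      + 4 * K ^ 2 * Γ ^ 2 * bilin A ω ω := by
  obtain ⟨τ, hτ, hτ'⟩ : ∃ τ, φ = τ * g ∧ |τ| ≤ K * Γ := by
    by_cases hg : g = 0
    · refine ⟨0, by simpa [hg] using h, by simpa using mul_nonneg hK hΓ⟩
    · refine ⟨φ / g, by field_simp, ?_⟩
      rw [abs_div, div_le_iff₀ (abs_pos.2 hg)]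
      linarith
  have h1 := h0 ((η * g) • ζ + (2 * τ) • ω)
  rw [bilin_smul_smul hA] at h1
  have h2 : τ ^ 2 ≤ (K * Γ) ^ 2 := sq_le_sq' (abs_le.1 hτ').1 (abs_le.1 hτ').2
  have h3 := mul_le_mul_of_nonneg_right h2 (h0 ω)
  have e : bilin A ζ ((η ^ 2 * g ^ 2) • ζ + (2 * η * φ) • ω)
      = η ^ 2 * g ^ 2 * bilin A ζ ζ + 2 * η * φ * bilin A ζ ω := by
    rw [bilin_comm hA, bilin_add_left, bilin_smul_left, bilin_smul_left, bilin_comm hA ω]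
  rw [e, hτ]
  nlinarith

theorem bilin_add_self_le {A : Matrix (Idx n m) (Idx n m) ℝ} (hA : A.IsSymm)
    (h0 : ∀ ζ, 0 ≤ bilin A ζ ζ) (ζ ω : Idx n m → ℝ) (a b : ℝ) :
    bilin A (a • ζ + b • ω) (a • ζ + b • ω)
      ≤ 2 * a ^ 2 * bilin A ζ ζ + 2 * b ^ 2 * bilin A ω ω := by
  have h1 := h0 (a • ζ + (-b) • ω)
  rw [bilin_smul_smul hA] at h1 ⊢
  nlinarith

variable {L : DegenerateOperator n m} {Ω : BoundedOpen n m}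

theorem degNormSq_smul (lam : EuclideanSpace ℝ (Fin n) → ℝ) (x : EuclideanSpace ℝ (Fin n)) (c : ℝ)
    (ζ : Idx n m → ℝ) : degNormSq lam x (c • ζ) = c ^ 2 * degNormSq lam x ζ := by
  simp only [degNormSq, Pi.smul_apply, smul_eq_mul, mul_pow, ← Finset.mul_sum]
  ring

theorem measurable_degNormSq_grad (hlam : Continuous L.lam) (g : Space n m → ℝ) :
    Measurable fun z : Space n m => degNormSq L.lam z.1 (grad g z) := by
  unfold degNormSq
  refine (Finset.measurable_fun_sum _ fun i _ => (measurable_grad g _).pow_const 2).add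
    (((hlam.measurable.comp measurable_fst).pow_const 2).mul
      (Finset.measurable_fun_sum _ fun i _ => (measurable_grad g _).pow_const 2))

theorem IsWeight.setLIntegral {w : Space n m → ℝ} (hw : IsWeight w) {S : Set (Space n m)}
    (hS : MeasurableSet S) {g : Space n m → ℝ≥0∞} (hg : AEMeasurable g (volume.restrict S)) :
    ∫⁻ z in S, g z ∂(weightMeasure w) = ∫⁻ z in S, ENNReal.ofReal (w z) * g z := by
  rw [weightMeasure, restrict_withDensity hS,
    lintegral_withDensity_eq_lintegral_mul₀ hw.aemeasurable.ennreal_ofReal.restrict hg]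
  rfl

theorem IsWeight.setIntegral {w : Space n m → ℝ} (hw : IsWeight w) {S : Set (Space n m)}
    (hS : MeasurableSet S) (g : Space n m → ℝ) :
    ∫ z in S, g z ∂(weightMeasure w) = ∫ z in S, w z * g z := by
  rw [weightMeasure, restrict_withDensity hS,
    integral_withDensity_eq_integral_toReal_smul₀ hw.aemeasurable.ennreal_ofReal.restrict
      (ae_of_all _ fun _ => ENNReal.ofReal_lt_top)]
  refine integral_congr_ae (ae_of_all _ fun z => ?_)
  simp [ENNReal.toReal_ofReal (hw.nonneg z)]

theorem grad_comp {G : ℝ → ℝ} {F : Space n m → ℝ} {z : Space n m} {d : ℝ}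
    (hG : HasDerivAt G d (F z)) (hF : DifferentiableAt ℝ F z) :
    grad (fun z => G (F z)) z = d • grad F z := by
  ext i
  have := (hG.comp_hasFDerivAt z hF.hasFDerivAt).fderiv
  simp only [grad, Pi.smul_apply]
  rw [show (fun z => G (F z)) = G ∘ F from rfl, this]
  rfl

theorem grad_test {Φ : ℝ → ℝ} {η F : Space n m → ℝ} {z : Space n m} {d : ℝ}
    (hΦ : HasDerivAt Φ d (F z)) (hF : DifferentiableAt ℝ F z) (hη : DifferentiableAt ℝ η z) :
    grad (fun z => η z ^ 2 * Φ (F z)) z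
      = (η z ^ 2 * d) • grad F z + (2 * η z * Φ (F z)) • grad η z := by
  ext i
  have h1 := hΦ.comp_hasFDerivAt z hF.hasFDerivAt
  have h2 := (hη.hasFDerivAt.pow 2).mul h1
  simp only [grad, Pi.smul_apply, Pi.add_apply]
  have e : (fun z => η z ^ 2 * Φ (F z)) = (fun x => η x ^ 2) * (Φ ∘ F) := rfl
  rw [e, h2.fderiv]
  simp
  ring

/-- The degenerate Dirichlet integral of `G ∘ φ` is controlled by `a₀(φ, η² Φ(φ))` and an integral
of `G(φ)²` over the support of the cutoff function. -/
theorem caccioppoli {K ℓ : ℝ} {G G' Φ : ℝ → ℝ} (h : IsTestPair K ℓ G G' Φ) {S T : Set (Space n m)}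
    (hS : MeasurableSet S) (hT : MeasurableSet T) (hTΩ : T ⊆ Ω.carrier) (hST : S ⊆ T) {c : ℝ}
    {η : Space n m → ℝ} (hη : IsCutoff L.lam S T c η) (φ θ : LipSpace L Ω)
    (hφ0 : ∀ z, 0 ≤ φ z) (hφ : ∃ K, LipschitzWith K (φ : Space n m → ℝ))
    (hθ : ∀ z, θ z = η z ^ 2 * Φ (φ z)) :
    ∫⁻ z in S, ENNReal.ofReal (degNormSq L.lam z.1 (grad (fun z => G (φ z)) z))
        ∂(weightMeasure L.v) ≤
      ENNReal.ofReal (2 * dirichlet φ θ) + ENNReal.ofReal (4 * K ^ 2 * c) *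
        ∫⁻ z in T, ENNReal.ofReal (G (φ z) ^ 2) ∂(weightMeasure L.u) := by
  have hvol : (volume : Measure (Space n m)).IsAddHaarMeasure :=
    Measure.prod.instIsAddHaarMeasure volume volume
  have hθ' : (θ : Space n m → ℝ) = fun z => η z ^ 2 * Φ (φ z) := funext hθ
  obtain ⟨Kη, hKη⟩ := hη.lipschitz
  obtain ⟨Kφ, hKφ⟩ := hφ
  have hGφ : Continuous fun z => G (φ z) := by
    obtain ⟨K', hK'⟩ := exists_lipschitzWith_comp (fun s t => h.abs_sub_le) h.bound_nonneg
      ⟨Kφ, hKφ⟩ hφ0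
    exact hK'.continuous
  have hc : 0 ≤ c := (degNormSq_nonneg _ _ _).trans (hη.degNormSq_le 0)
  -- The cutoff term is supported in T because the gradient of η vanishes off T; the indicator
  -- records this while all integrals are taken over Ω.
  set I : Space n m → ℝ := T.indicator fun z => L.u z * G (φ z) ^ 2 with hI
  have hIint : IntegrableOn I Ω.carrier := by
    obtain ⟨M, hM⟩ := Ω.isBounded.isCompact_closure.exists_bound_of_continuousOn
      (hGφ.pow 2).continuousOn
    refine Integrable.indicator ?_ hT
    refine (integrableOn_u (L := L) (Ω := Ω)).mul_bdd (c := M)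
      (hGφ.pow 2).aestronglyMeasurable ?_
    filter_upwards [ae_restrict_mem Ω.isOpen.measurableSet] with z hz
    exact hM z (subset_closure hz)
  set R : Space n m → ℝ := fun z => 2 * bilin (L.A z) (grad φ z) (grad θ z)
    + 4 * K ^ 2 * c * I z with hR
  have hRint : IntegrableOn R Ω.carrier :=
    ((integrableOn_bilin φ θ).const_mul 2).add (hIint.const_mul (4 * K ^ 2 * c))
  have hkey : ∀ᵐ z : Space n m, η z ^ 2 * G' (φ z) ^ 2 * bilin (L.A z) (grad φ z) (grad φ z)
      ≤ R z := by
    filter_upwards [L.elliptic, bilin_self_nonneg (L := L),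
      hKφ.ae_differentiableAt (μ := volume), hKη.ae_differentiableAt (μ := volume)]
      with z h1 h2 h3 h4
    have h5 := bilin_caccioppoli (L.symm_A z) h2 (grad φ z) (grad η z) (η := η z)
      (g := G' (φ z)) h.K_nonneg (h.nonneg _ (hφ0 z)) (h.abs_le _ (hφ0 z))
    refine h5.trans ?_
    rw [hR]
    simp only
    rw [hθ', grad_test (h.hasDerivAt_primitive _ (hφ0 z)) h3 h4]
    refine add_le_add le_rfl ?_
    have h6 : G (φ z) ^ 2 * bilin (L.A z) (grad η z) (grad η z) ≤ c * I z := by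
      by_cases hz : z ∈ T
      · rw [hI, indicator_of_mem hz]
        have := (h1 (grad η z)).2.trans
          (mul_le_mul_of_nonneg_left (hη.degNormSq_le z) (L.weight_u.nonneg z))
        nlinarith [mul_le_mul_of_nonneg_left this (sq_nonneg (G (φ z)))]
      · rw [hI, indicator_of_notMem hz, hη.grad_eq_zero hz]
        simp [bilin]
    nlinarith [mul_le_mul_of_nonneg_left h6 (by positivity : 0 ≤ 4 * K ^ 2)]
  -- R dominates a non-negative function on all of Ω, not only on S. So the integral may be enlarged
  -- from S to Ω, where it is a genuine integral containing a₀(φ, θ).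
  have hR0 : 0 ≤ᵐ[volume.restrict Ω.carrier] R := by
    refine ae_restrict_of_ae ?_
    filter_upwards [hkey, bilin_self_nonneg (L := L)] with z h1 h2
    exact (mul_nonneg (by positivity) (h2 _)).trans h1
  calc ∫⁻ z in S, ENNReal.ofReal (degNormSq L.lam z.1 (grad (fun z => G (φ z)) z))
        ∂(weightMeasure L.v)
      = ∫⁻ z in S, ENNReal.ofReal (L.v z)
          * ENNReal.ofReal (degNormSq L.lam z.1 (grad (fun z => G (φ z)) z)) :=
        L.weight_v.setLIntegral hS
          (measurable_degNormSq_grad L.isGrushin.continuous _).ennreal_ofReal.aemeasurable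
    _ ≤ ∫⁻ z in S, ENNReal.ofReal (R z) := by
        refine lintegral_mono_ae ?_
        filter_upwards [ae_restrict_of_ae hkey, ae_restrict_of_ae L.elliptic,
          ae_restrict_of_ae (hKφ.ae_differentiableAt (μ := volume)), ae_restrict_mem hS]
          with z h1 h2 h3 hz
        rw [← ENNReal.ofReal_mul (L.weight_v.nonneg z)]
        refine ENNReal.ofReal_le_ofReal (le_trans ?_ h1)
        rw [grad_comp (h.hasDerivAt _ (hφ0 z)) h3, degNormSq_smul, hη.eq_one z hz]
        nlinarith [mul_le_mul_of_nonneg_left (h2 (grad φ z)).1 (sq_nonneg (G' (φ z)))]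
    _ ≤ ∫⁻ z in Ω.carrier, ENNReal.ofReal (R z) := lintegral_mono_set (hST.trans hTΩ)
    _ = ENNReal.ofReal (∫ z in Ω.carrier, R z) :=
        (ofReal_integral_eq_lintegral_ofReal hRint hR0).symm
    _ = ENNReal.ofReal (2 * dirichlet φ θ + 4 * K ^ 2 * c * ∫ z in Ω.carrier, I z) := by
        rw [hR, integral_add ((integrableOn_bilin φ θ).const_mul 2)
          (hIint.const_mul (4 * K ^ 2 * c)), integral_const_mul, integral_const_mul]
        rfl
    _ ≤ ENNReal.ofReal (2 * dirichlet φ θ)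
          + ENNReal.ofReal (4 * K ^ 2 * c * ∫ z in Ω.carrier, I z) := ENNReal.ofReal_add_le
    _ = _ := by
        rw [ENNReal.ofReal_mul (p := 4 * K ^ 2 * c) (by positivity), ofReal_integral_eq_lintegral_ofReal hIint
          (ae_of_all _ fun z => indicator_nonneg (fun z _ =>
            mul_nonneg (L.weight_u.nonneg z) (sq_nonneg _)) z)]
        congr 2
        rw [L.weight_u.setLIntegral (g := fun z => ENNReal.ofReal (G (φ z) ^ 2)) hT (hGφ.pow 2).measurable.ennreal_ofReal.aemeasurable]
        have e : (fun z => ENNReal.ofReal (I z)) = T.indicator fun z =>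
            ENNReal.ofReal (L.u z) * ENNReal.ofReal (G (φ z) ^ 2) := by
          funext z
          by_cases hz : z ∈ T
          · simp [hI, hz, ENNReal.ofReal_mul (L.weight_u.nonneg z)]
          · simp [hI, hz]
        rw [e, setLIntegral_indicator hT, inter_eq_left.2 hTΩ]

/-- The test functions are bounded in `H(Ω)` in terms of the norm of `φ`. -/
theorem norm_sq_test_le {K ℓ : ℝ} {G G' Φ : ℝ → ℝ} (h : IsTestPair K ℓ G G' Φ)
    {S T : Set (Space n m)} {c : ℝ} {η : Space n m → ℝ} (hη : IsCutoff L.lam S T c η) :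
    ∃ a b : ℝ, 0 ≤ a ∧ 0 ≤ b ∧ ∀ φ θ : LipSpace L Ω, (∀ z, 0 ≤ φ z) →
      (∃ K, LipschitzWith K (φ : Space n m → ℝ)) → (∀ z, θ z = η z ^ 2 * Φ (φ z)) →
      ‖θ‖ ^ 2 ≤ a + b * ‖φ‖ ^ 2 := by
  have hvol : (volume : Measure (Space n m)).IsAddHaarMeasure :=
    Measure.prod.instIsAddHaarMeasure volume volume
  have hc : 0 ≤ c := (degNormSq_nonneg _ _ _).trans (hη.degNormSq_le 0)
  have hℓ := h.bound_nonneg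
  set U := (weightMeasure L.u).real Ω.carrier with hU
  refine ⟨(8 * c + 1) * (2 * Φ 0 ^ 2 * U), 2 * ℓ ^ 4 + (8 * c + 1) * (2 * ℓ ^ 4), by positivity,
    by positivity, fun φ θ hφ0 hφ hθ => ?_⟩
  have hθ' : (θ : Space n m → ℝ) = fun z => η z ^ 2 * Φ (φ z) := funext hθ
  obtain ⟨Kη, hKη⟩ := hη.lipschitz
  obtain ⟨Kφ, hKφ⟩ := hφ
  have hη2 : ∀ z, η z ^ 2 ≤ 1 := fun z => pow_le_one₀ (hη.nonneg z) (hη.le_one z)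
  -- Φ has slope at most ℓ², so it grows linearly and its square is controlled by the mass form of
  -- φ.
  have hΦ : ∀ z, Φ (φ z) ^ 2 ≤ 2 * Φ 0 ^ 2 + 2 * ℓ ^ 4 * (φ z * φ z) := fun z => by
    have h1 := h.abs_primitive_sub_le (hφ0 z) le_rfl
    rw [sub_zero, abs_of_nonneg (hφ0 z)] at h1
    have h2 : (Φ (φ z) - Φ 0) ^ 2 ≤ (ℓ ^ 2 * φ z) ^ 2 := sq_le_sq' (abs_le.1 h1).1 (abs_le.1 h1).2
    nlinarith [sq_nonneg (Φ (φ z) - 2 * Φ 0)]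
  have hmass : ∫ z in Ω.carrier, (2 * Φ 0 ^ 2 + 2 * ℓ ^ 4 * (φ z * φ z)) ∂(weightMeasure L.u)
      = 2 * Φ 0 ^ 2 * U + 2 * ℓ ^ 4 * massForm φ φ := by
    rw [integral_add (integrable_const _) ((integrableOn_mul φ φ).const_mul _),
      setIntegral_const, integral_const_mul, smul_eq_mul, mul_comm]
    rfl
  have hint : IntegrableOn (fun z => L.u z * (2 * Φ 0 ^ 2 + 2 * ℓ ^ 4 * (φ z * φ z)))
      Ω.carrier := by
    have hcont : Continuous fun z => 2 * Φ 0 ^ 2 + 2 * ℓ ^ 4 * (φ z * φ z) := by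
      have := hKφ.continuous
      fun_prop
    obtain ⟨M, hM⟩ := Ω.isBounded.isCompact_closure.exists_bound_of_continuousOn
      hcont.continuousOn
    refine (integrableOn_u (L := L) (Ω := Ω)).mul_bdd (c := M) hcont.aestronglyMeasurable ?_
    filter_upwards [ae_restrict_mem Ω.isOpen.measurableSet] with z hz
    exact hM z (subset_closure hz)
  have hdir : dirichlet θ θ ≤ 2 * ℓ ^ 4 * dirichlet φ φ
      + 8 * c * (2 * Φ 0 ^ 2 * U + 2 * ℓ ^ 4 * massForm φ φ) := by
    rw [← hmass, L.weight_u.setIntegral Ω.isOpen.measurableSet]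
    unfold dirichlet
    rw [← integral_const_mul, ← integral_const_mul,
      ← integral_add ((integrableOn_bilin φ φ).const_mul _) (hint.const_mul _)]
    refine integral_mono_ae (integrableOn_bilin θ θ)
      (((integrableOn_bilin φ φ).const_mul _).add (hint.const_mul _)) ?_
    refine ae_restrict_of_ae ?_
    filter_upwards [L.elliptic, bilin_self_nonneg (L := L),
      hKφ.ae_differentiableAt (μ := volume), hKη.ae_differentiableAt (μ := volume)]
      with z h1 h2 h3 h4
    rw [hθ', grad_test (h.hasDerivAt_primitive _ (hφ0 z)) h3 h4]
    refine (bilin_add_self_le (L.symm_A z) h2 _ _ _ _).trans ?_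
    have hu := L.weight_u.nonneg z
    have h5 := (h1 (grad η z)).2.trans (mul_le_mul_of_nonneg_left (hη.degNormSq_le z) hu)
    have h6 : (η z ^ 2 * G' (φ z) ^ 2) ^ 2 ≤ ℓ ^ 4 := by
      have e1 : G' (φ z) ^ 2 ≤ ℓ ^ 2 := by
        rw [← sq_abs]; exact pow_le_pow_left₀ (abs_nonneg _) (h.bound _ (hφ0 z)) 2
      have e2 : η z ^ 2 * G' (φ z) ^ 2 ≤ 1 * ℓ ^ 2 :=
        mul_le_mul (hη2 z) e1 (sq_nonneg _) zero_le_one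
      calc (η z ^ 2 * G' (φ z) ^ 2) ^ 2 ≤ (1 * ℓ ^ 2) ^ 2 :=
            pow_le_pow_left₀ (by positivity) e2 2
        _ = ℓ ^ 4 := by ring
    have h7 : (2 * η z * Φ (φ z)) ^ 2 ≤ 4 * (2 * Φ 0 ^ 2 + 2 * ℓ ^ 4 * (φ z * φ z)) := by
      have := mul_le_mul (hη2 z) (hΦ z) (sq_nonneg _) zero_le_one
      nlinarith
    have h8 := mul_le_mul_of_nonneg_right h6 (h2 (grad φ z))
    have h9 := mul_le_mul h7 h5 (h2 _) ((sq_nonneg _).trans h7)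
    linarith
  have hm : massForm θ θ ≤ 2 * Φ 0 ^ 2 * U + 2 * ℓ ^ 4 * massForm φ φ := by
    rw [← hmass]
    refine integral_mono (integrableOn_mul θ θ)
      ((integrable_const _).add ((integrableOn_mul φ φ).const_mul _)) fun z => ?_
    simp only
    rw [hθ z]
    have := mul_le_mul (pow_le_one₀ (sq_nonneg _) (hη2 z) (n := 2)) (hΦ z) (sq_nonneg _)
      zero_le_one
    linarith
  have hd0 := dirichlet_self_nonneg φ
  rw [norm_sq_lip, norm_sq_lip]
  have hl4 : 0 ≤ ℓ ^ 4 := by positivity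
  have hm0 : 0 ≤ massForm φ φ := integral_nonneg fun z => mul_self_nonneg (φ z)
  nlinarith [mul_nonneg hl4 hd0, mul_nonneg (mul_nonneg hc hl4) hd0, mul_nonneg hl4 hm0]

/-- `a₀(φ_k, θ_k) → 0` if `φ_k` converges to a weak solution and `θ_k` are bounded test
functions. -/
theorem IsWeakSolution.tendsto_dirichlet {f : HSpace L Ω} (hf : IsWeakSolution f)
    {φ θ : ℕ → LipSpace L Ω} (hφ : Tendsto (fun k => (φ k : HSpace L Ω)) atTop (𝓝 f))
    (hθ : ∀ k, (θ k : HSpace L Ω) ∈ HZero L Ω) {M : ℝ} (hM : ∀ k, ‖θ k‖ ≤ M) :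
    Tendsto (fun k => dirichlet (φ k) (θ k)) atTop (𝓝 0) := by
  set N := ‖tilde L Ω‖ with hN
  have hlim : Tendsto (fun k => (1 + N * N) * M * ‖(φ k : HSpace L Ω) - f‖) atTop (𝓝 0) := by
    simpa using (tendsto_iff_norm_sub_tendsto_zero.1 hφ).const_mul ((1 + N * N) * M)
  refine squeeze_zero_norm (fun k => ?_) hlim
  -- The vanishing a₀(f, θ_k) is subtracted, leaving a₀(φ_k - f, θ_k), which tends to 0 by
  -- Cauchy–Schwarz since the θ_k are bounded.
  have h0 : dirichlet (φ k) (θ k) = inner ℝ ((φ k : HSpace L Ω) - f) (θ k : HSpace L Ω)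
      - inner ℝ (tilde L Ω ((φ k : HSpace L Ω) - f)) (tilde L Ω (θ k)) := by
    have := hf _ (hθ k)
    rw [← a₀_coe]
    unfold a₀ at this ⊢
    rw [map_sub, inner_sub_left, inner_sub_left]
    linarith
  rw [h0]
  refine (norm_sub_le _ _).trans ?_
  have hθn : ‖(θ k : HSpace L Ω)‖ ≤ M := by
    rw [UniformSpace.Completion.norm_coe]; exact hM k
  have h1 := norm_inner_le_norm (𝕜 := ℝ) ((φ k : HSpace L Ω) - f) (θ k : HSpace L Ω)
  have h2 := norm_inner_le_norm (𝕜 := ℝ) (tilde L Ω ((φ k : HSpace L Ω) - f))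
    (tilde L Ω (θ k))
  have h3 := (tilde L Ω).le_opNorm ((φ k : HSpace L Ω) - f)
  have h4 := (tilde L Ω).le_opNorm (θ k : HSpace L Ω)
  have h5 : 0 ≤ N := norm_nonneg (tilde L Ω)
  have h6 : 0 ≤ ‖(φ k : HSpace L Ω) - f‖ := norm_nonneg _
  have h7 := h1.trans (mul_le_mul_of_nonneg_left hθn h6)
  have h8 := mul_le_mul h3 (h4.trans (mul_le_mul_of_nonneg_left hθn h5)) (norm_nonneg _)
    (mul_nonneg h5 h6)
  have h9 := h2.trans h8
  nlinarith

end Energy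

end Grushin

namespace Grushin

/-! ### Lipschitz approximation of non-negative elements of H(Ω) -/

section Approximation

variable {n m : ℕ} {L : DegenerateOperator n m} {Ω : BoundedOpen n m}

/-- On the open set Ω the difference vanishes together with its gradient, so its seminorm is zero.
-/
theorem coe_eq_coe_of_eqOn {φ ψ : LipSpace L Ω} (h : ∀ z ∈ Ω.carrier, φ z = ψ z) :
    (φ : HSpace L Ω) = (ψ : HSpace L Ω) := by
  have hd : ∀ z ∈ Ω.carrier, (φ - ψ) z = 0 := fun z hz => by
    have : (φ - ψ) z = φ z - ψ z := rfl
    rw [this, h z hz, sub_self]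
  have h1 : ‖φ - ψ‖ ^ 2 = 0 := by
    rw [norm_sq_lip]
    have e1 : dirichlet (φ - ψ) (φ - ψ) = 0 := by
      refine (setIntegral_congr_fun (g := fun _ => (0 : ℝ)) Ω.isOpen.measurableSet
        fun z hz => ?_).trans (by simp)
      have : (⇑(φ - ψ) : Space n m → ℝ) =ᶠ[𝓝 z] fun _ => 0 := by
        filter_upwards [Ω.isOpen.mem_nhds hz] with w hw using hd w hw
      have hg : grad (φ - ψ) z = 0 := by
        ext i
        simp [grad, this.fderiv_eq]
      simp [hg, bilin]
    have e2 : massForm (φ - ψ) (φ - ψ) = 0 := by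
      refine (setIntegral_congr_fun (g := fun _ => (0 : ℝ)) Ω.isOpen.measurableSet
        fun z hz => ?_).trans (by simp)
      simp only
      rw [hd z hz, mul_zero]
    rw [e1, e2, add_zero]
  rw [← sub_eq_zero, ← UniformSpace.Completion.coe_sub, ← norm_eq_zero,
    UniformSpace.Completion.norm_coe]
  exact pow_eq_zero_iff two_ne_zero |>.1 h1

/-- Extend from the closure as a Lipschitz function and truncate from below at 0 and from above by a
bound on the closure. A representative that is non-negative, bounded and Lipschitz everywhere makes
its compositions with G and Φ globally Lipschitz. -/
theorem exists_nonneg_extension (φ : LipSpace L Ω) (h : ∀ z ∈ closure Ω.carrier, 0 ≤ φ z) :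
    ∃ ψ : LipSpace L Ω, (ψ : HSpace L Ω) = φ ∧ (∀ z, 0 ≤ ψ z) ∧
      (∃ K, LipschitzWith K (ψ : Space n m → ℝ)) ∧ ∃ M, ∀ z, ψ z ≤ M := by
  obtain ⟨K, hK⟩ := φ.2
  obtain ⟨M, hM⟩ := Ω.isBounded.isCompact_closure.exists_bound_of_continuousOn hK.continuousOn
  obtain ⟨g, hg, hgφ⟩ := hK.extend_real
  have hlip : LipschitzWith K fun z => max 0 (min (g z) (max M 0)) :=
    (hg.min_const _).const_max 0
  refine ⟨⟨fun z => max 0 (min (g z) (max M 0)), K, hlip.lipschitzOnWith⟩,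
    coe_eq_coe_of_eqOn fun z hz => ?_, fun z => le_max_left _ _, ⟨K, hlip⟩, max M 0,
    fun z => max_le (le_max_right _ _) (min_le_right _ _)⟩
  have hz' := subset_closure hz
  have h1 : g z = φ z := (hgφ hz').symm
  have h2 : φ z ≤ M := (le_abs_self _).trans (hM z hz')
  change max 0 (min (g z) (max M 0)) = φ z
  rw [h1, min_eq_left (h2.trans (le_max_left _ _)), max_eq_right (h z hz')]

/-- Approximation of a non-negative element of `H(Ω)` by globally defined Lipschitz functions,
almost everywhere and in `H(Ω)`. -/
structure IsApprox (f : HSpace L Ω) (φ : ℕ → LipSpace L Ω) : Prop where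
  nonneg : ∀ k z, 0 ≤ φ k z
  lipschitz : ∀ k, ∃ K, LipschitzWith K (φ k : Space n m → ℝ)
  bounded : ∀ k, ∃ M, ∀ z, φ k z ≤ M
  tendsto : Tendsto (fun k => (φ k : HSpace L Ω)) atTop (𝓝 f)
  tendsto_ae : ∀ᵐ z ∂((weightMeasure L.u).restrict Ω.carrier),
    Tendsto (fun k => φ k z) atTop (𝓝 (tilde L Ω f z))

theorem tendsto_eLpNorm_sub {f : HSpace L Ω} {φ : ℕ → LipSpace L Ω}
    (h : Tendsto (fun k => (φ k : HSpace L Ω)) atTop (𝓝 f)) :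
    Tendsto (fun k => eLpNorm (⇑(φ k) - ⇑(tilde L Ω f)) 2
      ((weightMeasure L.u).restrict Ω.carrier)) atTop (𝓝 0) := by
  have h1 := (((tilde L Ω).continuous.tendsto f).comp h)
  rw [Lp.tendsto_Lp_iff_tendsto_eLpNorm'] at h1
  refine h1.congr fun k => eLpNorm_congr_ae ?_
  have e : (tilde L Ω (φ k : HSpace L Ω) : Space n m → ℝ)
      =ᵐ[(weightMeasure L.u).restrict Ω.carrier] φ k := by
    rw [tilde_coe]
    exact (memLp_lip (φ k)).coeFn_toLp
  exact e.sub ae_eq_rfl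

theorem IsNonneg.exists_isApprox {f : HSpace L Ω} (hf : IsNonneg f) : ∃ φ, IsApprox f φ := by
  obtain ⟨φ, hφ0, hφ⟩ := hf
  choose ψ h1 h2 h3 h4 using fun k => exists_nonneg_extension (φ k) (hφ0 k)
  have hψ : Tendsto (fun k => (ψ k : HSpace L Ω)) atTop (𝓝 f) := by simpa only [h1] using hφ
  -- Convergence in L² implies convergence in measure, whence an almost everywhere convergent
  -- subsequence.
  have hm : TendstoInMeasure ((weightMeasure L.u).restrict Ω.carrier)
      (fun k => (ψ k : Space n m → ℝ)) atTop (tilde L Ω f) :=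
    tendstoInMeasure_of_tendsto_eLpNorm two_ne_zero
      (fun k => (memLp_lip (ψ k)).aestronglyMeasurable) (Lp.aestronglyMeasurable _)
      (tendsto_eLpNorm_sub hψ)
  obtain ⟨ns, hns, hae⟩ := hm.exists_seq_tendsto_ae
  exact ⟨ψ ∘ ns, fun k => h2 _, fun k => h3 _, fun k => h4 _, hψ.comp hns.tendsto_atTop, hae⟩

theorem IsNonneg.tilde_nonneg {f : HSpace L Ω} (hf : IsNonneg f) :
    ∀ᵐ z ∂((weightMeasure L.u).restrict Ω.carrier), 0 ≤ tilde L Ω f z := by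
  obtain ⟨φ, hφ⟩ := hf.exists_isApprox
  filter_upwards [hφ.tendsto_ae] with z hz
  exact ge_of_tendsto' hz fun k => hφ.nonneg k z

end Approximation

/-! ### Sobolev inequality on a ball -/

section LocalSobolev

variable {n m : ℕ}

/-- The Sobolev-Poincaré inequality without subtraction of the mean value. -/
theorem SobolevPoincare.local_sobolev {q C : ℝ} {lam : EuclideanSpace ℝ (Fin n) → ℝ}
    {u v : Space n m → ℝ} (h : SobolevPoincare q C lam u v) (hq : 2 < q) {g : Space n m → ℝ}
    (hg : ∃ K : ℝ≥0, LipschitzWith K g) (z : Space n m) {r : ℝ} (hr : 0 < r)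
    (h0 : weightMeasure u (rhoBall lam z r) ≠ 0) (htop : weightMeasure u (rhoBall lam z r) ≠ ∞) :
    ((weightMeasure u (rhoBall lam z r))⁻¹ *
        ∫⁻ z in rhoBall lam z r, ENNReal.ofReal (|g z| ^ q) ∂(weightMeasure u)) ^ (1 / q) ≤
      ENNReal.ofReal (C * r) * ((weightMeasure v (rhoBall lam z r))⁻¹ *
          ∫⁻ z in rhoBall lam z r,
            ENNReal.ofReal (degNormSq lam z.1 (grad g z)) ∂(weightMeasure v)) ^ (1 / 2 : ℝ) +
      ((weightMeasure u (rhoBall lam z r))⁻¹ *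
        ∫⁻ z in rhoBall lam z r, ENNReal.ofReal (g z ^ 2) ∂(weightMeasure u)) ^ (1 / 2 : ℝ) := by
  have hsp := h g hg z r hr
  set B := rhoBall lam z r with hB
  set mB := wAverage u B g with hmB
  -- For the normalised measure all averages become norms of a probability space.
  set ν : Measure (Space n m) := (weightMeasure u B)⁻¹ • (weightMeasure u).restrict B with hν
  have hprob : IsProbabilityMeasure ν := ⟨by
    rw [hν, Measure.smul_apply, Measure.restrict_apply_univ, smul_eq_mul,
      ENNReal.inv_mul_cancel h0 htop]⟩
  have hgc : Continuous g := by obtain ⟨K, hK⟩ := hg; exact hK.continuous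
  have hq0 : 0 < q := by linarith
  have key : ∀ (s : ℝ) (k : Space n m → ℝ), 0 < s →
      ((weightMeasure u B)⁻¹ * ∫⁻ z in B, ENNReal.ofReal (|k z| ^ s) ∂(weightMeasure u)) ^ (1 / s)
        = eLpNorm k (ENNReal.ofReal s) ν := by
    intro s k hs
    rw [eLpNorm_eq_lintegral_rpow_enorm_toReal (by simpa using hs) ENNReal.ofReal_ne_top,
      ENNReal.toReal_ofReal hs.le, hν, lintegral_smul_measure, smul_eq_mul]
    congr 3
    funext z
    rw [Real.enorm_eq_ofReal_abs, ENNReal.ofReal_rpow_of_nonneg (abs_nonneg _) hs.le]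
  have e2 : ((weightMeasure u B)⁻¹ *
      ∫⁻ z in B, ENNReal.ofReal (g z ^ 2) ∂(weightMeasure u)) ^ (1 / 2 : ℝ)
        = eLpNorm g (ENNReal.ofReal 2) ν := by
    rw [← key 2 g two_pos]
    congr 3
    funext z
    rw [Real.rpow_two, sq_abs]
  rw [key q (fun z => g z - mB) hq0] at hsp
  rw [key q g hq0, e2]
  have hm : mB = ∫ z, g z ∂ν := by
    rw [hmB, wAverage, hν, integral_smul_measure, smul_eq_mul, ENNReal.toReal_inv]
    rfl
  -- The mean is bounded by the L¹ norm, hence by the L² norm, as ν is a probability measure.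
  have hconst : eLpNorm (fun _ : Space n m => mB) (ENNReal.ofReal q) ν
      ≤ eLpNorm g (ENNReal.ofReal 2) ν := by
    rw [eLpNorm_const mB (by simpa using hq0) hprob.ne_zero, measure_univ, ENNReal.one_rpow,
      mul_one, hm]
    refine (enorm_integral_le_lintegral_enorm g).trans ?_
    rw [← eLpNorm_one_eq_lintegral_enorm]
    exact eLpNorm_le_eLpNorm_of_exponent_le (by norm_num) hgc.aestronglyMeasurable
  have hsplit : g = (fun z => g z - mB) + fun _ => mB := by ext z; simp
  calc eLpNorm g (ENNReal.ofReal q) ν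
      ≤ eLpNorm (fun z => g z - mB) (ENNReal.ofReal q) ν
          + eLpNorm (fun _ => mB) (ENNReal.ofReal q) ν := by
        conv_lhs => rw [hsplit]
        refine eLpNorm_add_le (hgc.sub continuous_const).aestronglyMeasurable
          aestronglyMeasurable_const ?_
        rw [← ENNReal.ofReal_one]
        exact ENNReal.ofReal_le_ofReal (by linarith)
    _ ≤ _ := add_le_add hsp hconst

end LocalSobolev

end Grushin

namespace Grushin

/-! ### The local estimate for the weak solution -/

section Step

variable {n m : ℕ} {L : DegenerateOperator n m}

theorem test_mem_HZero {Ω : BoundedOpen n m} {T : Set (Space n m)} (hT : closure T ⊆ Ω.carrier)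
    (hTb : Bornology.IsBounded T) (θ : LipSpace L Ω) (hθ : ∀ z ∉ T, θ z = 0) :
    (θ : HSpace L Ω) ∈ HZero L Ω :=
  subset_closure ⟨θ, rfl, closure T, hTb.isCompact_closure, hT,
    fun z hz => hθ z fun hzT => hz.2 (subset_closure hzT)⟩

theorem closure_rect_subset (hn : 0 < n) {lam : EuclideanSpace ℝ (Fin n) → ℝ}
    (hlam : IsGrushinFunction lam) (z : Space n m) {r s : ℝ} (hr : 0 < r) (hrs : r < s) :
    closure (rect lam z r) ⊆ rect lam z s := by
  have hL := Lam_pos hn hlam z (hr.trans hrs)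
  have hmono : Lam lam z r ≤ Lam lam z s := Lam_mono hlam hr (by simpa using hrs.le)
  rw [rect, closure_prod_eq]
  refine prod_mono (Metric.closure_ball_subset_closedBall.trans
    (Metric.closedBall_subset_ball hrs)) (Metric.closure_ball_subset_closedBall.trans
    (Metric.closedBall_subset_ball ?_))
  calc r * Lam lam z r ≤ r * Lam lam z s := mul_le_mul_of_nonneg_left hmono hr.le
    _ < s * Lam lam z s := mul_lt_mul_of_pos_right hrs hL

/-- The test functions `η² Φ(φ_k)`. -/
theorem exists_test {Ω : BoundedOpen n m} {K ℓ : ℝ} {G G' Φ : ℝ → ℝ} (h : IsTestPair K ℓ G G' Φ)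
    {S T : Set (Space n m)} {c : ℝ} {η : Space n m → ℝ} (hη : IsCutoff L.lam S T c η)
    (φ : LipSpace L Ω) (h0 : ∀ z, 0 ≤ φ z) (hφ : ∃ K, LipschitzWith K (φ : Space n m → ℝ))
    (hb : ∃ M, ∀ z, φ z ≤ M) : ∃ θ : LipSpace L Ω, ∀ z, θ z = η z ^ 2 * Φ (φ z) := by
  obtain ⟨M, hM⟩ := hb
  have hη1 : ∀ z, |η z| ≤ 1 := fun z => by rw [abs_of_nonneg (hη.nonneg z)]; exact hη.le_one z
  have h1 : ∃ K, LipschitzWith K fun z => η z * η z :=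
    LipschitzWith.mul_of_bounded hη.lipschitz hη.lipschitz hη1 hη1
  have h2 : ∃ K, LipschitzWith K fun z => Φ (φ z) :=
    exists_lipschitzWith_comp (fun s t => h.abs_primitive_sub_le) (sq_nonneg ℓ) hφ h0
  have h3 : ∀ z, |Φ (φ z)| ≤ |Φ 0| + ℓ ^ 2 * M := fun z => by
    have h4 := h.abs_primitive_sub_le (h0 z) le_rfl
    rw [sub_zero, abs_of_nonneg (h0 z)] at h4
    have h5 := abs_add_le (Φ (φ z) - Φ 0) (Φ 0)
    rw [sub_add_cancel] at h5
    nlinarith [mul_le_mul_of_nonneg_left (hM z) (sq_nonneg ℓ)]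
  have h6 : ∀ z, |η z * η z| ≤ 1 := fun z => by
    rw [abs_mul]; exact mul_le_one₀ (hη1 z) (abs_nonneg _) (hη1 z)
  obtain ⟨K', hK'⟩ := LipschitzWith.mul_of_bounded h1 h2 h6 h3
  exact ⟨⟨fun z => η z * η z * Φ (φ z), K', hK'.lipschitzOnWith⟩, fun z => by
    rw [pow_two]⟩

theorem lintegral_ofReal_sq_eq {μ : Measure (Space n m)} (g : Space n m → ℝ) :
    ∫⁻ z, ENNReal.ofReal (g z ^ 2) ∂μ = eLpNorm g 2 μ ^ 2 := by
  rw [eLpNorm_eq_lintegral_rpow_enorm_toReal two_ne_zero ENNReal.ofNat_ne_top,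
    ← ENNReal.rpow_two, ← ENNReal.rpow_mul]
  simp only [ENNReal.toReal_ofNat, one_div, ne_eq, OfNat.ofNat_ne_zero, not_false_eq_true,
    inv_mul_cancel₀, ENNReal.rpow_one, ENNReal.rpow_ofNat]
  refine lintegral_congr fun z => ?_
  rw [Real.enorm_eq_ofReal_abs, ← ENNReal.ofReal_pow (abs_nonneg _), sq_abs]

/-- The local Sobolev inequality for `G(f̃)`, with the Dirichlet integral replaced by its bound
from the Caccioppoli inequality. -/
theorem local_estimate {q C₅ : ℝ} (hq : 2 < q) {Ω : BoundedOpen n m}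
    (hsp : SobolevPoincare q C₅ L.lam L.u L.v) {K ℓ : ℝ}
    {G G' Φ : ℝ → ℝ} (h : IsTestPair K ℓ G G' Φ) {S T : Set (Space n m)} (hS : MeasurableSet S)
    (hT : MeasurableSet T) (hST : S ⊆ T) (hTΩ : closure T ⊆ Ω.carrier) {c : ℝ}
    {η : Space n m → ℝ} (hη : IsCutoff L.lam S T c η) {f : HSpace L Ω} (hf : IsNonneg f)
    (hsol : IsWeakSolution f) (p : Space n m) {r : ℝ} (hr : 0 < r) (hB : rhoBall L.lam p r ⊆ S)
    (hu0 : weightMeasure L.u (rhoBall L.lam p r) ≠ 0)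
    (hv0 : weightMeasure L.v (rhoBall L.lam p r) ≠ 0) :
    ∫⁻ z in rhoBall L.lam p r, ENNReal.ofReal (G (tilde L Ω f z) ^ q) ∂(weightMeasure L.u) ≤
      weightMeasure L.u (rhoBall L.lam p r) *
        (ENNReal.ofReal (C₅ * r) * ((weightMeasure L.v (rhoBall L.lam p r))⁻¹ *
          (ENNReal.ofReal (4 * K ^ 2 * c) *
            ∫⁻ z in T, ENNReal.ofReal (G (tilde L Ω f z) ^ 2) ∂(weightMeasure L.u))) ^ (1 / 2 : ℝ) +
          ((weightMeasure L.u (rhoBall L.lam p r))⁻¹ *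
            ∫⁻ z in T, ENNReal.ofReal (G (tilde L Ω f z) ^ 2) ∂(weightMeasure L.u)) ^ (1 / 2 : ℝ))
          ^ q := by
  obtain ⟨φ, hφ⟩ := hf.exists_isApprox
  have hTΩ' : T ⊆ Ω.carrier := subset_closure.trans hTΩ
  have hBΩ : rhoBall L.lam p r ⊆ Ω.carrier := hB.trans (hST.trans hTΩ')
  have hq0 : 0 < q := by linarith
  choose θ hθ using fun k =>
    exists_test h hη (φ k) (hφ.nonneg k) (hφ.lipschitz k) (hφ.bounded k)
  have hθ0 : ∀ k, (θ k : HSpace L Ω) ∈ HZero L Ω := fun k =>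
    test_mem_HZero hTΩ (Ω.isBounded.subset hTΩ') (θ k) fun z hz => by
      rw [hθ, hη.eq_zero z hz]; simp
  obtain ⟨A, hA⟩ : ∃ A, ∀ k, ‖θ k‖ ≤ A := by
    obtain ⟨a, b, ha, hb, hab⟩ := norm_sq_test_le (Ω := Ω) h hη
    obtain ⟨R, hR⟩ := hφ.tendsto.norm.bddAbove_range
    refine ⟨Real.sqrt (a + b * R ^ 2), fun k => Real.le_sqrt_of_sq_le ?_⟩
    have h1 : ‖φ k‖ ≤ R := by
      rw [← UniformSpace.Completion.norm_coe]; exact hR ⟨k, rfl⟩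
    have h2 : ‖φ k‖ ^ 2 ≤ R ^ 2 := pow_le_pow_left₀ (norm_nonneg _) h1 2
    exact (hab _ _ (hφ.nonneg k) (hφ.lipschitz k) (hθ k)).trans
      (add_le_add le_rfl (mul_le_mul_of_nonneg_left h2 hb))
  have hdir := hsol.tendsto_dirichlet hφ.tendsto hθ0 hA
  have hGc : ∀ k, Continuous fun z => G (φ k z) := fun k => by
    obtain ⟨K', hK'⟩ := exists_lipschitzWith_comp (fun s t => h.abs_sub_le) h.bound_nonneg
      (hφ.lipschitz k) (hφ.nonneg k)
    exact hK'.continuous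
  have hpos := hf.tilde_nonneg
  have hGlim : ∀ᵐ z ∂((weightMeasure L.u).restrict Ω.carrier),
      Tendsto (fun k => G (φ k z)) atTop (𝓝 (G (tilde L Ω f z))) := by
    filter_upwards [hφ.tendsto_ae, hpos] with z h1 h2
    exact (h.hasDerivAt _ h2).continuousAt.tendsto.comp h1
  have hGm : AEMeasurable (fun z => G (tilde L Ω f z))
      ((weightMeasure L.u).restrict Ω.carrier) :=
    aemeasurable_of_tendsto_metrizable_ae atTop (fun k => (hGc k).aemeasurable) hGlim
  set μT := (weightMeasure L.u).restrict T with hμT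
  set B := rhoBall L.lam p r with hBdef
  set J := eLpNorm (fun z => G (tilde L Ω f z)) 2 μT with hJ
  set δ : ℕ → ℝ≥0∞ := fun k => ENNReal.ofReal ℓ * eLpNorm (⇑(φ k) - ⇑(tilde L Ω f)) 2
      ((weightMeasure L.u).restrict Ω.carrier) with hδ
  have hδlim : Tendsto δ atTop (𝓝 0) := by
    simpa using ENNReal.Tendsto.const_mul (a := ENNReal.ofReal ℓ) (tendsto_eLpNorm_sub hφ.tendsto)
      (Or.inr ENNReal.ofReal_ne_top)
  have hac : μT ≤ (weightMeasure L.u).restrict Ω.carrier := Measure.restrict_mono hTΩ' le_rfl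
  -- G is Lipschitz on [0, ∞), so replacing φ_k by f̃ costs at most ℓ times their L² distance, which
  -- is δ_k → 0.
  have hJk : ∀ k, eLpNorm (fun z => G (φ k z)) 2 μT ≤ J + δ k := by
    intro k
    have e : (fun z => G (φ k z)) = (fun z => G (tilde L Ω f z))
        + fun z => G (φ k z) - G (tilde L Ω f z) := by ext z; simp
    have hm := (hGm.mono_measure hac).aestronglyMeasurable
    rw [e]
    refine (eLpNorm_add_le hm ((hGc k).aestronglyMeasurable.sub hm) one_le_two).trans
      (add_le_add le_rfl ?_)
    refine le_trans ?_ (mul_le_mul_right (eLpNorm_mono_measure _ hac) _)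
    refine eLpNorm_le_mul_eLpNorm_of_ae_le_mul (c := ℓ) ?_ 2
    filter_upwards [ae_mono hac hpos] with z hz
    exact h.abs_sub_le (hφ.nonneg k z) hz
  -- The right-hand side as a continuous function of the two errors, 2a₀(φ_k, θ_k) and δ_k; its
  -- value at (0, 0) is the bound sought.
  set R : ℝ≥0∞ × ℝ≥0∞ → ℝ≥0∞ := fun x => ENNReal.ofReal (C₅ * r) * ((weightMeasure L.v B)⁻¹ *
      (x.1 + ENNReal.ofReal (4 * K ^ 2 * c) * (J + x.2) ^ 2)) ^ (1 / 2 : ℝ)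
      + ((weightMeasure L.u B)⁻¹ * (J + x.2) ^ 2) ^ (1 / 2 : ℝ) with hR
  have hRcont : Continuous R := by
    have c1 : Continuous fun x : ℝ≥0∞ × ℝ≥0∞ => (J + x.2) ^ 2 :=
      (ENNReal.continuous_pow 2).comp (continuous_const.add continuous_snd)
    have c2 : ∀ a : ℝ≥0∞, a ≠ ∞ → Continuous fun x : ℝ≥0∞ => a * x := fun a ha =>
      ENNReal.continuous_const_mul ha
    refine ((c2 _ ENNReal.ofReal_ne_top).comp (ENNReal.continuous_rpow_const.comp
      ((c2 _ (ENNReal.inv_ne_top.2 hv0)).comp (continuous_fst.add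
        ((c2 _ ENNReal.ofReal_ne_top).comp c1))))).add
      (ENNReal.continuous_rpow_const.comp ((c2 _ (ENNReal.inv_ne_top.2 hu0)).comp c1))
  have hutop : weightMeasure L.u B ≠ ∞ :=
    ((measure_mono hBΩ).trans_lt weightMeasure_lt_top).ne
  have hstep : ∀ k, ∫⁻ z in B, ENNReal.ofReal (G (φ k z) ^ q) ∂(weightMeasure L.u) ≤
      weightMeasure L.u B *
        R (ENNReal.ofReal (2 * dirichlet (φ k) (θ k)), δ k) ^ q := by
    intro k
    have h1 := hsp.local_sobolev hq (exists_lipschitzWith_comp (fun s t => h.abs_sub_le)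
      h.bound_nonneg (hφ.lipschitz k) (hφ.nonneg k)) p hr hu0 hutop
    have h2 := caccioppoli h hS hT hTΩ' hST hη (φ k) (θ k) (hφ.nonneg k) (hφ.lipschitz k) (hθ k)
    rw [lintegral_ofReal_sq_eq (fun z => G (φ k z))] at h2
    have h3 : ∫⁻ z in B, ENNReal.ofReal (G (φ k z) ^ 2) ∂(weightMeasure L.u) ≤ (J + δ k) ^ 2 := by
      refine (lintegral_mono_set (hB.trans hST)).trans ?_
      rw [lintegral_ofReal_sq_eq (fun z => G (φ k z))]
      exact pow_le_pow_left' (hJk k) 2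
    have h4 : ((weightMeasure L.u B)⁻¹ *
        ∫⁻ z in B, ENNReal.ofReal (G (φ k z) ^ q) ∂(weightMeasure L.u)) ^ (1 / q) ≤
        R (ENNReal.ofReal (2 * dirichlet (φ k) (θ k)), δ k) := by
      have e : ∀ z, |G (φ k z)| = G (φ k z) := fun z => abs_of_nonneg (h.nonneg _ (hφ.nonneg k z))
      simp only [e] at h1
      refine h1.trans (add_le_add (mul_le_mul_right (ENNReal.rpow_le_rpow (mul_le_mul_right
        ?_ _) (by norm_num)) _) (ENNReal.rpow_le_rpow (mul_le_mul_right h3 _) (by norm_num)))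
      exact (lintegral_mono_set hB).trans (h2.trans (add_le_add le_rfl
        (mul_le_mul_right (pow_le_pow_left' (hJk k) 2) _)))
    rw [one_div, ENNReal.rpow_inv_le_iff hq0] at h4
    rwa [mul_comm, ← div_eq_mul_inv, ENNReal.div_le_iff hu0 hutop, mul_comm] at h4
  have hRlim : Tendsto (fun k => weightMeasure L.u B *
      R (ENNReal.ofReal (2 * dirichlet (φ k) (θ k)), δ k) ^ q) atTop
      (𝓝 (weightMeasure L.u B * R (0, 0) ^ q)) := by
    refine ENNReal.Tendsto.const_mul ?_ (Or.inr hutop)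
    refine ((ENNReal.continuous_rpow_const.comp hRcont).tendsto (0, 0)).comp ?_
    refine Tendsto.prodMk_nhds ?_ hδlim
    have := ENNReal.tendsto_ofReal (hdir.const_mul 2)
    simpa using this
  -- Fatou's lemma on the left, continuity of R on the right; no prior integrability of G(f̃)^q is
  -- needed.
  have hfin : ∫⁻ z in B, ENNReal.ofReal (G (tilde L Ω f z) ^ q) ∂(weightMeasure L.u) ≤
      weightMeasure L.u B * R (0, 0) ^ q := by
    have hacB : (weightMeasure L.u).restrict B ≤ (weightMeasure L.u).restrict Ω.carrier :=
      Measure.restrict_mono hBΩ le_rfl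
    calc ∫⁻ z in B, ENNReal.ofReal (G (tilde L Ω f z) ^ q) ∂(weightMeasure L.u)
        = ∫⁻ z in B, liminf (fun k => ENNReal.ofReal (G (φ k z) ^ q)) atTop
            ∂(weightMeasure L.u) := by
          refine lintegral_congr_ae ?_
          filter_upwards [ae_mono hacB hGlim] with z hz
          exact (ENNReal.tendsto_ofReal (hz.rpow_const (Or.inr hq0.le))).liminf_eq.symm
      _ ≤ liminf (fun k => ∫⁻ z in B, ENNReal.ofReal (G (φ k z) ^ q) ∂(weightMeasure L.u))
            atTop := lintegral_liminf_le fun k =>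
          ((hGc k).measurable.pow_const q).ennreal_ofReal
      _ ≤ liminf (fun k => weightMeasure L.u B *
            R (ENNReal.ofReal (2 * dirichlet (φ k) (θ k)), δ k) ^ q) atTop :=
          liminf_le_liminf (Eventually.of_forall hstep)
      _ = _ := hRlim.liminf_eq
  simpa only [hR, zero_add, add_zero, hJ, hμT, ← lintegral_ofReal_sq_eq] using hfin

end Step

end Grushin

namespace Grushin

/-! ### The reverse Hölder inequality -/

section StepConstants

variable {n m : ℕ} {L : DegenerateOperator n m}

theorem ENNReal.inv_le_mul_inv_of_le_mul {a b w : ℝ≥0∞} (h : a ≤ w * b) (hw : w ≠ ∞)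
    (ha : a ≠ 0) (hb' : b ≠ ∞) : b⁻¹ ≤ w * a⁻¹ := by
  have hw0 : w ≠ 0 := by rintro rfl; simp at h; exact ha h
  have hb : b ≠ 0 := by rintro rfl; simp at h; exact ha h
  calc b⁻¹ = w * (w * b)⁻¹ := by
        rw [ENNReal.mul_inv (Or.inl hw0) (Or.inl hw), ← mul_assoc, ENNReal.mul_inv_cancel hw0 hw,
          one_mul]
    _ ≤ w * a⁻¹ := mul_le_mul_right (ENNReal.inv_le_inv.2 h) _

/-- This is where μ(Q) enters: V⁻¹ = M² U⁻¹ turns the normalisation by v into one by u. The factor w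
pays for replacing the masses of a small ball by those of Q, and d stands for the Sobolev constant
times the radius. -/
theorem bracket_le {U V uB vB I : ℝ≥0∞} {w K c d M : ℝ} (hU0 : U ≠ 0) (hU : U ≠ ∞) (hV0 : V ≠ 0)
    (hV : V ≠ ∞) (huB : uB ≠ ∞) (hvB : vB ≠ ∞) (hu : U ≤ ENNReal.ofReal w * uB)
    (hv : V ≤ ENNReal.ofReal w * vB) (hd : 0 ≤ d) (hK : 0 ≤ K) (hw : 0 ≤ w) (hc : 0 ≤ c)
    (hM : M = U.toReal ^ (1 / 2 : ℝ) * V.toReal ^ (-(1 / 2) : ℝ)) :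
    ENNReal.ofReal d * (vB⁻¹ * (ENNReal.ofReal (4 * K ^ 2 * c) * I)) ^ (1 / 2 : ℝ)
        + (uB⁻¹ * I) ^ (1 / 2 : ℝ) ≤
      ENNReal.ofReal (w ^ (1 / 2 : ℝ) * (1 + 2 * d * Real.sqrt c * (K * M)))
        * (U⁻¹ * I) ^ (1 / 2 : ℝ) := by
  have hUp : 0 < U.toReal := ENNReal.toReal_pos hU0 hU
  have hVp : 0 < V.toReal := ENNReal.toReal_pos hV0 hV
  have hM0 : 0 ≤ M := by rw [hM]; positivity
  have hM2 : M ^ 2 = U.toReal / V.toReal := by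
    rw [hM, mul_pow, ← Real.rpow_natCast, ← Real.rpow_natCast, ← Real.rpow_mul hUp.le,
      ← Real.rpow_mul hVp.le]
    norm_num
    rw [Real.rpow_neg_one, div_eq_mul_inv]
  have hVinv : V⁻¹ = ENNReal.ofReal (M ^ 2) * U⁻¹ := by
    rw [hM2, ENNReal.ofReal_div_of_pos hVp, ENNReal.ofReal_toReal hU, ENNReal.ofReal_toReal hV,
      div_eq_mul_inv, mul_right_comm, ENNReal.mul_inv_cancel hU0 hU, one_mul]
  have h1 : vB⁻¹ * (ENNReal.ofReal (4 * K ^ 2 * c) * I)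
      ≤ ENNReal.ofReal (w * M ^ 2 * (4 * K ^ 2 * c)) * (U⁻¹ * I) := by
    refine (mul_le_mul_left (ENNReal.inv_le_mul_inv_of_le_mul hv ENNReal.ofReal_ne_top hV0 hvB)
      _).trans_eq ?_
    rw [hVinv, ENNReal.ofReal_mul (p := w * M ^ 2) (by positivity), ENNReal.ofReal_mul hw]
    ring
  have h2 : uB⁻¹ * I ≤ ENNReal.ofReal w * (U⁻¹ * I) := by
    refine (mul_le_mul_left (ENNReal.inv_le_mul_inv_of_le_mul hu ENNReal.ofReal_ne_top hU0 huB)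
      _).trans_eq ?_
    ring
  have hhalf : (0 : ℝ) ≤ 1 / 2 := by norm_num
  refine (add_le_add (mul_le_mul_right (ENNReal.rpow_le_rpow h1 hhalf) _)
    (ENNReal.rpow_le_rpow h2 hhalf)).trans_eq ?_
  rw [ENNReal.mul_rpow_of_nonneg _ (U⁻¹ * I) hhalf, ENNReal.mul_rpow_of_nonneg _ (U⁻¹ * I) hhalf,
    ENNReal.ofReal_rpow_of_nonneg (by positivity) hhalf, ENNReal.ofReal_rpow_of_nonneg hw hhalf,
    ← mul_assoc, ← ENNReal.ofReal_mul hd, ← add_mul, ← ENNReal.ofReal_add (by positivity)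
    (by positivity)]
  congr 2
  rw [show w * M ^ 2 * (4 * K ^ 2 * c) = w * ((2 * (K * M)) ^ 2 * c) by ring,
    Real.mul_rpow hw (by positivity), ← Real.sqrt_eq_rpow, ← Real.sqrt_eq_rpow,
    Real.sqrt_mul (by positivity), Real.sqrt_sq (by positivity)]
  ring

/-- The exponent of `(b - a)⁻¹` in one step of the iteration. -/
noncomputable def stepDim (C₃ C₄ q : ℝ) : ℝ :=
  doublingDim C₃ / q + (doublingDim C₃ + doublingDim C₄) / 2

/-- The constant in one step of the iteration. -/
noncomputable def stepConst (n m : ℕ) (C₅ : ℝ) : ℝ := 1 + 2 * C₅ * Real.sqrt (n + m)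

theorem stepDim_pos (C₃ C₄ : ℝ) {q : ℝ} (hq : 0 < q) : 0 < stepDim C₃ C₄ q := by
  have := doublingDim_pos C₃
  have := doublingDim_pos C₄
  unfold stepDim
  positivity

theorem one_le_stepConst {C₅ : ℝ} (h : 0 ≤ C₅) : 1 ≤ stepConst n m C₅ := by
  unfold stepConst
  have : 0 ≤ 2 * C₅ * Real.sqrt (n + m) := by positivity
  linarith

/-- One step of the Moser iteration: a reverse Hölder inequality for `G(f̃)`. -/
theorem reverse_holder {C₁ C₂ C₃ C₄ C₅ q : ℝ} (hn : 0 < n) (hC₅ : 0 ≤ C₅) (hq : 2 < q)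
    (hL : Admissible C₁ C₂ C₃ C₄ C₅ q L) {z₀ : Space n m} {h : ℝ} (hh : 0 < h)
    {f : HSpace L (rectOpen L.lam z₀ h)} (hf : IsNonneg f) (hsol : IsWeakSolution f)
    {a b : ℝ} (ha : 0 < a) (hab : a < b) (hb : b ≤ 1) {K ℓ : ℝ} {G G' Φ : ℝ → ℝ}
    (hG : IsTestPair K ℓ G G' Φ) :
    ((weightMeasure L.u (rect L.lam z₀ h))⁻¹ * ∫⁻ z in rect L.lam z₀ (a * h),
        ENNReal.ofReal (G (tilde L _ f z) ^ q) ∂(weightMeasure L.u)) ^ (2 / q) ≤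
      ENNReal.ofReal ((stepConst n m C₅ * (1200 / (b - a)) ^ stepDim C₃ C₄ q
          * (1 + K * muRatio L (rect L.lam z₀ h))) ^ 2) *
        ((weightMeasure L.u (rect L.lam z₀ h))⁻¹ * ∫⁻ z in rect L.lam z₀ (b * h),
          ENNReal.ofReal (G (tilde L _ f z) ^ 2) ∂(weightMeasure L.u)) := by
  have hlam := L.isGrushin
  have hq0 : 0 < q := by linarith
  have hba : 0 < b - a := by linarith
  have hD₃ := doublingDim_pos C₃
  have hD₄ := doublingDim_pos C₄
  -- A quarter of the gap: balls of radius t centred in Q(z₀, ah) lie in S = Q(z₀, ah + t), where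
  -- the cutoff is 1, and T = Q(z₀, ah + 2t) has its closure inside Q(z₀, h).
  set t := (b - a) * h / 4 with ht
  have ht0 : 0 < t := by positivity
  have hbh : b * h = a * h + 4 * t := by rw [ht]; ring
  have hah : 0 < a * h := by positivity
  have hbh' : b * h ≤ h := by nlinarith
  have hht : h / t = 4 / (b - a) := by rw [ht]; field_simp
  set Q := rect L.lam z₀ h with hQ
  set U := weightMeasure L.u Q with hU
  set V := weightMeasure L.v Q with hV
  have hU0 : U ≠ 0 := (weightMeasure_rect_pos hn hlam L.weight_u hL.doubling_u z₀ hh).ne'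
  have hV0 : V ≠ 0 := (weightMeasure_rect_pos hn hlam L.weight_v hL.doubling_v z₀ hh).ne'
  have hUt : U ≠ ∞ := (L.weight_u.weightMeasure_rect_lt_top z₀ h).ne
  have hVt : V ≠ ∞ := (L.weight_v.weightMeasure_rect_lt_top z₀ h).ne
  set T := rect L.lam z₀ (a * h + 2 * t) with hT
  set S := rect L.lam z₀ (a * h + t) with hS
  obtain ⟨η, hη⟩ := exists_isCutoff (m := m) hn hlam z₀ (r := a * h + t) (s := a * h + 2 * t)
    (by positivity) (by linarith)
  have hc : ((n : ℝ) + m) / (a * h + 2 * t - (a * h + t)) ^ 2 = (n + m) / t ^ 2 := by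
    congr 2; ring
  rw [hc] at hη
  have hTb : T ⊆ rect L.lam z₀ (b * h) := rect_mono hlam z₀ (by positivity) (by linarith)
  have hTc : closure T ⊆ (rectOpen L.lam z₀ h).carrier :=
    closure_rect_subset hn hlam z₀ (by positivity) (by linarith)
  set I := ∫⁻ z in rect L.lam z₀ (b * h),
          ENNReal.ofReal (G (tilde L _ f z) ^ 2) ∂(weightMeasure L.u) with hI
  set M := muRatio L Q with hM
  have hM0 : 0 ≤ M := by rw [hM]; unfold muRatio; positivity
  set w : ℝ := (1200 / (b - a)) ^ (doublingDim C₃ + doublingDim C₄) with hw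
  have hw1 : 1 ≤ 1200 / (b - a) := by rw [one_le_div hba]; linarith
  have hball : ∀ p ∈ rect L.lam z₀ (a * h),
      ∫⁻ z in rhoBall L.lam p t, ENNReal.ofReal (G (tilde L _ f z) ^ q) ∂(weightMeasure L.u) ≤
      U * (ENNReal.ofReal (w ^ (1 / 2 : ℝ) * (stepConst n m C₅ * (1 + K * M)))
        * (U⁻¹ * I) ^ (1 / 2 : ℝ)) ^ q := by
    intro p hp
    have hpQ : p ∈ Q := rect_mono hlam z₀ hah (by linarith) hp
    have hBS : rhoBall L.lam p t ⊆ S :=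
      (rhoBall_subset_rect hn hlam p ht0).trans (rect_subset_rect_add hlam hah ht0 hp)
    have hBQ : rhoBall L.lam p t ⊆ Q :=
      hBS.trans (rect_mono hlam z₀ (by positivity) (by linarith))
    have hle : ∀ D, 0 ≤ D → D ≤ doublingDim C₃ + doublingDim C₄ →
        (20 * (h / t)) ^ D ≤ w := fun D hD hD' => by
      rw [hht, hw]
      refine (Real.rpow_le_rpow (by positivity) ?_ hD).trans (Real.rpow_le_rpow_of_exponent_le
        hw1 hD')
      rw [← mul_div_assoc]
      exact div_le_div_of_nonneg_right (by norm_num) hba.le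
    have hu : U ≤ ENNReal.ofReal w * weightMeasure L.u (rhoBall L.lam p t) :=
      (weightMeasure_rect_le hn hlam hL.doubling_u hh ht0 (by linarith) hpQ).trans
        (mul_le_mul_left (ENNReal.ofReal_le_ofReal (hle _ hD₃.le (by linarith))) _)
    have hv : V ≤ ENNReal.ofReal w * weightMeasure L.v (rhoBall L.lam p t) :=
      (weightMeasure_rect_le hn hlam hL.doubling_v hh ht0 (by linarith) hpQ).trans
        (mul_le_mul_left (ENNReal.ofReal_le_ofReal (hle _ hD₄.le (by linarith))) _)
    have hu0 : weightMeasure L.u (rhoBall L.lam p t) ≠ 0 := fun h0 => by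
      rw [h0, mul_zero] at hu; exact hU0 (le_antisymm hu zero_le)
    have hv0 : weightMeasure L.v (rhoBall L.lam p t) ≠ 0 := fun h0 => by
      rw [h0, mul_zero] at hv; exact hV0 (le_antisymm hv zero_le)
    have huU : weightMeasure L.u (rhoBall L.lam p t) ≤ U := measure_mono hBQ
    have hvV : weightMeasure L.v (rhoBall L.lam p t) ≤ V := measure_mono hBQ
    refine (local_estimate hq hL.sobolev hG (measurableSet_rect _ _) (measurableSet_rect _ _)
      (rect_mono hlam z₀ (by positivity) (by linarith)) hTc hη hf hsol p ht0 hBS hu0 hv0).trans ?_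
    refine mul_le_mul' huU (ENNReal.rpow_le_rpow ?_ hq0.le)
    have hIT : ∫⁻ z in T, ENNReal.ofReal (G (tilde L _ f z) ^ 2) ∂(weightMeasure L.u) ≤ I :=
      lintegral_mono_set hTb
    refine le_trans (add_le_add (mul_le_mul_right (ENNReal.rpow_le_rpow (mul_le_mul_right
      (mul_le_mul_right hIT _) _) (by norm_num)) _) (ENNReal.rpow_le_rpow (mul_le_mul_right
      hIT _) (by norm_num))) ?_
    refine (bracket_le hU0 hUt hV0 hVt (ne_top_of_le_ne_top hUt huU)
      (ne_top_of_le_ne_top hVt hvV) hu hv (by positivity) hG.K_nonneg (by positivity)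
      (by positivity) (M := M) rfl).trans ?_
    refine mul_le_mul_left (ENNReal.ofReal_le_ofReal (mul_le_mul_of_nonneg_left ?_
      (by positivity))) _
    -- The radius in Sobolev–Poincaré cancels the slope 1/t of the cutoff, so the constant is scale
    -- invariant.
    have e : 2 * (C₅ * t) * Real.sqrt ((n + m) / t ^ 2) = 2 * C₅ * Real.sqrt (n + m) := by
      rw [Real.sqrt_div (by positivity), Real.sqrt_sq ht0.le]
      field_simp
    rw [e, stepConst]
    have h1 : 0 ≤ 2 * C₅ * Real.sqrt (n + m) := by positivity
    have h2 : 0 ≤ K * M := mul_nonneg hG.K_nonneg hM0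
    nlinarith
  -- Size t/15, because the tripled rectangles of size t/5 lie in balls of radius 5 · t/5 = t.
  obtain ⟨P, hP, hcard, hcov⟩ := exists_finset_rect_cover hn hlam L.weight_u hL.doubling_u z₀
    (r := a * h) (s := t / 15) (h := h) hah (by positivity) (by linarith)
  set Y := U * (ENNReal.ofReal (w ^ (1 / 2 : ℝ) * (stepConst n m C₅ * (1 + K * M)))
        * (U⁻¹ * I) ^ (1 / 2 : ℝ)) ^ q with hY
  have hsum : ∫⁻ z in rect L.lam z₀ (a * h),
      ENNReal.ofReal (G (tilde L _ f z) ^ q) ∂(weightMeasure L.u) ≤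
      ENNReal.ofReal ((1200 / (b - a)) ^ doublingDim C₃) * Y := by
    have hcov' : rect L.lam z₀ (a * h) ⊆ ⋃ p : P, rhoBall L.lam (p : Space n m) t := by
      refine hcov.trans (iUnion₂_subset fun p hp => ?_)
      refine subset_trans ?_ (subset_iUnion (fun p : P => rhoBall L.lam (p : Space n m) t) ⟨p, hp⟩)
      have := rect_subset_rhoBall hn hlam p (r := 3 * (t / 15)) (by positivity)
      rwa [show 5 * (3 * (t / 15)) = t by ring] at this
    refine (lintegral_mono_set hcov').trans ((lintegral_iUnion_le _ _).trans ?_)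
    rw [tsum_fintype]
    refine (Finset.sum_le_card_nsmul _ _ Y fun p _ => hball _ (hP _ p.property)).trans ?_
    rw [nsmul_eq_mul]
    refine mul_le_mul_left ?_ _
    simp only [Finset.card_univ, Fintype.card_coe]
    refine hcard.trans_eq ?_
    -- The constant is 1200 = 20 · 15 · 4, the last factor coming from h/t = 4/(b - a).
    rw [show 20 * (h / (t / 15)) = 300 * (h / t) by field_simp; norm_num, hht]
    congr 2
    ring
  have hR0 : 0 ≤ w ^ (1 / 2 : ℝ) * (stepConst n m C₅ * (1 + K * M)) := by
    have := one_le_stepConst (n := n) (m := m) hC₅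
    have := mul_nonneg hG.K_nonneg hM0
    positivity
  have h2q : 0 ≤ 2 / q := by positivity
  calc (U⁻¹ * ∫⁻ z in rect L.lam z₀ (a * h),
        ENNReal.ofReal (G (tilde L _ f z) ^ q) ∂(weightMeasure L.u)) ^ (2 / q)
      ≤ (U⁻¹ * (ENNReal.ofReal ((1200 / (b - a)) ^ doublingDim C₃) * Y)) ^ (2 / q) :=
        ENNReal.rpow_le_rpow (mul_le_mul_right hsum _) h2q
    _ = (ENNReal.ofReal ((1200 / (b - a)) ^ doublingDim C₃) *
          (ENNReal.ofReal (w ^ (1 / 2 : ℝ) * (stepConst n m C₅ * (1 + K * M)))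
            * (U⁻¹ * I) ^ (1 / 2 : ℝ)) ^ q) ^ (2 / q) := by
        congr 1
        rw [hY, mul_left_comm, ← mul_assoc U⁻¹ U, ENNReal.inv_mul_cancel hU0 hUt, one_mul]
    _ = _ := by
        rw [ENNReal.mul_rpow_of_nonneg _ _ h2q, ← ENNReal.rpow_mul, mul_div_cancel₀ _ hq0.ne',
          ENNReal.rpow_two, mul_pow, ← ENNReal.rpow_two (_ ^ (1 / 2 : ℝ)), ← ENNReal.rpow_mul,
          show (1 / 2 : ℝ) * 2 = 1 by norm_num, ENNReal.rpow_one, ← mul_assoc,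
          ENNReal.ofReal_rpow_of_nonneg (by positivity) h2q, ← ENNReal.ofReal_pow hR0,
          ← ENNReal.ofReal_mul (by positivity)]
        congr 2
        have hx : (0 : ℝ) < 1200 / (b - a) := by positivity
        have e : ((1200 / (b - a)) ^ doublingDim C₃) ^ (2 / q) * (w ^ (1 / 2 : ℝ)) ^ 2
            = ((1200 / (b - a)) ^ stepDim C₃ C₄ q) ^ 2 := by
          rw [hw, stepDim, ← Real.rpow_natCast _ 2, ← Real.rpow_natCast _ 2, ← Real.rpow_mul hx.le,
            ← Real.rpow_mul hx.le, ← Real.rpow_mul hx.le, ← Real.rpow_mul hx.le,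
            ← Real.rpow_add hx]
          congr 1
          push_cast
          ring
        rw [mul_pow, ← mul_assoc, e]
        ring

end StepConstants

end Grushin

namespace Grushin

/-! ### Powers as test functions -/

section Powers

/-- The function equal to `f` up to `M` and to its tangent at `M` afterwards. -/
noncomputable def tangentExt (f f' : ℝ → ℝ) (M t : ℝ) : ℝ :=
  if t ≤ M then f t else f M + f' M * (t - M)

theorem tangentExt_of_le {f f' : ℝ → ℝ} {M t : ℝ} (h : t ≤ M) : tangentExt f f' M t = f t :=
  if_pos h

theorem tangentExt_of_ge {f f' : ℝ → ℝ} {M t : ℝ} (h : M ≤ t) :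
    tangentExt f f' M t = f M + f' M * (t - M) := by
  rcases h.eq_or_lt with rfl | h
  · simp [tangentExt]
  · exact if_neg h.not_ge

theorem hasDerivAt_tangentExt {f f' : ℝ → ℝ} {M t : ℝ} (hM : 0 < M)
    (hf : ∀ t, 0 < t → HasDerivAt f (f' t) t) (ht : 0 < t) :
    HasDerivAt (tangentExt f f' M) (f' (min t M)) t := by
  have hlin : ∀ s, HasDerivAt (fun t => f M + f' M * (t - M)) (f' M) s := fun s => by
    simpa using (((hasDerivAt_id s).sub_const M).const_mul (f' M)).const_add (f M)
  rcases lt_trichotomy t M with h | h | h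
  · rw [min_eq_left h.le]
    refine (hf t ht).congr_of_eventuallyEq ?_
    filter_upwards [Iio_mem_nhds h] with s hs using tangentExt_of_le (le_of_lt hs)
  · subst h
    rw [min_self, ← hasDerivWithinAt_univ, ← Iic_union_Ici (a := t)]
    refine HasDerivWithinAt.union ?_ ?_
    · exact (hf t ht).hasDerivWithinAt.congr (fun s hs => tangentExt_of_le hs)
        (tangentExt_of_le le_rfl)
    · exact (hlin t).hasDerivWithinAt.congr (fun s hs => tangentExt_of_ge hs)
        (tangentExt_of_ge le_rfl)
  · rw [min_eq_right h.le]
    refine (hlin t).congr_of_eventuallyEq ?_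
    filter_upwards [Ioi_mem_nhds h] with s hs using tangentExt_of_ge (le_of_lt hs)

theorem hasDerivAt_rpow_shift {f f' : ℝ → ℝ} {ε : ℝ}
    (hf : ∀ t, 0 < t → HasDerivAt f (f' t) t) (hε : 0 < ε) {t : ℝ} (ht : 0 ≤ t) :
    HasDerivAt (fun t => f (t + ε)) (f' (t + ε)) t := by
  simpa using (hf (t + ε) (by linarith)).comp_add_const t ε

theorem hasDerivAt_rpow_of_pos (s : ℝ) {t : ℝ} (ht : 0 < t) :
    HasDerivAt (fun t : ℝ => t ^ s) (s * t ^ (s - 1)) t :=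
  Real.hasDerivAt_rpow_const (Or.inl ht.ne')

/-- The square of the derivative of t^(p/2) is a multiple of t^(p-2); its primitive is a power
except for p = 1, the exponent to be avoided throughout. -/
theorem hasDerivAt_primitive_rpow {p : ℝ} (hp : p ≠ 1) {t : ℝ} (ht : 0 < t) :
    HasDerivAt (fun t : ℝ => p ^ 2 / (4 * (p - 1)) * t ^ (p - 1))
      ((p / 2 * t ^ (p / 2 - 1)) ^ 2) t := by
  have h1 : p - 1 ≠ 0 := sub_ne_zero.2 hp
  convert! (hasDerivAt_rpow_of_pos (p - 1) ht).const_mul (p ^ 2 / (4 * (p - 1))) using 1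
  rw [mul_pow, ← Real.rpow_natCast (t ^ _), ← Real.rpow_mul ht.le]
  rw [show (p / 2 - 1) * ((2 : ℕ) : ℝ) = p - 1 - 1 by push_cast; ring]
  field_simp
  norm_num

/-- The test functions for the exponents `p ≤ 2`. -/
theorem isTestPair_rpow {p ε : ℝ} (hp : p ≠ 1) (hp2 : p ≤ 2) (hε : 0 < ε) :
    IsTestPair (|p| / (2 * |p - 1|)) (|p| / 2 * ε ^ (p / 2 - 1)) (fun t => (t + ε) ^ (p / 2))
      (fun t => p / 2 * (t + ε) ^ (p / 2 - 1))
      (fun t => p ^ 2 / (4 * (p - 1)) * (t + ε) ^ (p - 1)) where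
  K_nonneg := by positivity
  hasDerivAt t ht := hasDerivAt_rpow_shift (f := fun t => t ^ (p / 2))
    (f' := fun t => p / 2 * t ^ (p / 2 - 1)) (fun t ht => hasDerivAt_rpow_of_pos _ ht) hε ht
  hasDerivAt_primitive t ht := hasDerivAt_rpow_shift
    (f := fun t => p ^ 2 / (4 * (p - 1)) * t ^ (p - 1))
    (f' := fun t => (p / 2 * t ^ (p / 2 - 1)) ^ 2)
    (fun t ht => hasDerivAt_primitive_rpow hp ht) hε ht
  abs_le t ht := by
    have hτ : 0 < t + ε := by linarith
    have h1 : 0 < |p - 1| := abs_pos.2 (sub_ne_zero.2 hp)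
    rw [abs_mul, abs_mul, abs_div, abs_mul, abs_pow, abs_of_pos (Real.rpow_pos_of_pos hτ _),
      abs_of_pos (Real.rpow_pos_of_pos hτ _), mul_assoc, ← Real.rpow_add hτ,
      show p / 2 - 1 + p / 2 = p - 1 by ring, abs_div, ← mul_assoc]
    -- Both sides are the same multiple of (t + ε)^(p-1), so K is exact here.
    refine le_of_eq ?_
    congr 1
    norm_num
    field_simp
    norm_num
    ring
  nonneg t ht := Real.rpow_nonneg (by linarith) _
  bound t ht := by
    have hτ : 0 < t + ε := by linarith
    rw [abs_mul, abs_of_pos (Real.rpow_pos_of_pos hτ _), abs_div, abs_two]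
    -- The exponent p/2 - 1 is non-positive, so the derivative is largest in absolute value at t =
    -- 0; the shift by ε keeps it finite.
    exact mul_le_mul_of_nonneg_left (Real.rpow_le_rpow_of_nonpos hε (by linarith) (by linarith))
      (by positivity)

/-- The test functions for the exponents `p > 2`, with linear growth. -/
theorem isTestPair_tangentExt {p ε M : ℝ} (hp2 : 2 < p) (hε : 0 < ε) (hM : 0 < M) :
    IsTestPair p (p / 2 * M ^ (p / 2 - 1))
      (fun t => tangentExt (fun t => t ^ (p / 2)) (fun t => p / 2 * t ^ (p / 2 - 1)) M (t + ε))
      (fun t => p / 2 * (min (t + ε) M) ^ (p / 2 - 1))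
      (fun t => tangentExt (fun t => p ^ 2 / (4 * (p - 1)) * t ^ (p - 1))
        (fun t => (p / 2 * t ^ (p / 2 - 1)) ^ 2) M (t + ε)) where
  K_nonneg := by linarith
  hasDerivAt t ht := by
    have := hasDerivAt_rpow_shift (f' := fun t => p / 2 * (min t M) ^ (p / 2 - 1))
      (fun t ht => hasDerivAt_tangentExt hM (f := fun t => t ^ (p / 2))
        (f' := fun t => p / 2 * t ^ (p / 2 - 1))
        (fun t ht => hasDerivAt_rpow_of_pos _ ht) ht) hε ht
    exact this
  hasDerivAt_primitive t ht := by
    have := hasDerivAt_rpow_shift (f' := fun t => (p / 2 * (min t M) ^ (p / 2 - 1)) ^ 2)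
      (fun t ht => hasDerivAt_tangentExt hM (f := fun t => p ^ 2 / (4 * (p - 1)) * t ^ (p - 1))
        (f' := fun t => (p / 2 * t ^ (p / 2 - 1)) ^ 2)
        (fun t ht => hasDerivAt_primitive_rpow (by linarith) ht) ht) hε ht
    exact this
  abs_le t ht := by
    have hτ : 0 < t + ε := by linarith
    have hp1 : 0 < p - 1 := by linarith
    -- Since p > 2 the coefficient of the primitive causes no harm. Beyond M the added slope term
    -- only needs p ≥ 1, so K = p works in both ranges.
    have hc : p ^ 2 / (4 * (p - 1)) ≤ p * (p / 2) := by
      rw [div_le_iff₀ (by linarith)]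
      nlinarith [sq_nonneg p]
    rcases le_total (t + ε) M with h | h
    · rw [tangentExt_of_le h, tangentExt_of_le h, min_eq_left h, abs_of_nonneg (by positivity),
        abs_of_nonneg (by positivity), mul_assoc (p / 2), ← Real.rpow_add hτ,
        show p / 2 - 1 + p / 2 = p - 1 by ring, ← mul_assoc]
      exact mul_le_mul_of_nonneg_right hc (Real.rpow_nonneg hτ.le _)
    · have hd : 0 ≤ t + ε - M := by linarith
      rw [tangentExt_of_ge h, tangentExt_of_ge h, min_eq_right h, abs_of_nonneg (by positivity),
        abs_of_nonneg (by positivity)]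
      have e1 : M ^ (p / 2 - 1) * M ^ (p / 2) = M ^ (p - 1) := by
        rw [← Real.rpow_add hM]; congr 1; ring
      have h1 : 0 ≤ M ^ (p - 1) := by positivity
      have h2 : 0 ≤ (p / 2 * M ^ (p / 2 - 1)) ^ 2 * (t + ε - M) := by positivity
      have h3 := mul_le_mul_of_nonneg_right hc h1
      calc p ^ 2 / (4 * (p - 1)) * M ^ (p - 1) + (p / 2 * M ^ (p / 2 - 1)) ^ 2 * (t + ε - M)
          ≤ p * (p / 2) * M ^ (p - 1) + p * ((p / 2 * M ^ (p / 2 - 1)) ^ 2 * (t + ε - M)) := by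
            nlinarith
        _ = _ := by rw [← e1]; ring
  nonneg t ht := by
    have hτ : 0 < t + ε := by linarith
    rcases le_total (t + ε) M with h | h
    · rw [tangentExt_of_le h]; positivity
    · have hd : 0 ≤ t + ε - M := by linarith
      rw [tangentExt_of_ge h]; positivity
  bound t ht := by
    have hτ : 0 < t + ε := by linarith
    have hmin : 0 < min (t + ε) M := lt_min hτ hM
    rw [abs_of_nonneg (by positivity)]
    exact mul_le_mul_of_nonneg_left (Real.rpow_le_rpow hmin.le (min_le_right _ _) (by linarith))
      (by linarith)

/-- A convex power lies above its tangents; this is Bernoulli's inequality at t/M. -/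
theorem tangentExt_rpow_le {s M t : ℝ} (hs : 1 ≤ s) (hM : 0 < M) (ht : 0 < t) :
    tangentExt (fun t => t ^ s) (fun t => s * t ^ (s - 1)) M t ≤ t ^ s := by
  rcases le_total t M with h | h
  · rw [tangentExt_of_le h]
  · rw [tangentExt_of_ge h]
    have h1 := one_add_mul_self_le_rpow_one_add (s := t / M - 1) (p := s)
      (by have : 0 < t / M := by positivity
          linarith) hs
    rw [add_sub_cancel, Real.div_rpow ht.le hM.le, le_div_iff₀ (by positivity)] at h1
    refine le_trans (le_of_eq ?_) h1
    rw [Real.rpow_sub_one hM.ne']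
    field_simp

theorem measurable_tangentExt_rpow (s M : ℝ) :
    Measurable (tangentExt (fun t => t ^ s) (fun t => s * t ^ (s - 1)) M) := by
  unfold tangentExt
  refine Measurable.ite measurableSet_Iic (by fun_prop) (by fun_prop)

variable {n m : ℕ} {L : DegenerateOperator n m}

theorem ENNReal.inv_mul_rpow_le_iff {U X R : ℝ≥0∞} {s : ℝ} (hs : 0 < s) (h0 : U ≠ 0)
    (ht : U ≠ ∞) : (U⁻¹ * X) ^ (1 / s) ≤ R ↔ X ≤ U * R ^ s := by
  rw [one_div, ENNReal.rpow_inv_le_iff hs, mul_comm U⁻¹, ← div_eq_mul_inv,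
    ENNReal.div_le_iff h0 ht, mul_comm U]

/-- One step of the Moser iteration for the powers of `f̃ + ε`. -/
theorem reverse_holder_rpow {C₁ C₂ C₃ C₄ C₅ q : ℝ} (hn : 0 < n) (hC₅ : 0 ≤ C₅) (hq : 2 < q)
    (hL : Admissible C₁ C₂ C₃ C₄ C₅ q L) {z₀ : Space n m} {h : ℝ} (hh : 0 < h)
    {f : HSpace L (rectOpen L.lam z₀ h)} (hf : IsNonneg f) (hsol : IsWeakSolution f)
    {a b : ℝ} (ha : 0 < a) (hab : a < b) (hb : b ≤ 1) {p ε κ : ℝ} (hε : 0 < ε) (hκ : 1 ≤ κ)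
    (hp1 : p ≠ 1) (hpκ : 1 / (2 * |p - 1|) ≤ κ) :
    ((weightMeasure L.u (rect L.lam z₀ h))⁻¹ * ∫⁻ z in rect L.lam z₀ (a * h),
        ((tildeFun f z + ENNReal.ofReal ε) ^ p) ^ (q / 2) ∂(weightMeasure L.u)) ^ (1 / (q / 2)) ≤
      ENNReal.ofReal ((stepConst n m C₅ * (1200 / (b - a)) ^ stepDim C₃ C₄ q
          * (1 + κ * |p| * muRatio L (rect L.lam z₀ h))) ^ 2) *
        ((weightMeasure L.u (rect L.lam z₀ h))⁻¹ * ∫⁻ z in rect L.lam z₀ (b * h),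
          (tildeFun f z + ENNReal.ofReal ε) ^ p ∂(weightMeasure L.u)) := by
  have hlam := L.isGrushin
  have hq0 : 0 < q := by linarith
  set Q := rect L.lam z₀ h with hQ
  set U := weightMeasure L.u Q with hU
  have hU0 : U ≠ 0 := (weightMeasure_rect_pos hn hlam L.weight_u hL.doubling_u z₀ hh).ne'
  have hUt : U ≠ ∞ := (L.weight_u.weightMeasure_rect_lt_top z₀ h).ne
  have hM0 : 0 ≤ muRatio L Q := by unfold muRatio; positivity
  have hmono : ∀ c, 0 < c → c ≤ 1 → (weightMeasure L.u).restrict (rect L.lam z₀ (c * h)) ≤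
      (weightMeasure L.u).restrict (rectOpen L.lam z₀ h).carrier := fun c hc hc1 =>
    Measure.restrict_mono (rect_mono hlam z₀ (by positivity) (by nlinarith)) le_rfl
  have hpos : ∀ c, 0 < c → c ≤ 1 → ∀ᵐ z ∂((weightMeasure L.u).restrict (rect L.lam z₀ (c * h))),
      0 ≤ tilde L _ f z := fun c hc hc1 => ae_mono (hmono c hc hc1) hf.tilde_nonneg
  have hval : ∀ z, 0 ≤ tilde L _ f z →
      (tildeFun f z + ENNReal.ofReal ε) ^ p
        = ENNReal.ofReal (((tilde L _ f z + ε) ^ (p / 2)) ^ 2) := fun z hz => by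
    have : 0 < tilde L _ f z + ε := by linarith
    rw [tildeFun, ← ENNReal.ofReal_add hz hε.le, ENNReal.ofReal_rpow_of_pos this,
      ← Real.rpow_natCast, ← Real.rpow_mul this.le]
    congr 2
    push_cast
    ring
  have hval' : ∀ z, 0 ≤ tilde L _ f z →
      ((tildeFun f z + ENNReal.ofReal ε) ^ p) ^ (q / 2)
        = ENNReal.ofReal (((tilde L _ f z + ε) ^ (p / 2)) ^ q) := fun z hz => by
    have : 0 < tilde L _ f z + ε := by linarith
    rw [hval z hz, ENNReal.ofReal_rpow_of_nonneg (by positivity) (by positivity),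
      ← Real.rpow_natCast, ← Real.rpow_mul (by positivity)]
    congr 2
    push_cast
    ring
  have hfac : ∀ K, 0 ≤ K → K ≤ κ * |p| →
      ENNReal.ofReal ((stepConst n m C₅ * (1200 / (b - a)) ^ stepDim C₃ C₄ q
          * (1 + K * muRatio L Q)) ^ 2) ≤
      ENNReal.ofReal ((stepConst n m C₅ * (1200 / (b - a)) ^ stepDim C₃ C₄ q
          * (1 + κ * |p| * muRatio L Q)) ^ 2) := fun K hK0 hK => by
    have h1 := one_le_stepConst (n := n) (m := m) hC₅
    have h2 : 0 < b - a := by linarith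
    refine ENNReal.ofReal_le_ofReal (pow_le_pow_left₀ (by positivity)
      (mul_le_mul_of_nonneg_left ?_ (by positivity)) 2)
    have := mul_le_mul_of_nonneg_right hK hM0
    linarith
  rcases le_or_gt p 2 with hp2 | hp2
  · have hK : |p| / (2 * |p - 1|) ≤ κ * |p| := by
      have := mul_le_mul_of_nonneg_right hpκ (abs_nonneg p)
      rwa [div_mul_eq_mul_div, one_mul] at this
    have hstep := reverse_holder hn hC₅ hq hL hh hf hsol ha hab hb (isTestPair_rpow hp1 hp2 hε)
    rw [lintegral_congr_ae ((hpos b (by linarith) hb).mono fun z hz => hval z hz),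
      lintegral_congr_ae ((hpos a ha (by linarith)).mono fun z hz => hval' z hz), one_div_div]
    exact hstep.trans (mul_le_mul_left (hfac _ (by positivity) hK) _)
  · rw [ENNReal.inv_mul_rpow_le_iff (by positivity) hU0 hUt]
    set R := ENNReal.ofReal ((stepConst n m C₅ * (1200 / (b - a)) ^ stepDim C₃ C₄ q
          * (1 + κ * |p| * muRatio L Q)) ^ 2) * (U⁻¹ * ∫⁻ z in rect L.lam z₀ (b * h),
          (tildeFun f z + ENNReal.ofReal ε) ^ p ∂(weightMeasure L.u)) with hR
    -- For p > 2 the power itself has unbounded slope. The truncations are at most the power and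
    -- eventually equal to it at each point, so Fatou's lemma removes them; the bound does not
    -- depend on N.
    set G : ℕ → ℝ → ℝ := fun N t =>
      tangentExt (fun t => t ^ (p / 2)) (fun t => p / 2 * t ^ (p / 2 - 1)) (N + 1) (t + ε) with hG
    have hGstep : ∀ N, ∫⁻ z in rect L.lam z₀ (a * h),
        ENNReal.ofReal (G N (tilde L _ f z) ^ q) ∂(weightMeasure L.u) ≤ U * R ^ (q / 2) := by
      intro N
      have hstep := reverse_holder hn hC₅ hq hL hh hf hsol ha hab hb
        (isTestPair_tangentExt (M := N + 1) hp2 hε (by positivity))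
      rw [← one_div_div q 2, ENNReal.inv_mul_rpow_le_iff (by positivity) hU0 hUt] at hstep
      refine hstep.trans (mul_le_mul_right (ENNReal.rpow_le_rpow (mul_le_mul'
        (hfac _ (by linarith) ?_) (mul_le_mul_right ?_ _)) (by positivity)) _)
      · rw [abs_of_pos (by linarith)]
        nlinarith
      · refine lintegral_mono_ae ?_
        filter_upwards [hpos b (by linarith) hb] with z hz
        rw [hval z hz]
        refine ENNReal.ofReal_le_ofReal (pow_le_pow_left₀ ?_ (tangentExt_rpow_le (by linarith)
          (by positivity) (by linarith)) 2)
        exact (isTestPair_tangentExt (M := N + 1) hp2 hε (by positivity)).nonneg _ hz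
    have hm : AEMeasurable (fun z => tilde L _ f z)
        ((weightMeasure L.u).restrict (rect L.lam z₀ (a * h))) :=
      (Lp.aestronglyMeasurable (tilde L _ f)).aemeasurable.mono_measure (hmono a ha (by linarith))
    calc ∫⁻ z in rect L.lam z₀ (a * h),
        ((tildeFun f z + ENNReal.ofReal ε) ^ p) ^ (q / 2) ∂(weightMeasure L.u)
        = ∫⁻ z in rect L.lam z₀ (a * h), liminf (fun N =>
            ENNReal.ofReal (G N (tilde L _ f z) ^ q)) atTop ∂(weightMeasure L.u) := by
          refine lintegral_congr_ae ?_
          filter_upwards [hpos a ha (by linarith)] with z hz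
          rw [hval' z hz]
          refine (Tendsto.liminf_eq (tendsto_const_nhds.congr' ?_)).symm
          obtain ⟨N₀, hN₀⟩ := exists_nat_ge (tilde L _ f z + ε)
          filter_upwards [eventually_ge_atTop N₀] with N hN
          have hN' : (N₀ : ℝ) ≤ N := by exact_mod_cast hN
          rw [hG]
          simp only
          rw [tangentExt_of_le (by linarith)]
      _ ≤ liminf (fun N => ∫⁻ z in rect L.lam z₀ (a * h),
            ENNReal.ofReal (G N (tilde L _ f z) ^ q) ∂(weightMeasure L.u)) atTop :=
          lintegral_liminf_le' fun N => ((((measurable_tangentExt_rpow (p / 2) (N + 1)).comp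
            (measurable_id.add_const ε)).comp_aemeasurable hm).pow_const q).ennreal_ofReal
      _ ≤ _ := liminf_le_of_le (by isBoundedDefault) fun x hx => by
          obtain ⟨N, hN⟩ := hx.exists
          exact hN.trans (hGstep N)

end Powers

end Grushin

namespace Grushin

/-! ### Abstract iteration and absorption -/

section Iteration

variable {α : Type*} [MeasurableSpace α] {μ : Measure α}

theorem ENNReal.rpow_le_rpow_of_neg {x y : ℝ≥0∞} {p : ℝ} (hp : p < 0) (h : x ≤ y) :
    y ^ p ≤ x ^ p := by
  rw [← neg_neg p, ENNReal.rpow_neg, ENNReal.rpow_neg x]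
  exact ENNReal.inv_le_inv.2 (ENNReal.rpow_le_rpow h (by linarith))

/-- If the `L^s` means of `W` are bounded by `c` along a sequence of exponents tending to infinity,
then `W ≤ c` almost everywhere. -/
theorem ae_le_of_lintegral_rpow_le {W : α → ℝ≥0∞} (hW : AEMeasurable W μ) {U c : ℝ≥0∞}
    (hU : U ≠ ∞) {s : ℕ → ℝ} (hs : Tendsto s atTop atTop) (hs0 : ∀ j, 0 < s j)
    (h : ∀ j, ∫⁻ z, W z ^ s j ∂μ ≤ U * c ^ s j) : ∀ᵐ z ∂μ, W z ≤ c := by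
  -- Chebyshev's inequality bounds the measure of {W ≥ d} by U(c/d)^(s_j), which tends to 0.
  have key : ∀ d : ℝ≥0∞, c < d → d ≠ ∞ → μ {z | d ≤ W z} = 0 := by
    intro d hd hd'
    have hd0 : d ≠ 0 := (zero_le.trans_lt hd).ne'
    have h1 : ∀ j, μ {z | d ≤ W z} ≤ U * (c / d) ^ s j := by
      intro j
      have h2 : d ^ s j * μ {z | d ^ s j ≤ W z ^ s j} ≤ U * c ^ s j :=
        (mul_meas_ge_le_lintegral₀ (hW.pow_const _) _).trans (h j)
      have h3 : {z | d ^ s j ≤ W z ^ s j} = {z | d ≤ W z} := by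
        ext z
        exact ENNReal.rpow_le_rpow_iff (hs0 j)
      have h4 : d ^ s j ≠ 0 := (ENNReal.rpow_pos (pos_iff_ne_zero.2 hd0) hd').ne'
      have h5 : d ^ s j ≠ ∞ := ENNReal.rpow_ne_top_of_nonneg (hs0 j).le hd'
      rw [h3, mul_comm, ← ENNReal.le_div_iff_mul_le (Or.inl h4) (Or.inl h5)] at h2
      rwa [ENNReal.div_rpow_of_nonneg _ _ (hs0 j).le, ← mul_div_assoc]
    have h6 : Tendsto (fun j => U * (c / d) ^ s j) atTop (𝓝 0) := by
      have hlt : c / d < 1 := ENNReal.div_lt_of_lt_mul (by rwa [one_mul])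
      simpa using ENNReal.Tendsto.const_mul
        ((ENNReal.tendsto_rpow_atTop_of_base_lt_one hlt).comp hs) (Or.inr hU)
    exact le_antisymm (ge_of_tendsto' h6 h1) zero_le
  have hle : essSup W μ ≤ c := by
    refine le_of_forall_gt fun b hb => ?_
    obtain ⟨d, hcd, hdb⟩ := exists_between hb
    have : ∀ᵐ z ∂μ, W z ≤ d := by
      have := key d hcd hdb.ne_top
      rw [measure_eq_zero_iff_ae_notMem] at this
      filter_upwards [this] with z hz
      exact (not_le.1 hz).le
    exact (essSup_le_of_ae_le d this).trans_lt hdb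
  filter_upwards [ENNReal.ae_le_essSup W] with z hz using hz.trans hle

theorem sum_inv_pow_le {k : ℝ} (hk : 1 < k) (J : ℕ) :
    ∑ i ∈ Finset.range J, (1 / k) ^ i ≤ k / (k - 1) := by
  have h1 : 0 ≤ 1 / k := by positivity
  have h2 : 1 / k < 1 := (div_lt_one (by linarith)).2 hk
  have h3 := (summable_geometric_of_lt_one h1 h2).sum_le_tsum (Finset.range J)
    fun i _ => pow_nonneg h1 i
  rw [tsum_geometric_of_lt_one h1 h2] at h3
  refine h3.trans_eq ?_
  have : k - 1 ≠ 0 := by linarith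
  field_simp

theorem sum_mul_inv_pow_le {k : ℝ} (hk : 1 < k) (J : ℕ) :
    ∑ i ∈ Finset.range J, (i : ℝ) * (1 / k) ^ i ≤ ∑' i : ℕ, (i : ℝ) * (1 / k) ^ i := by
  have h1 : 0 ≤ 1 / k := by positivity
  have h2 : 1 / k < 1 := (div_lt_one (by linarith)).2 hk
  have hs : Summable fun i : ℕ => (i : ℝ) * (1 / k) ^ i := by
    simpa using summable_pow_mul_geometric_of_norm_lt_one (R := ℝ) 1 (r := 1 / k)
      (by rwa [Real.norm_of_nonneg h1])
  exact hs.sum_le_tsum (Finset.range J) fun i _ => by positivity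

/-- The Moser iteration. -/
theorem moser_iteration {W : α → ℝ≥0∞} {S : ℝ → Set α} {U : ℝ≥0∞} {k Z τ a b : ℝ}
    (hk : 1 < k) (hZ : 1 ≤ Z) (hτ : 1 ≤ τ) (hU0 : U ≠ 0) (hU : U ≠ ∞)
    (hS : ∀ c, a ≤ c → S a ⊆ S c) (hW : AEMeasurable W (μ.restrict (S a))) (hab : a < b)
    (h : ∀ (j : ℕ) (c d : ℝ), a ≤ c → c < d → d ≤ b → d - c = (b - a) / 2 ^ (j + 1) →
      (U⁻¹ * ∫⁻ z in S c, (W z ^ (k ^ j)) ^ k ∂μ) ^ (1 / k) ≤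
        ENNReal.ofReal (Z * τ ^ j) * (U⁻¹ * ∫⁻ z in S d, W z ^ (k ^ j) ∂μ)) :
    ∀ᵐ z ∂(μ.restrict (S a)), W z ≤
      ENNReal.ofReal (Z ^ (k / (k - 1)) * τ ^ ∑' i : ℕ, (i : ℝ) * (1 / k) ^ i) *
        (U⁻¹ * ∫⁻ z in S b, W z ∂μ) := by
  have hk0 : 0 < k := by linarith
  -- The radii decrease from b towards a, with the gap halved at each step.
  set A : ℕ → ℝ := fun j => a + (b - a) / 2 ^ j with hA
  have hA0 : A 0 = b := by simp [hA]
  have hAa : ∀ j, a ≤ A j := fun j => by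
    simp only [hA]
    have : 0 ≤ (b - a) / 2 ^ j := div_nonneg (by linarith) (by positivity)
    linarith
  have hAstep : ∀ j, A j - A (j + 1) = (b - a) / 2 ^ (j + 1) := fun j => by
    simp only [hA, pow_succ]
    field_simp
    ring
  have hAlt : ∀ j, A (j + 1) < A j := fun j => by
    have h1 := hAstep j
    have : 0 < (b - a) / 2 ^ (j + 1) := div_pos (by linarith) (by positivity)
    linarith
  have hAb : ∀ j, A j ≤ b := fun j => by
    rw [← hA0]
    exact (antitone_nat_of_succ_le fun j => (hAlt j).le) (Nat.zero_le j)
  set N : ℕ → ℝ≥0∞ := fun j => U⁻¹ * ∫⁻ z in S (A j), W z ^ (k ^ j) ∂μ with hN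
  have hstep : ∀ j, N (j + 1) ^ (1 / k) ≤ ENNReal.ofReal (Z * τ ^ j) * N j := fun j => by
    have := h j (A (j + 1)) (A j) (hAa _) (hAlt j) (hAb j) (hAstep j)
    simp only [← ENNReal.rpow_mul, ← pow_succ] at this
    exact this
  -- The constant of step i is raised to the power k^(-(i+1)) by the roots taken up to then, apart
  -- from the root already contained in that step: Z and τ^i thus acquire the exponents k^(-i) and i
  -- k^(-i), both summable.
  have hiter : ∀ J, N J ^ ((1 / k) ^ J) ≤ ENNReal.ofReal (Z ^ (∑ i ∈ Finset.range J, (1 / k) ^ i)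
      * τ ^ (∑ i ∈ Finset.range J, (i : ℝ) * (1 / k) ^ i)) * N 0 := by
    intro J
    induction J with
    | zero => simp
    | succ J ih =>
      have hkJ : 0 ≤ (1 / k) ^ J := by positivity
      have h1 := ENNReal.rpow_le_rpow (hstep J) hkJ
      rw [← ENNReal.rpow_mul, ← pow_succ', ENNReal.mul_rpow_of_nonneg _ _ hkJ,
        ENNReal.ofReal_rpow_of_nonneg (by positivity) hkJ] at h1
      refine h1.trans ((mul_le_mul_right ih _).trans_eq ?_)
      rw [← mul_assoc, ← ENNReal.ofReal_mul (by positivity)]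
      congr 2
      rw [Finset.sum_range_succ, Finset.sum_range_succ, Real.rpow_add (by linarith),
        Real.rpow_add (by linarith), Real.mul_rpow (by linarith) (by positivity),
        Real.rpow_mul (by linarith : 0 ≤ τ) J, Real.rpow_natCast]
      ring
  set c := ENNReal.ofReal (Z ^ (k / (k - 1)) * τ ^ ∑' i : ℕ, (i : ℝ) * (1 / k) ^ i) * N 0 with hc
  have hfin : ∀ J, N J ^ ((1 / k) ^ J) ≤ c := fun J => by
    refine (hiter J).trans (mul_le_mul_left (ENNReal.ofReal_le_ofReal (mul_le_mul
      (Real.rpow_le_rpow_of_exponent_le hZ (sum_inv_pow_le hk J))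
      (Real.rpow_le_rpow_of_exponent_le hτ (sum_mul_inv_pow_le hk J))
      (by positivity) (by positivity))) _)
  have hmain := ae_le_of_lintegral_rpow_le (U := U) (c := c) hW hU
    (tendsto_pow_atTop_atTop_of_one_lt hk) (fun j => by positivity) fun j => by
      have h1 := hfin j
      rw [one_div, inv_pow, ENNReal.rpow_inv_le_iff (by positivity)] at h1
      have h2 : ∫⁻ z in S a, W z ^ (k ^ j) ∂μ ≤ U * N j := by
        rw [hN]
        simp only
        rw [← mul_assoc, ENNReal.mul_inv_cancel hU0 hU, one_mul]
        exact lintegral_mono_set (hS _ (hAa j))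
      exact h2.trans (mul_le_mul_right h1 _)
  filter_upwards [hmain] with z hz
  refine hz.trans_eq ?_
  rw [hc, hN]
  simp only [pow_zero, ENNReal.rpow_one, hA0]

/-- Absorption: the term with the factor `θ < 1` can be removed from the right-hand side. -/
theorem le_of_forall_le_add_mul {T : ℝ → ℝ} {a b Y δ θ : ℝ} (hab : a < b) (hδ : 0 < δ)
    (hθ : 0 < θ) (hθ1 : θ < 1) (hT0 : ∀ c, a ≤ c → c ≤ b → 0 ≤ T c)
    (hT : ∀ c, a ≤ c → c ≤ b → T c ≤ T b)
    (h : ∀ c d, a ≤ c → c < d → d ≤ b → T c ≤ Y / (d - c) ^ δ + θ * T d) :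
    T a ≤ 1 / ((1 - θ ^ (1 / (2 * δ))) ^ δ * (1 - θ ^ (1 / 2 : ℝ))) * (Y / (b - a) ^ δ) := by
  -- Chosen so that θ = θ^(1/2) t^δ: the part t^δ is spent when the distance to b shrinks by the
  -- factor t, and θ^(1/2) < 1 is left for absorption.
  set t := θ ^ (1 / (2 * δ)) with ht
  have ht0 : 0 < t := by positivity
  have ht1 : t < 1 := Real.rpow_lt_one hθ.le hθ1 (by positivity)
  have hθ2 : θ ^ (1 / 2 : ℝ) < 1 := Real.rpow_lt_one hθ.le hθ1 (by norm_num)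
  have htδ : θ = θ ^ (1 / 2 : ℝ) * t ^ δ := by
    rw [ht, ← Real.rpow_mul hθ.le, ← Real.rpow_add hθ]
    conv_lhs => rw [← Real.rpow_one θ]
    congr 1
    field_simp
    norm_num
  -- The weight offsets the blow-up of Y/(d - c)^δ. The supremum m of V is finite since T ≤ T(b), so
  -- m ≤ Y/(1 - t)^δ + θ^(1/2) m can be solved for m.
  set V : ℝ → ℝ := fun c => (b - c) ^ δ * T c with hV
  have hne : (V '' Ico a b).Nonempty := ⟨V a, a, ⟨le_rfl, hab⟩, rfl⟩
  have hbdd : BddAbove (V '' Ico a b) := by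
    refine ⟨(b - a) ^ δ * T b, ?_⟩
    rintro _ ⟨c, hc, rfl⟩
    have h1 : 0 ≤ b - c := by linarith [hc.2]
    exact mul_le_mul (Real.rpow_le_rpow h1 (by linarith [hc.1]) hδ.le) (hT c hc.1 hc.2.le)
      (hT0 c hc.1 hc.2.le) (Real.rpow_nonneg (by linarith) _)
  set m := sSup (V '' Ico a b) with hm
  have h1t : 0 < 1 - t := by linarith
  have hstep : ∀ c ∈ Ico a b, V c ≤ Y / (1 - t) ^ δ + θ ^ (1 / 2 : ℝ) * m := by
    intro c hc
    have hbc : 0 < b - c := by linarith [hc.2]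
    set d := c + (1 - t) * (b - c) with hd
    have hcd : c < d := by rw [hd]; nlinarith
    have hbd : b - d = t * (b - c) := by rw [hd]; ring
    have hdb : d < b := by nlinarith
    have h2 := h c d hc.1 hcd hdb.le
    have h3 : V d ≤ m := le_csSup hbdd ⟨d, ⟨hc.1.trans hcd.le, hdb⟩, rfl⟩
    have h4 : V d = t ^ δ * ((b - c) ^ δ * T d) := by
      simp only [hV]
      rw [hbd, Real.mul_rpow ht0.le hbc.le, mul_assoc]
    have h5 : d - c = (1 - t) * (b - c) := by rw [hd]; ring
    have hbcδ : 0 < (b - c) ^ δ := by positivity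
    have h6 := mul_le_mul_of_nonneg_left h2 hbcδ.le
    rw [h5, Real.mul_rpow h1t.le hbc.le] at h6
    refine h6.trans ?_
    have h7 : (b - c) ^ δ * (Y / ((1 - t) ^ δ * (b - c) ^ δ) + θ * T d)
        = Y / (1 - t) ^ δ + θ ^ (1 / 2 : ℝ) * V d := by
      rw [h4]
      conv_lhs => rw [htδ]
      have : 0 < (1 - t) ^ δ := by positivity
      field_simp
    rw [h7]
    exact add_le_add le_rfl (mul_le_mul_of_nonneg_left h3 (by positivity))
  have hm' : m ≤ Y / (1 - t) ^ δ + θ ^ (1 / 2 : ℝ) * m := csSup_le hne <| by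
    rintro _ ⟨c, hc, rfl⟩
    exact hstep c hc
  have hVa : V a ≤ m := le_csSup hbdd ⟨a, ⟨le_rfl, hab⟩, rfl⟩
  have hpos : 0 < (b - a) ^ δ := Real.rpow_pos_of_pos (by linarith) _
  have h1tδ : 0 < (1 - t) ^ δ := by positivity
  have h8 : m ≤ Y / (1 - t) ^ δ / (1 - θ ^ (1 / 2 : ℝ)) := by
    rw [le_div_iff₀ (by linarith)]
    linarith
  have h9 : T a * (b - a) ^ δ ≤ Y / (1 - t) ^ δ / (1 - θ ^ (1 / 2 : ℝ)) := by
    rw [mul_comm]; exact hVa.trans h8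
  rw [← le_div_iff₀ hpos] at h9
  refine h9.trans_eq ?_
  have : 1 - θ ^ (1 / 2 : ℝ) ≠ 0 := by linarith
  field_simp

end Iteration

end Grushin

namespace Grushin

/-! ### Mean value inequality for exponents away from one -/

section MeanValue

variable {n m : ℕ} {L : DegenerateOperator n m}

/-- The constant produced by the Moser iteration. -/
noncomputable def iterConst (n m : ℕ) (C₃ C₄ C₅ q κ : ℝ) : ℝ :=
  (stepConst n m C₅ * 2400 ^ stepDim C₃ C₄ q * κ) ^ (2 * q / (q - 2)) *
    ((2 ^ stepDim C₃ C₄ q * (q / 2)) ^ 2) ^ ∑' i : ℕ, (i : ℝ) * (1 / (q / 2)) ^ i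

theorem iterConst_pos {C₃ C₄ C₅ q κ : ℝ} (hC₅ : 0 ≤ C₅) (hq : 2 < q) (hκ : 1 ≤ κ) :
    0 < iterConst n m C₃ C₄ C₅ q κ := by
  have := one_le_stepConst (n := n) (m := m) hC₅
  have : 0 < stepConst n m C₅ := by linarith
  have : 0 < κ := by linarith
  have : 0 < q := by linarith
  unfold iterConst
  positivity

theorem aemeasurable_tildeFun {Ω : BoundedOpen n m} (f : HSpace L Ω) :
    AEMeasurable (tildeFun f) ((weightMeasure L.u).restrict Ω.carrier) :=
  (Lp.aestronglyMeasurable (tilde L Ω f)).aemeasurable.ennreal_ofReal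

theorem restrict_rect_le (hlam : IsGrushinFunction L.lam) (z₀ : Space n m) {h c : ℝ} (hh : 0 < h)
    (hc : 0 < c) (hc1 : c ≤ 1) : (weightMeasure L.u).restrict (rect L.lam z₀ (c * h)) ≤
      (weightMeasure L.u).restrict (rectOpen L.lam z₀ h).carrier :=
  Measure.restrict_mono (rect_mono hlam z₀ (by positivity) (by nlinarith)) le_rfl

/-- An exponent whose iterates `p kʲ` stay away from `1`. -/
def AvoidsOne (k κ p : ℝ) : Prop := ∀ j : ℕ, p * k ^ j ≠ 1 ∧ 1 / (2 * |p * k ^ j - 1|) ≤ κ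

/-- The mean value inequality for `f̃ + ε`, for the exponents whose iterates stay away from `1`. -/
theorem mean_value_of_avoidsOne {C₁ C₂ C₃ C₄ C₅ q : ℝ} (hn : 0 < n) (hC₅ : 0 ≤ C₅) (hq : 2 < q)
    (hL : Admissible C₁ C₂ C₃ C₄ C₅ q L) {z₀ : Space n m} {h : ℝ} (hh : 0 < h)
    {f : HSpace L (rectOpen L.lam z₀ h)} (hf : IsNonneg f) (hsol : IsWeakSolution f)
    {a b : ℝ} (ha : 0 < a) (hab : a < b) (hb : b ≤ 1) {p ε κ : ℝ} (hε : 0 < ε) (hκ : 1 ≤ κ)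
    (hp : AvoidsOne (q / 2) κ p) :
    ∀ᵐ z ∂((weightMeasure L.u).restrict (rect L.lam z₀ (a * h))),
      (tildeFun f z + ENNReal.ofReal ε) ^ p ≤
        ENNReal.ofReal (iterConst n m C₃ C₄ C₅ q κ /
            (b - a) ^ (stepDim C₃ C₄ q * (2 * q / (q - 2))) *
            (1 + |p| * muRatio L (rect L.lam z₀ h)) ^ (2 * q / (q - 2))) *
          ((weightMeasure L.u (rect L.lam z₀ h))⁻¹ * ∫⁻ z in rect L.lam z₀ (b * h),
            (tildeFun f z + ENNReal.ofReal ε) ^ p ∂(weightMeasure L.u)) := by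
  have hlam := L.isGrushin
  set U := weightMeasure L.u (rect L.lam z₀ h) with hU
  have hU0 : U ≠ 0 := (weightMeasure_rect_pos hn hlam L.weight_u hL.doubling_u z₀ hh).ne'
  have hUt : U ≠ ∞ := (L.weight_u.weightMeasure_rect_lt_top z₀ h).ne
  set M := muRatio L (rect L.lam z₀ h) with hM
  have hM0 : 0 ≤ M := by rw [hM]; unfold muRatio; positivity
  set k := q / 2 with hk
  have hk1 : 1 < k := by rw [hk]; linarith
  set A := stepConst n m C₅ with hA
  have hA1 : 1 ≤ A := one_le_stepConst hC₅
  set D := stepDim C₃ C₄ q with hD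
  have hD0 : 0 < D := stepDim_pos C₃ C₄ (by linarith)
  have hba : 0 < b - a := by linarith
  have hpM : 0 ≤ |p| * M := by positivity
  set X := A * (2400 / (b - a)) ^ D * κ * (1 + |p| * M) with hX
  have hbase : 1 ≤ (2400 / (b - a)) ^ D :=
    Real.one_le_rpow (by rw [one_le_div hba]; linarith) hD0.le
  have hX1 : 1 ≤ X := one_le_mul_of_one_le_of_one_le (one_le_mul_of_one_le_of_one_le
    (one_le_mul_of_one_le_of_one_le hA1 hbase) hκ) (by linarith)
  set τ := ((2 : ℝ) ^ D * k) ^ 2 with hτ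
  have hτ1 : 1 ≤ τ := one_le_pow₀ (one_le_mul_of_one_le_of_one_le
    (Real.one_le_rpow one_le_two hD0.le) hk1.le)
  have hmeas : AEMeasurable (fun z => (tildeFun f z + ENNReal.ofReal ε) ^ p)
      ((weightMeasure L.u).restrict (rect L.lam z₀ (a * h))) :=
    (((aemeasurable_tildeFun f).mono_measure (restrict_rect_le hlam z₀ hh ha
      (by linarith))).add_const _).pow_const p
  have hmain := moser_iteration (μ := weightMeasure L.u) (S := fun c => rect L.lam z₀ (c * h))
    (Z := X ^ 2) (τ := τ) hk1 (one_le_pow₀ hX1) hτ1 hU0 hUt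
    (fun c hc => rect_mono hlam z₀ (by positivity) (mul_le_mul_of_nonneg_right hc hh.le))
    hmeas hab (fun j c d hac hcd hdb hdiff => by
      have hs := reverse_holder_rpow hn hC₅ hq hL hh hf hsol (by linarith : 0 < c) hcd
        (hdb.trans hb) hε hκ (hp j).1 (hp j).2
      simp only [← ENNReal.rpow_mul]
      simp only [← ENNReal.rpow_mul] at hs
      refine hs.trans (mul_le_mul_left (ENNReal.ofReal_le_ofReal ?_) _)
      rw [hτ, ← pow_mul, mul_comm 2 j, pow_mul, ← mul_pow]
      have hkj : 1 ≤ k ^ j := one_le_pow₀ hk1.le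
      refine pow_le_pow_left₀ (by have : 0 < d - c := by linarith
                                  positivity) ?_ 2
      -- The gap at step j is (b - a)/2^(j+1): one factor 2 turns 1200 into 2400, the other j go
      -- into τ.
      have e1 : (1200 / (d - c)) ^ D = (2400 / (b - a)) ^ D * ((2 : ℝ) ^ D) ^ j := by
        rw [← Real.rpow_natCast (_ ^ D), ← Real.rpow_mul (by norm_num), mul_comm D,
          Real.rpow_mul (by norm_num), ← Real.mul_rpow (by positivity) (by positivity), hdiff,
          Real.rpow_natCast]
        congr 1
        field_simp
        ring
      have e2 : 1 + κ * |p * k ^ j| * M ≤ κ * k ^ j * (1 + |p| * M) := by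
        rw [abs_mul, abs_of_pos (by positivity : 0 < k ^ j)]
        have : 1 ≤ κ * k ^ j := one_le_mul_of_one_le_of_one_le hκ hkj
        linarith
      rw [e1]
      calc A * ((2400 / (b - a)) ^ D * ((2 : ℝ) ^ D) ^ j) * (1 + κ * |p * k ^ j| * M)
          ≤ A * ((2400 / (b - a)) ^ D * ((2 : ℝ) ^ D) ^ j) * (κ * k ^ j * (1 + |p| * M)) :=
            mul_le_mul_of_nonneg_left e2 (by positivity)
        _ = X * (2 ^ D * k) ^ j := by rw [hX, mul_pow]; ring)
  filter_upwards [hmain] with z hz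
  refine hz.trans_eq ?_
  congr 2
  have hq2 : q - 2 ≠ 0 := by linarith
  have he : ((2 : ℕ) : ℝ) * (k / (k - 1)) = 2 * q / (q - 2) := by
    rw [hk]
    have : q / 2 - 1 ≠ 0 := by rw [← hk]; linarith
    field_simp
    push_cast
    field_simp
  rw [← Real.rpow_natCast X, ← Real.rpow_mul (by linarith), he, iterConst, ← hk, hX, ← hA, ← hD, ← hτ,
    show A * (2400 / (b - a)) ^ D * κ * (1 + |p| * M)
      = A * 2400 ^ D * κ * ((b - a) ^ D)⁻¹ * (1 + |p| * M) by
        rw [Real.div_rpow (by norm_num) hba.le]; field_simp,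
    Real.mul_rpow (by positivity) (by linarith), Real.mul_rpow (by positivity) (by positivity),
    Real.inv_rpow (by positivity), ← Real.rpow_mul hba.le]
  field_simp

/-- All iterates are negative, hence at distance more than 1 from 1. -/
theorem avoidsOne_of_neg {k κ p : ℝ} (hk : 1 < k) (hκ : 1 ≤ κ) (hp : p < 0) :
    AvoidsOne k κ p := by
  intro j
  have h1 : p * k ^ j < 0 := mul_neg_of_neg_of_pos hp (by positivity)
  refine ⟨by linarith, ?_⟩
  rw [abs_of_neg (by linarith), div_le_iff₀ (by linarith)]
  nlinarith

/-- The lower bound for the reciprocal distance of `k ^ (i + 1 / 2)` to `1`. -/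
noncomputable def avoidConst (k : ℝ) : ℝ := max 1 (1 / (2 * (1 - k ^ (-(1 / 2) : ℝ))))

/-- The half-integer powers of k are stable under multiplication by k. Those below 1 are at most x =
k^(-1/2), and those above 1 are at least 1/x ≥ 2 - x, so all are at distance at least 1 - x from 1.
-/
theorem avoidsOne_rpow {k : ℝ} (hk : 1 < k) (i : ℤ) :
    AvoidsOne k (avoidConst k) (k ^ ((i : ℝ) + 1 / 2)) := by
  intro j
  have hk0 : 0 < k := by linarith
  have e : k ^ ((i : ℝ) + 1 / 2) * k ^ j = k ^ (((i + j : ℤ) : ℝ) + 1 / 2) := by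
    rw [← Real.rpow_natCast, ← Real.rpow_add hk0]
    congr 1
    push_cast
    ring
  rw [e]
  set l := i + (j : ℤ)
  set x := k ^ (-(1 / 2) : ℝ) with hx
  have hx1 : x < 1 := Real.rpow_lt_one_of_one_lt_of_neg hk (by norm_num)
  have hx0 : 0 < x := by positivity
  have key : 1 - x ≤ |k ^ ((l : ℝ) + 1 / 2) - 1| := by
    rcases le_or_gt 0 l with hl | hl
    · have hl' : (0 : ℝ) ≤ l := by exact_mod_cast hl
      have h1 : k ^ (1 / 2 : ℝ) ≤ k ^ ((l : ℝ) + 1 / 2) :=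
        Real.rpow_le_rpow_of_exponent_le hk.le (by linarith)
      have h2 : k ^ (1 / 2 : ℝ) * x = 1 := by
        rw [hx, ← Real.rpow_add hk0]; norm_num
      have h3 : 2 - x ≤ k ^ (1 / 2 : ℝ) := by
        by_contra hlt
        push Not at hlt
        nlinarith [sq_nonneg (1 - x)]
      exact le_trans (by linarith) (le_abs_self _)
    · have hl' : (l : ℝ) ≤ -1 := by exact_mod_cast (by omega : l ≤ -1)
      have h1 : k ^ ((l : ℝ) + 1 / 2) ≤ x :=
        Real.rpow_le_rpow_of_exponent_le hk.le (by linarith)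
      exact le_trans (by linarith) (neg_le_abs _)
  have hpos : 0 < |k ^ ((l : ℝ) + 1 / 2) - 1| := by linarith
  refine ⟨fun h => by rw [h] at hpos; simp at hpos, ?_⟩
  refine le_trans ?_ (le_max_right _ _)
  exact one_div_le_one_div_of_le (by linarith) (by linarith)

/-- The half-integer powers of k form a geometric progression of ratio k, so one of them lies
between p and kp. -/
theorem exists_avoidsOne {k p : ℝ} (hk : 1 < k) (hp : 0 < p) :
    ∃ p', p ≤ p' ∧ p' ≤ k * p ∧ AvoidsOne k (avoidConst k) p' := by
  have hk0 : 0 < k := by linarith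
  obtain ⟨i, hi, hi'⟩ := exists_mem_Ico_zpow (x := p * k ^ (1 / 2 : ℝ)) (by positivity) hk
  have hs : 0 < k ^ (1 / 2 : ℝ) := by positivity
  have hss : k ^ (1 / 2 : ℝ) * k ^ (1 / 2 : ℝ) = k := by
    rw [← Real.rpow_add hk0]; norm_num
  have e : k ^ ((i : ℝ) + 1 / 2) * k ^ (1 / 2 : ℝ) = k ^ (i + 1) := by
    rw [← Real.rpow_add hk0, ← Real.rpow_intCast]
    congr 1
    push_cast
    ring
  refine ⟨k ^ ((i : ℝ) + 1 / 2), ?_, ?_, avoidsOne_rpow hk i⟩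
  · rw [← mul_le_mul_iff_left₀ hs, e]
    exact hi'.le
  · rw [Real.rpow_add hk0, Real.rpow_intCast]
    calc k ^ i * k ^ (1 / 2 : ℝ) ≤ p * k ^ (1 / 2 : ℝ) * k ^ (1 / 2 : ℝ) :=
          mul_le_mul_of_nonneg_right hi hs.le
      _ = k * p := by rw [mul_assoc, hss, mul_comm]

end MeanValue

end Grushin

namespace Grushin

/-! ### Removing the shift and lowering the exponent -/

section Measure

variable {α : Type*} [MeasurableSpace α] {μ ν : Measure α} {W : α → ℝ≥0∞}

theorem tendsto_ofReal_one_div_add_one :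
    Tendsto (fun j : ℕ => ENNReal.ofReal (1 / ((j : ℝ) + 1))) atTop (𝓝 0) := by
  simpa using ENNReal.tendsto_ofReal tendsto_one_div_add_atTop_nhds_zero_nat

/-- Undoing the decreasing power turns the hypothesis into R^(1/p) ≤ W + 1/(j + 1), where the limit
is immediate. -/
theorem essInf_rpow_le_of_forall_add {p : ℝ} (hp : p < 0) {R : ℝ≥0∞}
    (h : ∀ j : ℕ, ∀ᵐ z ∂μ, (W z + ENNReal.ofReal (1 / ((j : ℝ) + 1))) ^ p ≤ R) :
    essInf W μ ^ p ≤ R := by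
  have h1 : ∀ᵐ z ∂μ, R ^ p⁻¹ ≤ W z := by
    filter_upwards [ae_all_iff.2 h] with z hz
    have hlim : Tendsto (fun j : ℕ => W z + ENNReal.ofReal (1 / ((j : ℝ) + 1))) atTop
        (𝓝 (W z)) := by
      simpa using tendsto_const_nhds.add tendsto_ofReal_one_div_add_one
    refine ge_of_tendsto' hlim fun j => ?_
    have := ENNReal.rpow_le_rpow_of_neg (inv_lt_zero.2 hp) (hz j)
    rwa [ENNReal.rpow_rpow_inv hp.ne] at this
  have h2 := ENNReal.rpow_le_rpow_of_neg hp (le_essInf_of_ae_le _ h1)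
  rwa [ENNReal.rpow_inv_rpow hp.ne] at h2

/-- If the integral of W^p is infinite there is nothing to prove; otherwise 2^p (W^p + 1) dominates,
as the shifts are at most 1 and ν is finite. -/
theorem essSup_rpow_le_of_forall_add [IsFiniteMeasure ν] (hW : AEMeasurable W ν) {p : ℝ}
    (hp : 0 < p) {K U : ℝ≥0∞} (hK : K ≠ 0) (hK' : K ≠ ∞) (hU0 : U ≠ 0) (hU : U ≠ ∞)
    (h : ∀ j : ℕ, essSup (fun z => W z + ENNReal.ofReal (1 / ((j : ℝ) + 1))) μ ^ p ≤
      K * (U⁻¹ * ∫⁻ z, (W z + ENNReal.ofReal (1 / ((j : ℝ) + 1))) ^ p ∂ν)) :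
    essSup W μ ^ p ≤ K * (U⁻¹ * ∫⁻ z, W z ^ p ∂ν) := by
  rcases eq_or_ne (∫⁻ z, W z ^ p ∂ν) ∞ with hI | hI
  · rw [hI, ENNReal.mul_top (ENNReal.inv_ne_zero.2 hU), ENNReal.mul_top hK]
    exact le_top
  have hlim : Tendsto (fun j : ℕ => ∫⁻ z, (W z + ENNReal.ofReal (1 / ((j : ℝ) + 1))) ^ p ∂ν) atTop
      (𝓝 (∫⁻ z, W z ^ p ∂ν)) := by
    refine tendsto_lintegral_of_dominated_convergence' (fun z => 2 ^ p * (W z ^ p + 1))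
      (fun j => (hW.add_const _).pow_const p) (fun j => ae_of_all _ fun z => ?_) ?_
      (ae_of_all _ fun z => ?_)
    · have h1 : ENNReal.ofReal (1 / ((j : ℝ) + 1)) ≤ 1 := by
        rw [ENNReal.ofReal_le_one, div_le_one (by positivity)]
        linarith [Nat.cast_nonneg (α := ℝ) j]
      rcases le_total (W z) 1 with h2 | h2
      · calc (W z + ENNReal.ofReal (1 / ((j : ℝ) + 1))) ^ p ≤ 2 ^ p :=
              ENNReal.rpow_le_rpow ((add_le_add h2 h1).trans_eq one_add_one_eq_two) hp.le
          _ ≤ 2 ^ p * (W z ^ p + 1) := le_mul_of_one_le_right' le_add_self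
      · calc (W z + ENNReal.ofReal (1 / ((j : ℝ) + 1))) ^ p ≤ (2 * W z) ^ p :=
              ENNReal.rpow_le_rpow ((add_le_add le_rfl (h1.trans h2)).trans_eq (two_mul _).symm)
                hp.le
          _ = 2 ^ p * W z ^ p := ENNReal.mul_rpow_of_nonneg _ _ hp.le
          _ ≤ 2 ^ p * (W z ^ p + 1) := by gcongr; exact le_self_add
    · rw [lintegral_const_mul' _ _ (ENNReal.rpow_ne_top_of_nonneg hp.le (by simp)),
        lintegral_add_right _ measurable_const, lintegral_const, one_mul]
      exact ENNReal.mul_ne_top (ENNReal.rpow_ne_top_of_nonneg hp.le (by simp))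
        (ENNReal.add_ne_top.2 ⟨hI, measure_ne_top _ _⟩)
    · have : Tendsto (fun j : ℕ => W z + ENNReal.ofReal (1 / ((j : ℝ) + 1))) atTop
          (𝓝 (W z)) := by
        simpa using tendsto_const_nhds.add tendsto_ofReal_one_div_add_one
      exact (ENNReal.continuous_rpow_const.tendsto _).comp this
  refine ge_of_tendsto' (ENNReal.Tendsto.const_mul (ENNReal.Tendsto.const_mul hlim
    (Or.inr (ENNReal.inv_ne_top.2 hU0))) (Or.inr hK')) fun j => le_trans ?_ (h j)
  exact ENNReal.rpow_le_rpow (essSup_mono_ae (ae_of_all _ fun z => le_self_add)) hp.le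

/-- The constant of the absorption argument with the factor `θ`. -/
noncomputable def absorbConst (δ θ : ℝ) : ℝ :=
  1 / ((1 - θ ^ (1 / (2 * δ))) ^ δ * (1 - θ ^ (1 / 2 : ℝ)))

theorem absorbConst_pos {δ θ : ℝ} (hδ : 0 < δ) (hθ : 0 < θ) (hθ1 : θ < 1) :
    0 < absorbConst δ θ := by
  have h1 : θ ^ (1 / (2 * δ)) < 1 := Real.rpow_lt_one hθ.le hθ1 (by positivity)
  have h2 : θ ^ (1 / 2 : ℝ) < 1 := Real.rpow_lt_one hθ.le hθ1 (by norm_num)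
  have h3 : 0 < 1 - θ ^ (1 / (2 * δ)) := by linarith
  have h4 : 0 < 1 - θ ^ (1 / 2 : ℝ) := by linarith
  unfold absorbConst
  positivity

/-- A mean value inequality for one exponent implies one for every smaller positive exponent. -/
theorem essSup_rpow_le_of_mean_value {S : ℝ → Set α} {Q : Set α} {U : ℝ≥0∞}
    {a b p p' k X δ : ℝ} (hp : 0 < p) (hpp' : p ≤ p') (hp'k : p' ≤ k * p) (hk : 1 < k) (hX : 0 < X)
    (hδ : 0 < δ) (hab : a < b) (hSb : S b ⊆ Q)
    (hS : ∀ c, a ≤ c → c ≤ b → S c ⊆ S b) (hfin : essSup W (μ.restrict (S b)) ≠ ∞)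
    (h : ∀ c d, a ≤ c → c < d → d ≤ b → ∀ᵐ z ∂(μ.restrict (S c)),
      W z ^ p' ≤ ENNReal.ofReal (X / (d - c) ^ δ) * (U⁻¹ * ∫⁻ z in S d, W z ^ p' ∂μ)) :
    essSup W (μ.restrict (S a)) ^ p ≤
      ENNReal.ofReal (absorbConst δ (1 - 1 / k) * (X / (b - a) ^ δ)) *
        (U⁻¹ * ∫⁻ z in Q, W z ^ p ∂μ) := by
  have hk0 : 0 < k := by linarith
  have hp' : 0 < p' := by linarith
  have hθ : 0 < 1 - 1 / k := by rw [sub_pos, div_lt_one hk0]; exact hk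
  have hθ1 : 1 - 1 / k < 1 := by linarith [one_div_pos.2 hk0]
  have hA := absorbConst_pos hδ hθ hθ1
  have hba : 0 < b - a := by linarith
  set I := U⁻¹ * ∫⁻ z in Q, W z ^ p ∂μ with hI
  rcases eq_or_ne I ∞ with hIt | hIt
  · rw [hIt, ENNReal.mul_top (by rw [ne_eq, ENNReal.ofReal_eq_zero, not_le]; positivity)]
    exact le_top
  set s : ℝ → ℝ≥0∞ := fun c => essSup W (μ.restrict (S c)) with hs
  have hsb : ∀ c, a ≤ c → c ≤ b → s c ≤ s b := fun c hc hc' =>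
    essSup_mono_measure' (Measure.restrict_mono (hS c hc hc') le_rfl)
  have hst : ∀ c, a ≤ c → c ≤ b → s c ≠ ∞ := fun c hc hc' => ne_top_of_le_ne_top hfin (hsb c hc hc')
  -- In the integral of W^p' the factor W^(p'-p) is replaced by its essential supremum over S(d).
  have hstep : ∀ c d, a ≤ c → c < d → d ≤ b →
      s c ^ p' ≤ ENNReal.ofReal (X / (d - c) ^ δ) * I * s d ^ (p' - p) := by
    intro c d hac hcd hdb
    have h1 : ∫⁻ z in S d, W z ^ p' ∂μ ≤ (∫⁻ z in Q, W z ^ p ∂μ) * s d ^ (p' - p) := by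
      calc ∫⁻ z in S d, W z ^ p' ∂μ ≤ ∫⁻ z in S d, W z ^ p * s d ^ (p' - p) ∂μ := by
            refine lintegral_mono_ae ?_
            filter_upwards [ENNReal.ae_le_essSup (μ := μ.restrict (S d)) W] with z hz
            rw [show p' = p + (p' - p) by ring, ENNReal.rpow_add_of_nonneg _ _ hp.le (by linarith),
              add_sub_cancel_left]
            gcongr
        _ = (∫⁻ z in S d, W z ^ p ∂μ) * s d ^ (p' - p) :=
            lintegral_mul_const' _ _ (ENNReal.rpow_ne_top_of_nonneg (by linarith)
              (hst d (by linarith) hdb))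
        _ ≤ _ := by
            gcongr
            exact (hS d (by linarith) hdb).trans hSb
    have h2 : s c ≤ (ENNReal.ofReal (X / (d - c) ^ δ) * I * s d ^ (p' - p)) ^ p'⁻¹ := by
      refine essSup_le_of_ae_le _ ?_
      filter_upwards [h c d hac hcd hdb] with z hz
      rw [ENNReal.le_rpow_inv_iff hp']
      refine hz.trans ?_
      rw [hI, mul_assoc, mul_assoc]
      gcongr
    rwa [ENNReal.le_rpow_inv_iff hp'] at h2
  have habs := le_of_forall_le_add_mul (T := fun c => (s c).toReal ^ p) (Y := X * I.toReal) hab hδ hθ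
    hθ1 (fun c _ _ => by positivity) (fun c hc hc' => Real.rpow_le_rpow ENNReal.toReal_nonneg
      (ENNReal.toReal_mono hfin (hsb c hc hc')) hp.le) (fun c d hac hcd hdb => by
      have hdc : 0 < d - c := by linarith
      have h1 := ENNReal.toReal_mono (ENNReal.mul_ne_top (ENNReal.mul_ne_top ENNReal.ofReal_ne_top
        hIt) (ENNReal.rpow_ne_top_of_nonneg (by linarith) (hst d (by linarith) hdb)))
        (hstep c d hac hcd hdb)
      rw [ENNReal.toReal_mul, ENNReal.toReal_mul, ENNReal.toReal_ofReal (by positivity),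
        ← ENNReal.toReal_rpow, ← ENNReal.toReal_rpow] at h1
      set x := (s c).toReal
      set y := (s d).toReal
      set w := X / (d - c) ^ δ * I.toReal with hw
      have hx : 0 ≤ x := ENNReal.toReal_nonneg
      have hy : 0 ≤ y := ENNReal.toReal_nonneg
      have hw0 : 0 ≤ w := by positivity
      have hσ : p / p' ≤ 1 := (div_le_one hp').2 hpp'
      have hσk : 1 / k ≤ p / p' := by
        rw [div_le_div_iff₀ hk0 hp']; linarith
      -- Take the power p/p' and then the weighted geometric–arithmetic mean inequality. As p' ≤ kp,
      -- the weight of y^p is at most 1 - 1/k, an absorption factor independent of p.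
      have h2 : x ^ p ≤ w ^ (p / p') * (y ^ p) ^ (1 - p / p') := by
        have := Real.rpow_le_rpow (by positivity) h1 (by positivity : 0 ≤ p / p')
        rw [Real.mul_rpow hw0 (by positivity), ← Real.rpow_mul hx, ← Real.rpow_mul hy] at this
        rw [← Real.rpow_mul hy]
        refine (le_of_eq ?_).trans (this.trans_eq ?_)
        · congr 1; field_simp
        · congr 2; field_simp
      have h3 := Real.geom_mean_le_arith_mean2_weighted (w₁ := p / p') (w₂ := 1 - p / p')
        (p₁ := w) (p₂ := y ^ p) (by positivity) (by linarith) hw0 (by positivity) (by ring)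
      have h4 : p / p' * w ≤ w := mul_le_of_le_one_left hw0 hσ
      have h5 : (1 - p / p') * y ^ p ≤ (1 - 1 / k) * y ^ p :=
        mul_le_mul_of_nonneg_right (by linarith) (by positivity)
      have h6 : X * I.toReal / (d - c) ^ δ = w := by rw [hw]; ring
      rw [h6]
      linarith)
  have hsa := hst a le_rfl hab.le
  calc s a ^ p = ENNReal.ofReal ((s a).toReal ^ p) := by
        rw [← ENNReal.ofReal_rpow_of_nonneg ENNReal.toReal_nonneg hp.le, ENNReal.ofReal_toReal hsa]
    _ ≤ ENNReal.ofReal (absorbConst δ (1 - 1 / k) * (X * I.toReal / (b - a) ^ δ)) :=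
        ENNReal.ofReal_le_ofReal habs
    _ = ENNReal.ofReal (absorbConst δ (1 - 1 / k) * (X / (b - a) ^ δ)) * I := by
        rw [show absorbConst δ (1 - 1 / k) * (X * I.toReal / (b - a) ^ δ)
          = absorbConst δ (1 - 1 / k) * (X / (b - a) ^ δ) * I.toReal by ring,
          ENNReal.ofReal_mul (by positivity), ENNReal.ofReal_toReal hIt]

end Measure

/-! ### Mean value inequality for all nonzero exponents -/

section MeanValue

variable {n m : ℕ} {L : DegenerateOperator n m}

/-- The inequality for f̃ + 1/(j + 1) applies directly with b = 1. As p < 0, the shift only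
decreases the integrand on the right, so the limit concerns the left side alone. -/
theorem mean_value_of_neg {C₁ C₂ C₃ C₄ C₅ q : ℝ} (hn : 0 < n) (hC₅ : 0 ≤ C₅) (hq : 2 < q)
    (hL : Admissible C₁ C₂ C₃ C₄ C₅ q L) {z₀ : Space n m} {h : ℝ} (hh : 0 < h)
    {f : HSpace L (rectOpen L.lam z₀ h)} (hf : IsNonneg f) (hsol : IsWeakSolution f)
    {a : ℝ} (ha : 0 < a) (ha1 : a < 1) {p : ℝ} (hp : p < 0) :
    essInf (tildeFun f) ((weightMeasure L.u).restrict (rect L.lam z₀ (a * h))) ^ p ≤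
      ENNReal.ofReal (iterConst n m C₃ C₄ C₅ q 1 /
          (1 - a) ^ (stepDim C₃ C₄ q * (2 * q / (q - 2))) *
          (1 + |p| * muRatio L (rect L.lam z₀ h)) ^ (2 * q / (q - 2))) *
        ((weightMeasure L.u (rect L.lam z₀ h))⁻¹ *
          ∫⁻ z in rect L.lam z₀ h, tildeFun f z ^ p ∂(weightMeasure L.u)) := by
  refine essInf_rpow_le_of_forall_add hp fun j => ?_
  filter_upwards [mean_value_of_avoidsOne hn hC₅ hq hL hh hf hsol ha ha1 le_rfl
    (by positivity : 0 < 1 / ((j : ℝ) + 1)) le_rfl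
    (avoidsOne_of_neg (by linarith : 1 < q / 2) le_rfl hp)] with z hz
  rw [one_mul] at hz
  refine hz.trans ?_
  refine mul_le_mul_right (mul_le_mul_right (lintegral_mono fun z => ?_) _) _
  exact ENNReal.rpow_le_rpow_of_neg hp le_self_add

theorem essInf_tildeFun_le_essSup (hn : 0 < n) {C : ℝ} (hdbl : IsRhoDoubling C L.lam L.u)
    {Ω : BoundedOpen n m} (f : HSpace L Ω) (z₀ : Space n m) {r : ℝ} (hr : 0 < r) :
    essInf (tildeFun f) ((weightMeasure L.u).restrict (rect L.lam z₀ r)) ≤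
      essSup (tildeFun f) ((weightMeasure L.u).restrict (rect L.lam z₀ r)) := by
  have : (ae ((weightMeasure L.u).restrict (rect L.lam z₀ r))).NeBot := by
    rw [ae_neBot, ne_eq, Measure.restrict_eq_zero]
    exact (weightMeasure_rect_pos hn L.isGrushin L.weight_u hdbl z₀ hr).ne'
  exact liminf_le_limsup

/-- For p ≤ 2 the integrand is at most 1 plus a square, and f̃ ∈ L²(u) with u(Ω) finite. This starts
the a priori bound of the supremum. -/
theorem lintegral_tildeFun_add_rpow_lt_top {Ω : BoundedOpen n m} (f : HSpace L Ω) {p ε : ℝ}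
    (hp : 0 < p) (hp2 : p ≤ 2) :
    ∫⁻ z in Ω.carrier, (tildeFun f z + ENNReal.ofReal ε) ^ p ∂(weightMeasure L.u) < ∞ := by
  have h2 : MemLp (fun z => |tilde L Ω f z| + |ε|) 2 ((weightMeasure L.u).restrict Ω.carrier) :=
    (Lp.memLp (tilde L Ω f)).abs.add (memLp_const _)
  have h3 : ∫⁻ z in Ω.carrier, (1 + ENNReal.ofReal ((|tilde L Ω f z| + |ε|) ^ 2))
      ∂(weightMeasure L.u) < ∞ := by
    rw [lintegral_add_left measurable_const, lintegral_const, one_mul]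
    exact ENNReal.add_lt_top.2 ⟨measure_lt_top _ _, h2.integrable_sq.lintegral_lt_top⟩
  refine lt_of_le_of_lt (lintegral_mono fun z => ?_) h3
  have h4 : tildeFun f z + ENNReal.ofReal ε ≤ ENNReal.ofReal (|tilde L Ω f z| + |ε|) := by
    rw [ENNReal.ofReal_add (abs_nonneg _) (abs_nonneg _)]
    exact add_le_add (ENNReal.ofReal_le_ofReal (le_abs_self _))
      (ENNReal.ofReal_le_ofReal (le_abs_self _))
  have h5 : 0 ≤ |tilde L Ω f z| + |ε| := by positivity
  refine (ENNReal.rpow_le_rpow h4 hp.le).trans ?_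
  rw [ENNReal.ofReal_rpow_of_nonneg h5 hp.le]
  rcases le_total (|tilde L Ω f z| + |ε|) 1 with h6 | h6
  · exact le_add_right (ENNReal.ofReal_le_one.2 (Real.rpow_le_one h5 h6 hp.le))
  · refine le_add_left (ENNReal.ofReal_le_ofReal ?_)
    rw [← Real.rpow_natCast]
    exact Real.rpow_le_rpow_of_exponent_le h6 (by exact_mod_cast hp2)

/-- The constant of the mean value inequality for positive exponents. -/
noncomputable def posConst (n m : ℕ) (C₃ C₄ C₅ q : ℝ) : ℝ :=
  absorbConst (stepDim C₃ C₄ q * (2 * q / (q - 2))) (1 - 1 / (q / 2)) *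
    (iterConst n m C₃ C₄ C₅ q (avoidConst (q / 2)) * (q / 2) ^ (2 * q / (q - 2)) *
      2 ^ (stepDim C₃ C₄ q * (2 * q / (q - 2))))

theorem posConst_pos {C₃ C₄ C₅ q : ℝ} (hC₅ : 0 ≤ C₅) (hq : 2 < q) :
    0 < posConst n m C₃ C₄ C₅ q := by
  have h1 := iterConst_pos (n := n) (m := m) (C₃ := C₃) (C₄ := C₄) (κ := avoidConst (q / 2)) hC₅ hq
    (le_max_left _ _)
  have hD := stepDim_pos C₃ C₄ (by linarith : 0 < q)
  have hq0 : 0 < q := by linarith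
  have hq2 : 0 < q - 2 := by linarith
  have h2 : 0 < absorbConst (stepDim C₃ C₄ q * (2 * q / (q - 2))) (1 - 1 / (q / 2)) := by
    refine absorbConst_pos (by positivity) ?_ (by linarith [one_div_pos.2 (half_pos hq0)])
    rw [sub_pos, div_lt_one (by positivity)]
    linarith
  unfold posConst
  positivity

theorem mean_value_of_pos {C₁ C₂ C₃ C₄ C₅ q : ℝ} (hn : 0 < n) (hC₅ : 0 ≤ C₅) (hq : 2 < q)
    (hL : Admissible C₁ C₂ C₃ C₄ C₅ q L) {z₀ : Space n m} {h : ℝ} (hh : 0 < h)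
    {f : HSpace L (rectOpen L.lam z₀ h)} (hf : IsNonneg f) (hsol : IsWeakSolution f)
    {a : ℝ} (ha : 0 < a) (ha1 : a < 1) {p : ℝ} (hp : 0 < p) :
    essSup (tildeFun f) ((weightMeasure L.u).restrict (rect L.lam z₀ (a * h))) ^ p ≤
      ENNReal.ofReal (posConst n m C₃ C₄ C₅ q /
          (1 - a) ^ (stepDim C₃ C₄ q * (2 * q / (q - 2))) *
          (1 + |p| * muRatio L (rect L.lam z₀ h)) ^ (2 * q / (q - 2))) *
        ((weightMeasure L.u (rect L.lam z₀ h))⁻¹ *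
          ∫⁻ z in rect L.lam z₀ h, tildeFun f z ^ p ∂(weightMeasure L.u)) := by
  have hq0 : 0 < q := by linarith
  have hq2 : 0 < q - 2 := by linarith
  have hU0 := (weightMeasure_rect_pos hn L.isGrushin L.weight_u hL.doubling_u z₀ hh).ne'
  have hU := (L.weight_u.weightMeasure_rect_lt_top (lam := L.lam) z₀ h).ne
  have hM : 0 ≤ muRatio L (rect L.lam z₀ h) := by unfold muRatio; positivity
  have hC := posConst_pos (n := n) (m := m) (C₃ := C₃) (C₄ := C₄) hC₅ hq
  have hD := stepDim_pos C₃ C₄ hq0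
  have hk : 1 < q / 2 := by linarith
  have hκ : 1 ≤ avoidConst (q / 2) := le_max_left _ _
  have hIC := iterConst_pos (n := n) (m := m) (C₃ := C₃) (C₄ := C₄) hC₅ hq hκ
  have h1a : 0 < 1 - a := by linarith
  refine essSup_rpow_le_of_forall_add (ν := (weightMeasure L.u).restrict (rectOpen L.lam z₀ h).carrier)
    (aemeasurable_tildeFun f) hp (by rw [ne_eq, ENNReal.ofReal_eq_zero, not_le]; positivity)
    ENNReal.ofReal_ne_top hU0 hU fun j => ?_
  have hε : 0 < 1 / ((j : ℝ) + 1) := by positivity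
  -- Starting from 2/k yields an admissible exponent r ≤ 2, used only to show that the supremum is
  -- finite.
  obtain ⟨r, hr, hr2, hravoid⟩ := exists_avoidsOne hk (by positivity : 0 < 2 / (q / 2))
  obtain ⟨p', hpp', hp'k, havoid⟩ := exists_avoidsOne hk hp
  have hr0 : 0 < r := lt_of_lt_of_le (by positivity) hr
  have hr2' : r ≤ 2 := hr2.trans_eq (by field_simp)
  have hb1 : (1 + a) / 2 < 1 := by linarith
  have hmono : ∀ c d, 0 < c → c ≤ d → rect L.lam z₀ (c * h) ⊆ rect L.lam z₀ (d * h) :=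
    fun c d hc hcd => rect_mono L.isGrushin z₀ (by positivity)
      (mul_le_mul_of_nonneg_right hcd hh.le)
  have hbQ : rect L.lam z₀ ((1 + a) / 2 * h) ⊆ rect L.lam z₀ h := by
    simpa using hmono ((1 + a) / 2) 1 (by linarith) hb1.le
  -- Finiteness is obtained on the intermediate rectangle of ratio (1 + a)/2, strictly inside Q;
  -- absorption then runs between a and (1 + a)/2. Halving the gap accounts for the power of 2 in
  -- `posConst`.
  have hfin : essSup (fun z => tildeFun f z + ENNReal.ofReal (1 / ((j : ℝ) + 1)))
      ((weightMeasure L.u).restrict (rect L.lam z₀ ((1 + a) / 2 * h))) ≠ ∞ := by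
    have h1 := mean_value_of_avoidsOne hn hC₅ hq hL hh hf hsol (by linarith) hb1 le_rfl hε hκ
      hravoid
    rw [one_mul] at h1
    have h2 := (lintegral_tildeFun_add_rpow_lt_top f (ε := 1 / ((j : ℝ) + 1)) hr0 hr2').ne
    refine ne_top_of_le_ne_top ?_ (essSup_le_of_ae_le _ (h1.mono fun z hz =>
      (ENNReal.le_rpow_inv_iff hr0).2 hz))
    exact ENNReal.rpow_ne_top_of_nonneg (by positivity) (ENNReal.mul_ne_top ENNReal.ofReal_ne_top
      (ENNReal.mul_ne_top (ENNReal.inv_ne_top.2 hU0) h2))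
  -- Since p' ≤ (q/2) p, passing from p' to p in this factor costs only a power of q/2.
  have hX : iterConst n m C₃ C₄ C₅ q (avoidConst (q / 2)) *
      (1 + |p'| * muRatio L (rect L.lam z₀ h)) ^ (2 * q / (q - 2)) ≤
      iterConst n m C₃ C₄ C₅ q (avoidConst (q / 2)) * (q / 2) ^ (2 * q / (q - 2)) *
      (1 + |p| * muRatio L (rect L.lam z₀ h)) ^ (2 * q / (q - 2)) := by
    rw [mul_assoc, ← Real.mul_rpow (by positivity) (by positivity)]
    refine mul_le_mul_of_nonneg_left (Real.rpow_le_rpow (by positivity) ?_ (by positivity)) hIC.le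
    rw [abs_of_pos hp, abs_of_pos (hp.trans_le hpp')]
    nlinarith [mul_le_mul_of_nonneg_right hp'k hM]
  have hmain := essSup_rpow_le_of_mean_value (μ := weightMeasure L.u)
    (W := fun z => tildeFun f z + ENNReal.ofReal (1 / ((j : ℝ) + 1)))
    (S := fun c => rect L.lam z₀ (c * h)) (Q := rect L.lam z₀ h)
    (U := weightMeasure L.u (rect L.lam z₀ h)) (a := a) (b := (1 + a) / 2)
    (X := iterConst n m C₃ C₄ C₅ q (avoidConst (q / 2)) * (q / 2) ^ (2 * q / (q - 2)) *
      (1 + |p| * muRatio L (rect L.lam z₀ h)) ^ (2 * q / (q - 2)))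
    (δ := stepDim C₃ C₄ q * (2 * q / (q - 2))) hp hpp' hp'k hk (by positivity) (by positivity)
    (by linarith) hbQ (fun c hc hc' => hmono c _ (by linarith) hc') hfin
    (fun c d hac hcd hdb => by
      filter_upwards [mean_value_of_avoidsOne hn hC₅ hq hL hh hf hsol (by linarith : 0 < c) hcd
        (hdb.trans hb1.le) hε hκ havoid] with z hz
      refine hz.trans ?_
      have : 0 < d - c := by linarith
      gcongr ENNReal.ofReal ?_ * _
      rw [div_mul_eq_mul_div]
      gcongr)
  refine hmain.trans_eq ?_
  congr 2
  rw [posConst, show (1 + a) / 2 - a = (1 - a) / 2 by ring, Real.div_rpow h1a.le (by norm_num)]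
  field_simp

end MeanValue

end Grushin

theorem proposition4p4 (n m : ℕ) (hn : 0 < n) (hm : 0 < m) (C₁ C₂ C₃ C₄ C₅ q : ℝ)
    (hC₃ : 0 < C₃) (hC₄ : 0 < C₄) (hC₅ : 0 < C₅) (hq : 2 < q) :
    ∃ C δ : ℝ, 0 < C ∧ 0 < δ ∧
      ∀ L : DegenerateOperator n m, Admissible C₁ C₂ C₃ C₄ C₅ q L →
      ∀ (z₀ : Space n m) (h : ℝ), 0 < h →
      ∀ f : HSpace L (rectOpen L.lam z₀ h), IsNonneg f → IsWeakSolution f →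
      ∀ a : ℝ, 1 / 2 ≤ a → a < 1 → ∀ p : ℝ, p ≠ 0 →
        (essSup (tildeFun f) ((weightMeasure L.u).restrict (rect L.lam z₀ (a * h)))) ^ p ≤
          ENNReal.ofReal (C / (1 - a) ^ δ *
              (1 + |p| * muRatio L (rect L.lam z₀ h)) ^ (2 * q / (q - 2))) *
            ((weightMeasure L.u (rect L.lam z₀ h))⁻¹ *
              ∫⁻ z in rect L.lam z₀ h, tildeFun f z ^ p ∂(weightMeasure L.u)) ∧
        (p < 0 →
          (essInf (tildeFun f) ((weightMeasure L.u).restrict (rect L.lam z₀ (a * h)))) ^ p ≤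
            ENNReal.ofReal (C / (1 - a) ^ δ *
                (1 + |p| * muRatio L (rect L.lam z₀ h)) ^ (2 * q / (q - 2))) *
              ((weightMeasure L.u (rect L.lam z₀ h))⁻¹ *
                ∫⁻ z in rect L.lam z₀ h, tildeFun f z ^ p ∂(weightMeasure L.u))) := by
  have hq0 : 0 < q := by linarith
  have hq2 : 0 < q - 2 := by linarith
  have h1 := iterConst_pos (n := n) (m := m) (C₃ := C₃) (C₄ := C₄) hC₅.le hq (le_refl (1 : ℝ))
  have h2 := posConst_pos (n := n) (m := m) (C₃ := C₃) (C₄ := C₄) hC₅.le hq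
  have h3 := stepDim_pos C₃ C₄ hq0
  refine ⟨iterConst n m C₃ C₄ C₅ q 1 + posConst n m C₃ C₄ C₅ q,
    stepDim C₃ C₄ q * (2 * q / (q - 2)), by positivity, by positivity, ?_⟩
  intro L hL z₀ h hh f hf hsol a ha ha1 p hp
  have ha0 : 0 < a := by linarith
  have h1a : 0 < 1 - a := by linarith
  have hM : 0 ≤ muRatio L (rect L.lam z₀ h) := by unfold muRatio; positivity
  have hinf : p < 0 → essInf (tildeFun f)
      ((weightMeasure L.u).restrict (rect L.lam z₀ (a * h))) ^ p ≤ _ := fun hneg =>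
    (mean_value_of_neg hn hC₅.le hq hL hh hf hsol ha0 ha1 hneg).trans
      (mul_le_mul_left (ENNReal.ofReal_le_ofReal (mul_le_mul_of_nonneg_right
        (div_le_div_of_nonneg_right (le_add_of_nonneg_right h2.le) (by positivity))
        (by positivity))) _)
  refine ⟨?_, hinf⟩
  -- For p < 0 the power reverses the order, so the bound for the infimum implies the one for the
  -- supremum; the positive mass of aQ ensures that infimum and supremum are ordered.
  rcases lt_or_gt_of_ne hp with hneg | hpos
  · exact (ENNReal.rpow_le_rpow_of_neg hneg (essInf_tildeFun_le_essSup hn hL.doubling_u f z₀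
      (by positivity))).trans (hinf hneg)
  · exact (mean_value_of_pos hn hC₅.le hq hL hh hf hsol ha0 ha1 hpos).trans
      (mul_le_mul_left (ENNReal.ofReal_le_ofReal (mul_le_mul_of_nonneg_right
        (div_le_div_of_nonneg_right (le_add_of_nonneg_left h1.le) (by positivity))
        (by positivity))) _)
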